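/- **Setting.** Let $d\ge 2$ and let $\Omega\subset\mathbb R^d$ be a bounded open set with boundary of class $C^k$, $k\ge 1$. Fix a finite $C^k$ atlas of $\partial\Omega$ with a subordinate smooth partition of unity; it defines the norms of the (Slobodeckij) spaces $W^{s,p}(\partial\Omega)$, $0<s\le k$, $1\le p\le\infty$. Let $s_b\ge 1$. Assume that there is an injective map $\Xi:[0,1]\times[-1,1]^{d-1}\to\overline\Omega$ such that $\Xi$ and $\Xi^{-1}$ (on the range of $\Xi$) are of class $C^{s_b}$ with finite norms, and $\Xi(0,w),\Xi(1,w)\in\partial\Omega$ for all $w\in[-1,1]^{d-1}$. For non-integer $s$, $C^s$ denotes the Hölder space. For a parameter set $\mathcal P\subset\mathbb R^m$ and a parametric flow field $b=(b_\mu)_{\mu\in\mathcal P}$, consider $$b_\mu\cdot\nabla u_\mu=0\ \text{ in }\Omega,\qquad u_\mu=g_-\ \text{ on }\Gamma_-,\qquad q(\mu)=\int_{\Gamma_+}g_+u_\mu,$$ where $\Gamma_\mp=\{x\in\partial\Omega:\ \pm\, b_\mu(x)\cdot n(x)<0\}$ with the outward unit normal $n$. Solutions are locally integrable; the equation holds in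 the sense of distributions and boundary values are traces (for almost every boundary point $x$, the mean of $|u_\mu-u_\mu(x)|$ over $B(x,r)\cap\Omega$ tends to $0$ as $r\to0$). Let $\mathcal B(g_+)$ be the set of flow fields $b$ such that for every $\mu\in\mathcal P$ there is a relatively open part $\omega_\mu$ of $\overline\Omega$ that contains $\operatorname{supp}(g_+)$ and on which the problem has, for every $g_-\in W^{s_-,p}(\partial\Omega)$, exactly one solution; $q(\mu)$ is computed from this solution. With closed balls $B_X(r)$ of radius $r$, $B_X=B_X(1)$, let $$\mathbb P=\big\{(g_-,g_+,b):\ g_-\in B_{W^{s_-,p}(\partial\Omega)},\ g_+\in B_{W^{s_+,\infty}(\partial\Omega)},\ b\in B_{C^{s_b}(\Omega\times\mathcal P)}(C_b)\cap\mathcal B(g_+)\big\}$$ and let $Q(\mathbb P)\subset L_\infty(\mathcal P)$ be the set of all the resulting quantities of interest $\mu\mapsto q(\mu)$. Finally, $\epsilon_n(K)$ denotes the infimum of all $\epsilon$ such that $K$ is covered by $2^n$ balls of radius $\epsilon$ in $L_\infty(\mathcal P)$. **Theorem.** There is a constant $C_0>0$, depending only on $d$, $\Omega$, the atlas, $s_b$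 and $\Xi$, such that the following holds for all $C_b\ge C_0$. Let $D\ge0$ be an integer with $\max\{D,d-2\}>0$, let $\mathcal P\subset\mathbb R^m$ be a nonempty open set of dimension $m\ge d-2+D$, and let $0<s_-,s_+\le k$ and $1\le p<\infty$. Then there is a constant $c>0$, independent of $n$, such that for all $n\ge1$ $$\epsilon_n(Q(\mathbb P))\ \ge\ c\,n^{-\frac{s_-+s_++(d-1)}{\max\{D/s_b,\;d-2\}}}.$$ -/

import Mathlib

open MeasureTheory Set Filter Topology
open scoped ENNReal NNReal

namespace TransportROM

noncomputable section

/-- Euclidean space `ℝⁿ`. -/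
abbrev E (n : ℕ) : Type := EuclideanSpace ℝ (Fin n)

/-! ### Hölder spaces `C^s` -/

/-- The norm of `C^s(S)` for real `s ≥ 0`: suprema over `S` of all derivatives up to order `⌊s⌋`
and, for non-integer `s`, the Hölder seminorm of exponent `s - ⌊s⌋` of the derivative of
order `⌊s⌋`. On an open set `S` the derivatives are the ordinary ones. -/
def holderNorm {X Y : Type*} [NormedAddCommGroup X] [NormedSpace ℝ X] [NormedAddCommGroup Y]
    [NormedSpace ℝ Y] (s : ℝ) (S : Set X) (f : X → Y) : ℝ≥0∞ :=
  (⨆ j ∈ Finset.range (⌊s⌋₊ + 1), ⨆ x ∈ S, ‖iteratedFDerivWithin ℝ j f S x‖ₑ) +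
    if Int.fract s = 0 then 0 else
      ⨆ x ∈ S, ⨆ y ∈ S, ‖iteratedFDerivWithin ℝ ⌊s⌋₊ f S x - iteratedFDerivWithin ℝ ⌊s⌋₊ f S y‖ₑ /
        edist x y ^ Int.fract s

/-- `f` belongs to `C^s(S)` and has `C^s(S)`-norm at most `C`. -/
def InHolderBall {X Y : Type*} [NormedAddCommGroup X] [NormedSpace ℝ X] [NormedAddCommGroup Y]
    [NormedSpace ℝ Y] (s : ℝ) (C : ℝ≥0∞) (S : Set X) (f : X → Y) : Prop :=
  ContDiffOn ℝ (⌊s⌋₊ : ℕ) f S ∧ holderNorm s S f ≤ C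

/-! ### Sobolev spaces `W^{s,p}(ℝⁿ)` -/

/-- `G` is the weak derivative of order `j` of `f` on `ℝⁿ`, as a field of multilinear forms. -/
def IsWeakDeriv {n : ℕ} (j : ℕ) (f : E n → ℝ)
    (G : E n → ContinuousMultilinearMap ℝ (fun _ : Fin j => E n) ℝ) : Prop :=
  LocallyIntegrable f volume ∧ LocallyIntegrable G volume ∧
    ∀ φ : E n → ℝ, ContDiff ℝ (⊤ : ℕ∞) φ → HasCompactSupport φ → ∀ v : Fin j → E n,
      ∫ x, f x * iteratedFDeriv ℝ j φ x v = (-1) ^ j * ∫ x, φ x * G x v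

/-- The norm of `W^{s,p}(ℝⁿ)` for real `s ≥ 0` and `1 ≤ p ≤ ∞`: the `L^p` norms of the weak
derivatives up to order `⌊s⌋` and, for non-integer `s`, the Slobodeckij seminorm of the weak
derivative of order `⌊s⌋`. It is `∞` if the weak derivatives do not exist. For `p = ∞` one has
`p.toReal = 0` and `n / p.toReal = 0`, so that the seminorm is the essential Hölder seminorm. -/
def sobolevNorm {n : ℕ} (s : ℝ) (p : ℝ≥0∞) (f : E n → ℝ) : ℝ≥0∞ :=
  ⨅ (G : (j : ℕ) → E n → ContinuousMultilinearMap ℝ (fun _ : Fin j => E n) ℝ)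
    (_ : ∀ j ≤ ⌊s⌋₊, IsWeakDeriv j f (G j)),
    (∑ j ∈ Finset.range (⌊s⌋₊ + 1), eLpNorm (G j) p volume) +
      if Int.fract s = 0 then 0 else
        eLpNorm (fun z : E n × E n => ‖G ⌊s⌋₊ z.1 - G ⌊s⌋₊ z.2‖ /
          dist z.1 z.2 ^ (Int.fract s + (n : ℝ) / p.toReal)) p volume

/-! ### Domains with `C^k` boundary and Sobolev spaces on the boundary -/

/-- A finite atlas of the boundary of a `C^k` domain `Ω ⊂ ℝ^d`: `C^k` diffeomorphisms between open
sets that flatten the boundary and map the points of `Ω` to a half space, with a smooth partition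
of unity on `∂Ω` subordinate to the atlas. -/
structure BoundaryAtlas {d : ℕ} (k : ℕ) (Ω : Set (E d)) where
  /-- the number of charts -/
  N : ℕ
  /-- the flattening charts -/
  chart : Fin N → OpenPartialHomeomorph (E d) (ℝ × E (d - 1))
  contDiffOn_chart : ∀ i, ContDiffOn ℝ k (chart i) (chart i).source
  contDiffOn_symm : ∀ i, ContDiffOn ℝ k (chart i).symm (chart i).target
  mem_iff : ∀ i, ∀ x ∈ (chart i).source, x ∈ Ω ↔ 0 < (chart i x).1
  /-- the partition of unity -/
  weight : Fin N → E d → ℝ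
  contDiff_weight : ∀ i, ContDiff ℝ (⊤ : ℕ∞) (weight i)
  hasCompactSupport_weight : ∀ i, HasCompactSupport (weight i)
  tsupport_weight : ∀ i, tsupport (weight i) ⊆ (chart i).source
  weight_nonneg : ∀ i x, 0 ≤ weight i x
  sum_weight : ∀ x ∈ frontier Ω, ∑ i, weight i x = 1

/-- The function `g` on the boundary, localized by the `i`-th weight and written in the `i`-th
boundary chart, extended by zero to `ℝ^{d-1}`. -/
def BoundaryAtlas.localize {d k : ℕ} {Ω : Set (E d)} (A : BoundaryAtlas k Ω) (g : E d → ℝ)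
    (i : Fin A.N) : E (d - 1) → ℝ :=
  open scoped Classical in
  fun y => if ((0 : ℝ), y) ∈ (A.chart i).target then
    A.weight i ((A.chart i).symm (0, y)) * g ((A.chart i).symm (0, y)) else 0

/-- The norm of `W^{s,p}(∂Ω)`. Only the values of `g` on `∂Ω` enter. -/
def BoundaryAtlas.sobolevNorm {d k : ℕ} {Ω : Set (E d)} (A : BoundaryAtlas k Ω) (s : ℝ)
    (p : ℝ≥0∞) (g : E d → ℝ) : ℝ≥0∞ :=
  ∑ i, TransportROM.sobolevNorm s p (A.localize g i)

/-- The surface measure on `∂Ω`. -/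
def surfaceMeasure {d : ℕ} (Ω : Set (E d)) : Measure (E d) :=
  (μHE[d - 1] : Measure (E d)).restrict (frontier Ω)

/-- `ν` is the outward unit normal of `Ω` at the point `x` of the boundary. -/
def IsOutwardNormal {d : ℕ} (Ω : Set (E d)) (x ν : E d) : Prop :=
  ‖ν‖ = 1 ∧
    (∀ v : E d, inner ℝ v ν < 0 → ∀ᶠ t : ℝ in 𝓝[>] 0, x + t • v ∈ Ω) ∧
    (∀ v : E d, 0 < inner ℝ v ν → ∀ᶠ t : ℝ in 𝓝[>] 0, x + t • v ∉ closure Ω)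

/-- The inflow boundary `Γ₋` of the field `b`. -/
def inflow {d : ℕ} (Ω : Set (E d)) (b : E d → E d) : Set (E d) :=
  {x ∈ frontier Ω | ∃ ν, IsOutwardNormal Ω x ν ∧ inner ℝ (b x) ν < 0}

/-- The outflow boundary `Γ₊` of the field `b`. -/
def outflow {d : ℕ} (Ω : Set (E d)) (b : E d → E d) : Set (E d) :=
  {x ∈ frontier Ω | ∃ ν, IsOutwardNormal Ω x ν ∧ 0 < inner ℝ (b x) ν}

/-! ### The transport equation -/

/-- The divergence of a vector field. -/
def divergence {d : ℕ} (F : E d → E d) (x : E d) : ℝ :=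
  LinearMap.trace ℝ (E d) (fderiv ℝ F x : E d →ₗ[ℝ] E d)

/-- The function `u` on `Ω` has the boundary value (trace) `a` at the point `x` of `∂Ω`: the means
of `|u - a|` over `B(x, r) ∩ Ω` tend to zero as `r → 0`. -/
def HasTrace {d : ℕ} (Ω : Set (E d)) (u : E d → ℝ) (x : E d) (a : ℝ) : Prop :=
  Tendsto (fun r : ℝ => ⨍⁻ y in Metric.ball x r ∩ Ω, ‖u y - a‖ₑ ∂volume) (𝓝[>] 0) (𝓝 0)

/-- `u` is a weak solution of `b · ∇u = 0`, `u = g` on `Γ₋`, on the relatively open part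
`U ∩ closure Ω` of `closure Ω`, where `U ⊆ ℝ^d` is open. The values of `u` on `Γ₋ ∪ Γ₊` are the
traces of its values in `Ω`. -/
structure IsTransportSolution {d : ℕ} (Ω U : Set (E d)) (b : E d → E d) (g u : E d → ℝ) :
    Prop where
  locallyIntegrableOn : LocallyIntegrableOn u (Ω ∩ U) volume
  weak_eq : ∀ φ : E d → ℝ, ContDiff ℝ (⊤ : ℕ∞) φ → HasCompactSupport φ → tsupport φ ⊆ Ω ∩ U →
    ∫ x, u x * divergence (fun y => φ y • b y) x = 0
  hasTrace : ∀ᵐ x ∂surfaceMeasure Ω, x ∈ (inflow Ω b ∪ outflow Ω b) ∩ U → HasTrace Ω u x (u x)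
  inflow_eq : ∀ᵐ x ∂surfaceMeasure Ω, x ∈ inflow Ω b ∩ U → u x = g x

/-- For all inflow data in `W^{s,p}(∂Ω)`, the transport equation with flow field `b` has a unique
solution on the part `U ∩ closure Ω` of `closure Ω`. -/
def WellPosedOn {d k : ℕ} {Ω : Set (E d)} (A : BoundaryAtlas k Ω) (s : ℝ) (p : ℝ≥0∞)
    (U : Set (E d)) (b : E d → E d) : Prop :=
  ∀ g : E d → ℝ, A.sobolevNorm s p g < ∞ →
    (∃ u, IsTransportSolution Ω U b g u) ∧
    ∀ u v, IsTransportSolution Ω U b g u → IsTransportSolution Ω U b g v →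
      (∀ᵐ x ∂volume, x ∈ Ω ∩ U → u x = v x) ∧
      (∀ᵐ x ∂surfaceMeasure Ω, x ∈ (inflow Ω b ∪ outflow Ω b) ∩ U → u x = v x)

/-- `U` gives a subdomain that contains the support of `gp` (a function on `∂Ω`) and on which the
transport equation with flow field `b` has unique solutions. -/
def IsSolvabilityDomain {d k : ℕ} {Ω : Set (E d)} (A : BoundaryAtlas k Ω) (s : ℝ) (p : ℝ≥0∞)
    (gp : E d → ℝ) (b : E d → E d) (U : Set (E d)) : Prop :=
  IsOpen U ∧ closure (frontier Ω ∩ Function.support gp) ⊆ U ∧ WellPosedOn A s p U b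

/-- The set `𝓑(gp)` of the parametric flow fields for which, at every parameter, the transport
equation has unique solutions on a subdomain that contains the support of `gp`. -/
def admissibleFields {d k m : ℕ} {Ω : Set (E d)} (A : BoundaryAtlas k Ω) (s : ℝ) (p : ℝ≥0∞)
    (P : Set (E m)) (gp : E d → ℝ) : Set (E d × E m → E d) :=
  {b | ∀ μ ∈ P, ∃ U, IsSolvabilityDomain A s p gp (fun x => b (x, μ)) U}

/-- The real number `q` is the quantity of interest `∫_{Γ₊} gp u` of the solution `u` of the
transport equation with flow field `b` and inflow data `gm`. -/
def IsQuantityOfInterest {d k : ℕ} {Ω : Set (E d)} (A : BoundaryAtlas k Ω) (s : ℝ) (p : ℝ≥0∞)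
    (gm gp : E d → ℝ) (b : E d → E d) (q : ℝ) : Prop :=
  ∃ U u, IsSolvabilityDomain A s p gp b U ∧ IsTransportSolution Ω U b gm u ∧
    IntegrableOn (fun x => gp x * u x) (outflow Ω b) (surfaceMeasure Ω) ∧
    q = ∫ x in outflow Ω b, gp x * u x ∂surfaceMeasure Ω

/-- The problem class: triples of inflow data, outflow functional and flow field. A flow field in
`C^{sb}(Ω × P)`, `sb ≥ 1`, is represented by its continuous extension to `closure Ω × P`. -/
def problemClass {d k m : ℕ} {Ω : Set (E d)} (A : BoundaryAtlas k Ω) (sm sp sb : ℝ) (p : ℝ≥0∞)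
    (Cb : ℝ) (P : Set (E m)) : Set ((E d → ℝ) × (E d → ℝ) × (E d × E m → E d)) :=
  {(gm, gp, b) | A.sobolevNorm sm p gm ≤ 1 ∧ A.sobolevNorm sp ∞ gp ≤ 1 ∧
    InHolderBall sb (ENNReal.ofReal Cb) (Ω ×ˢ P) b ∧ ContinuousOn b (closure Ω ×ˢ P) ∧
    b ∈ admissibleFields A sm p P gp}

/-- The class `Q(ℙ) ⊂ L_∞(P)` of the quantities of interest, as functions of the parameter. -/
def qoiClass {d k m : ℕ} {Ω : Set (E d)} (A : BoundaryAtlas k Ω) (sm sp sb : ℝ) (p : ℝ≥0∞)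
    (Cb : ℝ) (P : Set (E m)) : Set (Lp ℝ ∞ ((volume : Measure (E m)).restrict P)) :=
  {q | ∃ gm gp b, (gm, gp, b) ∈ problemClass A sm sp sb p Cb P ∧ ∃ q₀ : E m → ℝ,
    (∀ μ ∈ P, IsQuantityOfInterest A sm p gm gp (fun x => b (x, μ)) (q₀ μ)) ∧
    q =ᵐ[volume.restrict P] q₀}

/-! ### Reference map and metric entropy -/

/-- The reference domain `[0,1] × [-1,1]^{d-1}`. -/
def referenceDomain (d : ℕ) : Set (ℝ × E (d - 1)) :=
  Icc 0 1 ×ˢ {w | ∀ i, w i ∈ Icc (-1) 1}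

/-- `Ξ` is an injective map of the reference domain to `closure Ω`, of class `C^s` together with
its inverse, that maps the faces `t = 0` and `t = 1` to `∂Ω`. -/
structure IsReferenceMap {d : ℕ} (s : ℝ) (Ω : Set (E d)) (Ξ : ℝ × E (d - 1) → E d) : Prop where
  mapsTo : MapsTo Ξ (referenceDomain d) (closure Ω)
  injOn : InjOn Ξ (referenceDomain d)
  inflow_face : ∀ w, (0, w) ∈ referenceDomain d → Ξ (0, w) ∈ frontier Ω
  outflow_face : ∀ w, (1, w) ∈ referenceDomain d → Ξ (1, w) ∈ frontier Ω
  regular : ∃ C : ℝ≥0, InHolderBall s C (referenceDomain d) Ξ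
  regular_inv : ∃ C : ℝ≥0,
    InHolderBall s C (Ξ '' referenceDomain d) (Function.invFunOn Ξ (referenceDomain d))

/-- The entropy number `ε_n(K)`: the infimum of the radii `ε` such that `2^n` balls of radius `ε`,
with arbitrary centers in the ambient space, cover `K`; it is `∞` if there is no such `ε`. -/
def entropyNumber {Z : Type*} [PseudoEMetricSpace Z] (n : ℕ) (K : Set Z) : ℝ≥0∞ :=
  ⨅ (ε : ℝ≥0) (_ : Metric.externalCoveringNumber ε K ≤ 2 ^ n), (ε : ℝ≥0∞)

end

end TransportROM

open TransportROM

open MeasureTheory Set Filter Topology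
open scoped ENNReal NNReal

namespace TransportROM

noncomputable section

/-! ### Local defining functions of a domain -/

/-! Flow fields that are constant in space already realize the lower bound. A ball of maximal radius
in `Ω` touches the boundary at two different points, and the chord between them is transversal to
the boundary at both ends (`exists_transversal_chord`). Lines in nearby directions therefore enter
and leave `Ω` near the ends of the chord through Lipschitz graphs (`exists_tubeFamily`). On a tube
of parallel lines the transport equation is well posed (`TubeFamily.wellPosedOn`): the solution
carries the inflow data along the lines. For uniqueness, the weak equation makes the means of the
modulus of a solution over balls invariant under translation along the flow, so a mean near an
interior point equals a mean near the entry point of its line, where the trace controls it.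

Take as outflow functional a bump of size `h` and height `h ^ sp` at the outflow end of the chord,
and as inflow data a sum of separated bumps of size `h` and height `h ^ sm`; up to constants both
lie in the unit balls (`BoundaryAtlas.exists_amplitude`). Let `S = sm + sp + (d - 1)`. If the line
through the outflow end starts at the centre of an inflow bump, the quantity of interest is at least
a constant times `h ^ S`, the summand `d - 1` being the surface measure of a ball of radius `h`. If
it starts far from all bumps, on the scale `h`, the quantity of interest is zero
(`TubeFamily.exists_mem_qoiClass`).

This switch is operated in two ways on a grid of `N` parameters, each giving `2 ^ N` quantities of
interest at mutual distance at least a constant times `h ^ S`. In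
`TubeFamily.exists_le_entropyNumber_of_data` the field is fixed and its direction depends linearly
on `d - 2` parameters, so `N = K ^ (d - 2)` parameters see entry points with spacing of order `1 /
K`; the subset is encoded by the positions of inflow bumps of size `h ~ 1 / K`. In
`TubeFamily.exists_le_entropyNumber_of_field` there is one inflow bump, and the subset of `N = K ^
D` parameters is encoded in the field by bumps in the parameter of width `r ~ 1 / K`. Boundedness in
the Hölder space allows the height `r ^ sb`; the entry point moves by the same order, so `h ~ K ^
(-sb)`. A packing argument with `N > n` (`exists_le_entropyNumber`) turns both into rates, and the
theorem takes the better one. The functions are compared at single parameters; continuity of the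
quantities of interest makes this legitimate for the `L_∞` distance. -/

/-- On the open set `W` the open set `Ω` is the superlevel set of the `C¹` function `φ`, which has
no critical points there. -/
structure IsDefiningOn {d : ℕ} (Ω : Set (E d)) (φ : E d → ℝ) (W : Set (E d)) : Prop where
  isOpen : IsOpen W
  contDiffOn : ContDiffOn ℝ 1 φ W
  mem_iff : ∀ x ∈ W, x ∈ Ω ↔ 0 < φ x
  fderiv_ne : ∀ x ∈ W, fderiv ℝ φ x ≠ 0

/-- A function that increases in the direction `v` is positive on small cones around `v`. -/
lemma eventually_pos_on_ball {X : Type*} [NormedAddCommGroup X] [NormedSpace ℝ X] {φ : X → ℝ}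
    {p : X →L[ℝ] ℝ} {x v : X} (h : HasFDerivAt φ p x) (h0 : φ x = 0) (hv : 0 < p v) :
    ∃ c > 0, ∀ᶠ r : ℝ in 𝓝[>] 0, ∀ z ∈ Metric.ball (x + r • v) (c * r), 0 < φ z := by
  -- Of the linear gain `r * p v`, the deviation from the axis of the cone and the Taylor remainder
  -- may each consume a quarter.
  set c : ℝ := p v / (4 * (‖p‖ + 1)) with hc
  have hc0 : 0 < c := by positivity
  set ε : ℝ := p v / (4 * (‖v‖ + c + 1)) with hε
  have hε0 : 0 < ε := by positivity
  refine ⟨c, hc0, ?_⟩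
  have h1 := h.isLittleO.def hε0
  rw [Metric.eventually_nhds_iff] at h1
  obtain ⟨δ, hδ, h1⟩ := h1
  have h2 : ∀ᶠ r : ℝ in 𝓝[>] 0, r < δ / (‖v‖ + c + 1) :=
    (eventually_lt_nhds (by positivity)).filter_mono nhdsWithin_le_nhds
  filter_upwards [h2, self_mem_nhdsWithin] with r hr hr0 z hz
  have hr0 : 0 < r := hr0
  rw [lt_div_iff₀ (by positivity)] at hr
  have hz' : ‖z - (x + r • v)‖ < c * r := by simpa [dist_eq_norm] using hz
  have hzx : ‖z - x‖ ≤ r * (‖v‖ + c) := by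
    calc ‖z - x‖ = ‖(z - (x + r • v)) + r • v‖ := by congr 1; abel
      _ ≤ ‖z - (x + r • v)‖ + ‖r • v‖ := norm_add_le _ _
      _ ≤ c * r + r * ‖v‖ := by
          rw [norm_smul, Real.norm_of_nonneg hr0.le]; gcongr
      _ = _ := by ring
  have h3 := h1 (y := z) (by rw [dist_eq_norm]; nlinarith)
  rw [h0, sub_zero, Real.norm_eq_abs] at h3
  have h4 : p (z - x) = r * p v + p (z - (x + r • v)) := by
    have : z - x = r • v + (z - (x + r • v)) := by abel
    rw [this, map_add, map_smul, smul_eq_mul]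
  have h5 : |p (z - (x + r • v))| ≤ ‖p‖ * (c * r) :=
    (p.le_opNorm _).trans (by gcongr)
  have h6 : ‖p‖ * c ≤ p v / 4 := by
    rw [hc, mul_div_assoc', div_le_div_iff₀ (by positivity) (by positivity)]
    nlinarith [norm_nonneg p]
  have h7 : ε * (‖v‖ + c) ≤ p v / 4 := by
    rw [hε, div_mul_eq_mul_div, div_le_div_iff₀ (by positivity) (by positivity)]
    nlinarith [norm_nonneg v]
  have h8 := (abs_le.1 h3).1
  have h9 := (abs_le.1 h5).1
  have h10 : ε * ‖z - x‖ ≤ ε * (‖v‖ + c) * r := by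
    calc _ ≤ ε * (r * (‖v‖ + c)) := by gcongr
      _ = _ := by ring
  nlinarith

namespace IsDefiningOn

variable {d : ℕ} {Ω W : Set (E d)} {φ : E d → ℝ} {x v : E d}

lemma hasFDerivAt (h : IsDefiningOn Ω φ W) (hx : x ∈ W) : HasFDerivAt φ (fderiv ℝ φ x) x :=
  ((h.contDiffOn.differentiableOn one_ne_zero).differentiableAt
    (h.isOpen.mem_nhds hx)).hasFDerivAt

lemma continuousOn_fderiv (h : IsDefiningOn Ω φ W) : ContinuousOn (fderiv ℝ φ) W :=
  h.contDiffOn.continuousOn_fderiv_of_isOpen h.isOpen le_rfl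

/-- This is the interior cone condition at a boundary point. It allows traces to be evaluated by
means over full balls inside `Ω`. -/
lemma eventually_ball_subset (h : IsDefiningOn Ω φ W) (hx : x ∈ W) (h0 : φ x = 0)
    (hv : 0 < fderiv ℝ φ x v) :
    ∃ c > 0, ∀ᶠ r : ℝ in 𝓝[>] 0, Metric.ball (x + r • v) (c * r) ⊆ Ω := by
  obtain ⟨c, hc, H⟩ := eventually_pos_on_ball (h.hasFDerivAt hx) h0 hv
  obtain ⟨δ, hδ, hW⟩ := Metric.isOpen_iff.1 h.isOpen x hx
  refine ⟨c, hc, ?_⟩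
  have h2 : ∀ᶠ r : ℝ in 𝓝[>] 0, r < δ / (‖v‖ + c) :=
    (eventually_lt_nhds (by positivity)).filter_mono nhdsWithin_le_nhds
  filter_upwards [H, h2, self_mem_nhdsWithin] with r h1 h2 hr z hz
  have hr : 0 < r := hr
  refine (h.mem_iff z (hW ?_)).2 (h1 z hz)
  rw [lt_div_iff₀ (by positivity)] at h2
  rw [Metric.mem_ball] at hz ⊢
  calc dist z x ≤ dist z (x + r • v) + dist (x + r • v) x := dist_triangle _ _ _
    _ < c * r + r * ‖v‖ := by
        have : dist (x + r • v) x = r * ‖v‖ := by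
          rw [dist_eq_norm, add_sub_cancel_left, norm_smul, Real.norm_of_nonneg hr.le]
        rw [this]; gcongr
    _ < δ := by linarith

lemma eventually_mem (h : IsDefiningOn Ω φ W) (hx : x ∈ W) (h0 : φ x = 0)
    (hv : 0 < fderiv ℝ φ x v) : ∀ᶠ r : ℝ in 𝓝[>] 0, x + r • v ∈ Ω := by
  obtain ⟨c, hc, H⟩ := h.eventually_ball_subset hx h0 hv
  filter_upwards [H, self_mem_nhdsWithin] with r h1 (hr : 0 < r)
  exact h1 (Metric.mem_ball_self (by positivity))

lemma not_mem_closure (h : IsDefiningOn Ω φ W) (hx : x ∈ W) (h0 : φ x < 0) : x ∉ closure Ω := by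
  have h1 : ∀ᶠ y in 𝓝 x, φ y < 0 := (h.hasFDerivAt hx).continuousAt.eventually_lt_const h0
  rw [mem_closure_iff_frequently, not_frequently]
  filter_upwards [h1, h.isOpen.mem_nhds hx] with y hy hyW hyΩ
  exact absurd ((h.mem_iff y hyW).1 hyΩ) hy.not_gt

/-- At a zero, the nonvanishing derivative provides a direction of increase, along which points of
`Ω` converge to the zero. Where `φ` is negative, it is negative nearby, so such points are not in
the closure. -/
lemma frontier_iff (h : IsDefiningOn Ω φ W) (hΩ : IsOpen Ω) (hx : x ∈ W) :
    x ∈ frontier Ω ↔ φ x = 0 := by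
  rw [hΩ.frontier_eq, Set.mem_sdiff, h.mem_iff x hx]
  constructor
  · rintro ⟨h1, h2⟩
    by_contra h3
    exact h.not_mem_closure hx (lt_of_le_of_ne (not_lt.1 h2) h3) h1
  · intro h0
    refine ⟨?_, by simp [h0]⟩
    obtain ⟨v, hv⟩ : ∃ v, 0 < fderiv ℝ φ x v := by
      obtain ⟨v, hv⟩ := DFunLike.ne_iff.1 (h.fderiv_ne x hx)
      rcases lt_or_gt_of_ne hv with h | h
      · exact ⟨-v, by simpa using h⟩
      · exact ⟨v, h⟩
    have h1 := h.eventually_mem hx h0 hv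
    rw [mem_closure_iff_frequently]
    have h2 : Tendsto (fun r : ℝ => x + r • v) (𝓝[>] 0) (𝓝 x) := by
      have : Tendsto (fun r : ℝ => x + r • v) (𝓝 0) (𝓝 (x + (0 : ℝ) • v)) :=
        (continuous_const.add (continuous_id.smul continuous_const)).tendsto 0
      simpa using this.mono_left nhdsWithin_le_nhds
    exact h2.frequently h1.frequently

lemma eventually_not_mem_closure (h : IsDefiningOn Ω φ W) (hx : x ∈ W) (h0 : φ x = 0)
    (hv : fderiv ℝ φ x v < 0) : ∀ᶠ r : ℝ in 𝓝[>] 0, x + r • v ∉ closure Ω := by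
  obtain ⟨c, hc, H⟩ := eventually_pos_on_ball (h.hasFDerivAt hx).neg
    (by simpa using h0) (v := v) (by simpa using hv)
  have h2 : Tendsto (fun r : ℝ => x + r • v) (𝓝[>] 0) (𝓝 x) := by
    have : Tendsto (fun r : ℝ => x + r • v) (𝓝 0) (𝓝 (x + (0 : ℝ) • v)) :=
      (continuous_const.add (continuous_id.smul continuous_const)).tendsto 0
    simpa using this.mono_left nhdsWithin_le_nhds
  filter_upwards [H, self_mem_nhdsWithin, h2.eventually (h.isOpen.mem_nhds hx)]
    with r h1 (hr : 0 < r) hW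
  refine h.not_mem_closure hW ?_
  have := h1 _ (Metric.mem_ball_self (by positivity))
  simpa using this

/-- The outward unit normal is the normalized negative gradient of the defining function. -/
lemma exists_isOutwardNormal (h : IsDefiningOn Ω φ W) (hx : x ∈ W) (h0 : φ x = 0) :
    ∃ ν, IsOutwardNormal Ω x ν ∧ ∀ v, 0 < inner ℝ v ν ↔ fderiv ℝ φ x v < 0 := by
  set g := (InnerProductSpace.toDual ℝ (E d)).symm (fderiv ℝ φ x) with hg
  have hg1 : ∀ v, inner ℝ v g = fderiv ℝ φ x v := fun v => by
    rw [real_inner_comm, hg, InnerProductSpace.toDual_symm_apply]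
  have hg0 : 0 < ‖g‖ := by
    rw [hg, LinearIsometryEquiv.norm_map]; exact norm_pos_iff.2 (h.fderiv_ne x hx)
  have hi : ∀ v, inner ℝ v (-(‖g‖⁻¹ • g)) = -(‖g‖⁻¹ * fderiv ℝ φ x v) := fun v => by
    rw [inner_neg_right, inner_smul_right, hg1]
  have hpos : ∀ v, 0 < inner ℝ v (-(‖g‖⁻¹ • g)) ↔ fderiv ℝ φ x v < 0 := fun v => by
    have h2 : 0 < ‖g‖⁻¹ := by positivity
    rw [hi, neg_pos]
    constructor <;> intro h3 <;> nlinarith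
  refine ⟨-(‖g‖⁻¹ • g), ⟨?_, fun v hv => ?_, fun v hv => ?_⟩, hpos⟩
  · rw [norm_neg, norm_smul, norm_inv, norm_norm, inv_mul_cancel₀ hg0.ne']
  · refine h.eventually_mem hx h0 ?_
    rw [hi, neg_neg_iff_pos] at hv
    exact (mul_pos_iff_of_pos_left (by positivity)).1 hv
  · exact h.eventually_not_mem_closure hx h0 ((hpos v).1 hv)

lemma mem_inflow (h : IsDefiningOn Ω φ W) (hΩ : IsOpen Ω) (hx : x ∈ W) (h0 : φ x = 0)
    {b : E d → E d} (hv : 0 < fderiv ℝ φ x (b x)) : x ∈ inflow Ω b := by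
  obtain ⟨ν, h1, h2⟩ := h.exists_isOutwardNormal hx h0
  refine ⟨(h.frontier_iff hΩ hx).2 h0, ν, h1, ?_⟩
  have := (h2 (-b x)).2 (by simpa using hv)
  simpa [inner_neg_left] using this

lemma mem_outflow (h : IsDefiningOn Ω φ W) (hΩ : IsOpen Ω) (hx : x ∈ W) (h0 : φ x = 0)
    {b : E d → E d} (hv : fderiv ℝ φ x (b x) < 0) : x ∈ outflow Ω b := by
  obtain ⟨ν, h1, h2⟩ := h.exists_isOutwardNormal hx h0
  exact ⟨(h.frontier_iff hΩ hx).2 h0, ν, h1, (h2 _).2 hv⟩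

end IsDefiningOn

/-- If two outward unit normals differed, their difference `ν' - ν` would point inward with respect
to `ν` and outward with respect to `ν'`, so short steps along it would end both in `Ω` and outside
its closure. -/
lemma IsOutwardNormal.unique {d : ℕ} {Ω : Set (E d)} {x ν ν' : E d} (h : IsOutwardNormal Ω x ν)
    (h' : IsOutwardNormal Ω x ν') : ν = ν' := by
  by_contra hne
  have h1 : inner ℝ ν ν' < 1 := by
    have := inner_lt_one_iff_real_of_norm_eq_one h.1 h'.1
    exact this.2 hne
  have e1 : inner ℝ (ν' - ν) ν < 0 := by
    rw [inner_sub_left, real_inner_self_eq_norm_sq, h.1, real_inner_comm]; linarith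
  have e2 : 0 < inner ℝ (ν' - ν) ν' := by
    rw [inner_sub_left, real_inner_self_eq_norm_sq, h'.1]; linarith
  obtain ⟨r, h3, h4⟩ := ((h.2.1 _ e1).and (h'.2.2 _ e2)).exists
  exact h4 (subset_closure h3)

lemma disjoint_inflow_outflow {d : ℕ} (Ω : Set (E d)) (b : E d → E d) :
    Disjoint (inflow Ω b) (outflow Ω b) := by
  rw [Set.disjoint_left]
  rintro x ⟨_, ν, h, h1⟩ ⟨_, ν', h', h2⟩
  rw [h.unique h'] at h1
  exact lt_asymm h1 h2

/-- The first component of a boundary chart is a local defining function. -/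
lemma BoundaryAtlas.isDefiningOn {d k : ℕ} {Ω : Set (E d)} (A : BoundaryAtlas k Ω) (hk : 1 ≤ k)
    (i : Fin A.N) : IsDefiningOn Ω (fun x => (A.chart i x).1) (A.chart i).source := by
  have hk' : (1 : WithTop ℕ∞) ≤ k := by exact_mod_cast hk
  have h1 : ContDiffOn ℝ 1 (A.chart i) (A.chart i).source := (A.contDiffOn_chart i).of_le hk'
  refine ⟨(A.chart i).open_source, contDiff_fst.comp_contDiffOn h1, A.mem_iff i, fun x hx h0 => ?_⟩
  have hd : HasFDerivAt (A.chart i) (fderiv ℝ (A.chart i) x) x :=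
    ((h1.differentiableOn one_ne_zero).differentiableAt
      ((A.chart i).open_source.mem_nhds hx)).hasFDerivAt
  have hy := (A.chart i).map_source hx
  have hd' : HasFDerivAt (A.chart i).symm (fderiv ℝ (A.chart i).symm (A.chart i x)) (A.chart i x) :=
    ((((A.contDiffOn_symm i).of_le hk').differentiableOn one_ne_zero).differentiableAt
      ((A.chart i).open_target.mem_nhds hy)).hasFDerivAt
  have hx' : (A.chart i).symm (A.chart i x) = x := (A.chart i).left_inv hx
  rw [← hx'] at hd
  have hc := hd.comp _ hd'
  have hid : HasFDerivAt (A.chart i ∘ (A.chart i).symm) (ContinuousLinearMap.id ℝ _)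
      (A.chart i x) := by
    refine (hasFDerivAt_id _).congr_of_eventuallyEq ?_
    filter_upwards [(A.chart i).open_target.mem_nhds hy] with y hy
    exact (A.chart i).right_inv hy
  have heq := hc.unique hid
  rw [hx'] at heq hd
  have hf : fderiv ℝ (fun x => (A.chart i x).1) x =
      (ContinuousLinearMap.fst ℝ ℝ (E (d - 1))).comp (fderiv ℝ (A.chart i) x) :=
    (hasFDerivAt_fst.comp x hd).fderiv
  -- The image of the first unit vector under the derivative of the inverse chart is a direction in
  -- which the first chart component has derivative one.
  have := congrArg (fun L => (L ((1 : ℝ), (0 : E (d - 1)))).1) heq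
  have h3 := congrArg
    (fun L => L (fderiv ℝ (A.chart i).symm (A.chart i x) ((1 : ℝ), (0 : E (d - 1))))) h0
  rw [hf] at h3
  simp at this h3
  linarith

/-- Every boundary point lies in the support of a weight of the atlas. -/
lemma BoundaryAtlas.exists_mem_source {d k : ℕ} {Ω : Set (E d)} (A : BoundaryAtlas k Ω) {x : E d}
    (hx : x ∈ frontier Ω) : ∃ i, x ∈ (A.chart i).source := by
  by_contra! h
  have h1 := A.sum_weight x hx
  rw [Finset.sum_eq_zero] at h1
  · exact zero_ne_one h1
  · intro i _
    by_contra h2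
    exact h i (A.tsupport_weight i (subset_tsupport _ h2))

lemma BoundaryAtlas.exists_isDefiningOn {d k : ℕ} {Ω : Set (E d)} (A : BoundaryAtlas k Ω)
    (hk : 1 ≤ k) {x : E d} (hx : x ∈ frontier Ω) : ∃ φ W, IsDefiningOn Ω φ W ∧ x ∈ W := by
  obtain ⟨i, hi⟩ := A.exists_mem_source hx
  exact ⟨_, _, A.isDefiningOn hk i, hi⟩

/-! ### A transversal chord -/

/-- If a ball inside `Ω` touches the boundary at `y`, then directions into the ball are directions
of increase of a defining function. -/
lemma IsDefiningOn.fderiv_pos_of_ball_subset {d : ℕ} {Ω W : Set (E d)} {φ : E d → ℝ} {c y v : E d}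
    (h : IsDefiningOn Ω φ W) (hy : y ∈ W) (h0 : φ y = 0)
    (hb : Metric.ball c (dist y c) ⊆ Ω) (hv : 0 < inner ℝ v (c - y)) : 0 < fderiv ℝ φ y v := by
  -- Short steps in such a direction stay in the ball, whereas a negative derivative would push them
  -- out of the closure of `Ω`.
  have key : ∀ w, 0 < inner ℝ w (c - y) → 0 ≤ fderiv ℝ φ y w := by
    intro w hw
    by_contra! hneg
    have h1 := h.eventually_not_mem_closure hy h0 hneg
    have hw0 : 0 < ‖w‖ := norm_pos_iff.2 (by rintro rfl; simp at hw)
    have h2 : ∀ᶠ r : ℝ in 𝓝[>] 0, r < 2 * inner ℝ w (c - y) / ‖w‖ ^ 2 :=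
      (eventually_lt_nhds (by positivity)).filter_mono nhdsWithin_le_nhds
    obtain ⟨r, h3, h4, hr⟩ := (h1.and (h2.and self_mem_nhdsWithin)).exists
    have hr : 0 < r := hr
    refine h3 (subset_closure (hb ?_))
    rw [lt_div_iff₀ (by positivity)] at h4
    rw [Metric.mem_ball, dist_eq_norm, dist_eq_norm]
    have e1 : y + r • w - c = r • w - (c - y) := by abel
    rw [e1, norm_sub_rev y c]
    refine lt_of_pow_lt_pow_left₀ 2 (norm_nonneg _) ?_
    rw [norm_sub_sq_real, norm_smul, inner_smul_left, Real.norm_of_nonneg hr.le]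
    simp only [conj_trivial]
    nlinarith
  -- The derivative is nonnegative on an open half space. If it vanished at `v`, a small
  -- perturbation of `v` in a direction of decrease would stay in the half space and make it
  -- negative.
  refine (key v hv).lt_of_ne' fun hz => ?_
  obtain ⟨w, hw⟩ : ∃ w, fderiv ℝ φ y w < 0 := by
    obtain ⟨w, hw⟩ := DFunLike.ne_iff.1 (h.fderiv_ne y hy)
    rcases lt_or_gt_of_ne hw with h | h
    · exact ⟨w, h⟩
    · exact ⟨-w, by simpa using h⟩
  have h1 : ∀ᶠ r : ℝ in 𝓝[>] 0, 0 < inner ℝ (v + r • w) (c - y) := by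
    have : Continuous fun r : ℝ => inner ℝ (v + r • w) (c - y) := by fun_prop
    refine Filter.Eventually.filter_mono nhdsWithin_le_nhds ?_
    exact this.continuousAt.eventually_const_lt (by simpa using hv)
  obtain ⟨r, h2, hr⟩ := (h1.and self_mem_nhdsWithin).exists
  have := key _ h2
  rw [map_add, hz, map_smul, smul_eq_mul] at this
  have hr : 0 < r := hr
  nlinarith

/-- A ball of maximal radius in a bounded open set touches the boundary at two points. -/
lemma exists_ball_touching_twice {d : ℕ} (hd : 1 ≤ d) {Ω : Set (E d)} (hΩ : IsOpen Ω)
    (hb : Bornology.IsBounded Ω) (hne : Ω.Nonempty) :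
    ∃ c y₀ y₁ : E d, y₀ ≠ y₁ ∧ dist y₀ c = dist y₁ c ∧ y₀ ∈ frontier Ω ∧ y₁ ∈ frontier Ω ∧
      Metric.ball c (dist y₁ c) ⊆ Ω := by
  have : Nonempty (Fin d) := ⟨⟨0, hd⟩⟩
  have hcne : Ωᶜ.Nonempty := by
    rw [nonempty_compl]
    rintro rfl
    exact NormedSpace.unbounded_univ ℝ (E d) hb
  have hcl : IsClosed Ωᶜ := hΩ.isClosed_compl
  have hK : IsCompact (closure Ω) := hb.isCompact_closure
  obtain ⟨c, hc, hmax⟩ := hK.exists_isMaxOn hne.closure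
    (Metric.continuous_infDist_pt Ωᶜ).continuousOn
  set r := Metric.infDist c Ωᶜ with hr
  have hr0 : 0 < r := by
    obtain ⟨x, hx⟩ := hne
    have : 0 < Metric.infDist x Ωᶜ :=
      (hcl.notMem_iff_infDist_pos hcne).1 (by simpa using hx)
    exact this.trans_le (hmax (subset_closure hx))
  have hball : Metric.ball c r ⊆ Ω := by
    intro z hz
    by_contra hzn
    have := Metric.infDist_le_dist_of_mem (x := c) (s := Ωᶜ) hzn
    rw [Metric.mem_ball, dist_comm] at hz
    linarith
  have hfr : ∀ y ∈ Ωᶜ, dist c y = r → y ∈ frontier Ω := by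
    intro y hy hcy
    rw [hΩ.frontier_eq]
    refine ⟨closure_mono hball ?_, hy⟩
    rw [closure_ball c hr0.ne', Metric.mem_closedBall, dist_comm, hcy]
  obtain ⟨y₀, hy₀, hcy₀⟩ := hcl.exists_infDist_eq_dist hcne c
  rw [← hr] at hcy₀
  -- If the maximal ball had only one contact point, moving its centre away from that point would
  -- increase the distance to the complement.
  by_contra! hcon
  have huniq : ∀ y ∈ Ωᶜ, dist c y = r → y = y₀ := by
    intro y hy hcy
    by_contra hne'
    refine hcon c y y₀ hne' ?_ (hfr y hy hcy) (hfr y₀ hy₀ hcy₀.symm) ?_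
    · rw [dist_comm, hcy, dist_comm, hcy₀]
    · rw [dist_comm, ← hcy₀]; exact hball
  set e := c - y₀ with he
  have hen : ‖e‖ = r := by rw [he, ← dist_eq_norm, hcy₀]
  -- These are the nearby complement points that need not get farther away when the centre moves
  -- along `e`. The contact point is not among them, so compactness gives them a positive margin `η`
  -- beyond the distance `r`.
  set Z := Ωᶜ ∩ Metric.closedBall c (2 * r) ∩ {z | inner ℝ (c - z) e ≤ 0} with hZ
  have hZc : IsCompact Z := by
    refine ((isCompact_closedBall c (2 * r)).inter_left hcl).inter_right ?_
    exact isClosed_le (by fun_prop) continuous_const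
  have hZr : ∀ z ∈ Z, r < dist c z := by
    rintro z ⟨⟨hz1, -⟩, hz2⟩
    have h1 : r ≤ dist c z := Metric.infDist_le_dist_of_mem hz1
    refine h1.lt_of_ne fun h2 => ?_
    rw [huniq z hz1 h2.symm] at hz2
    have : inner ℝ (c - y₀) e = r ^ 2 := by rw [← he, real_inner_self_eq_norm_sq, hen]
    simp only [mem_ofPred_eq] at hz2
    nlinarith
  obtain ⟨η, hη, hZη⟩ : ∃ η > 0, ∀ z ∈ Z, r + η ≤ dist c z := by
    rcases Z.eq_empty_or_nonempty with h | h
    · exact ⟨1, one_pos, by simp [h]⟩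
    · obtain ⟨z, hz, hmin⟩ := hZc.exists_isMinOn h (f := fun z => dist c z) (by fun_prop)
      exact ⟨dist c z - r, by linarith [hZr z hz], fun w hw => by
        have := hmin hw
        simp only [mem_ofPred_eq] at this
        linarith⟩
  set ε := min (1 / 2) (η / (2 * r)) with hε
  have hε0 : 0 < ε := by positivity
  have hε1 : ε * r < r := by nlinarith [min_le_left (1 / 2) (η / (2 * r))]
  have hε2 : ε * r < η := by
    have : ε * r ≤ η / (2 * r) * r := by gcongr; exact min_le_right _ _
    have h2 : η / (2 * r) * r = η / 2 := by field_simp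
    linarith
  set c' := c + ε • e with hc'
  have hcc' : dist c c' = ε * r := by
    rw [hc', dist_eq_norm, sub_add_cancel_left, norm_neg, norm_smul, hen,
      Real.norm_of_nonneg hε0.le]
  have hfar : ∀ z ∈ Ωᶜ, r < dist c' z := by
    intro z hz
    have htri : dist c z ≤ dist c c' + dist c' z := dist_triangle _ _ _
    rw [hcc'] at htri
    by_cases h1 : dist c z ≤ 2 * r
    · by_cases h2 : inner ℝ (c - z) e ≤ 0
      · have := hZη z ⟨⟨hz, by rwa [Metric.mem_closedBall, dist_comm]⟩, h2⟩
        linarith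
      · have h3 : r ≤ dist c z := Metric.infDist_le_dist_of_mem hz
        push Not at h2
        rw [dist_eq_norm] at h3 ⊢
        refine lt_of_pow_lt_pow_left₀ 2 (norm_nonneg _) ?_
        have : c' - z = (c - z) + ε • e := by rw [hc']; abel
        rw [this, norm_add_sq_real, inner_smul_right]
        nlinarith [mul_pos hε0 h2, sq_nonneg ‖ε • e‖]
    · linarith
  obtain ⟨z, hz, hcz⟩ := hcl.exists_infDist_eq_dist hcne c'
  have h1 := hfar z hz
  have h2 : c' ∈ Ω := by
    by_contra h3
    have := hfar c' h3
    rw [dist_self] at this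
    linarith
  have h3 : Metric.infDist c' Ωᶜ ≤ r := hmax (subset_closure h2)
  linarith

/-- A bounded domain has a chord that is transversal to the boundary at both ends. -/
lemma exists_transversal_chord {d k : ℕ} (hd : 1 ≤ d) (hk : 1 ≤ k) {Ω : Set (E d)} (hΩ : IsOpen Ω)
    (hb : Bornology.IsBounded Ω) (hne : Ω.Nonempty) (A : BoundaryAtlas k Ω) :
    ∃ (y₀ y₁ : E d) (φ₀ φ₁ : E d → ℝ) (W₀ W₁ : Set (E d)), y₀ ≠ y₁ ∧
      openSegment ℝ y₀ y₁ ⊆ Ω ∧ IsDefiningOn Ω φ₀ W₀ ∧ IsDefiningOn Ω φ₁ W₁ ∧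
      y₀ ∈ W₀ ∧ y₁ ∈ W₁ ∧ φ₀ y₀ = 0 ∧ φ₁ y₁ = 0 ∧
      0 < fderiv ℝ φ₀ y₀ (y₁ - y₀) ∧ fderiv ℝ φ₁ y₁ (y₁ - y₀) < 0 := by
  obtain ⟨c, y₀, y₁, hy, hdist, hf0, hf1, hball⟩ := exists_ball_touching_twice hd hΩ hb hne
  obtain ⟨φ₀, W₀, h0, hW0⟩ := A.exists_isDefiningOn hk hf0
  obtain ⟨φ₁, W₁, h1, hW1⟩ := A.exists_isDefiningOn hk hf1
  have e0 := (h0.frontier_iff hΩ hW0).1 hf0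
  have e1 := (h1.frontier_iff hΩ hW1).1 hf1
  have hpos : 0 < ‖y₁ - y₀‖ ^ 2 := by
    have : 0 < ‖y₁ - y₀‖ := norm_pos_iff.2 (sub_ne_zero.2 hy.symm)
    positivity
  -- The chord between two points equidistant from `c` makes an acute angle with the radius at
  -- either end; this is transversality in the form required by
  -- `IsDefiningOn.fderiv_pos_of_ball_subset`.
  have key : ∀ p q : E d, dist p c = dist q c →
      2 * inner ℝ (q - p) (c - p) = ‖q - p‖ ^ 2 := by
    intro p q hpq
    have h2 : q - c = (q - p) - (c - p) := by abel
    have h3 := norm_sub_sq_real (q - p) (c - p)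
    rw [← h2, ← dist_eq_norm, ← dist_eq_norm c p, dist_comm c p, hpq] at h3
    linarith
  refine ⟨y₀, y₁, φ₀, φ₁, W₀, W₁, hy, ?_, h0, h1, hW0, hW1, e0, e1, ?_, ?_⟩
  · refine Subset.trans ?_ hball
    have hs := (strictConvex_closedBall ℝ c (dist y₁ c)).openSegment_subset
      (x := y₀) (y := y₁) (by simp [hdist]) (by simp) hy
    refine hs.trans ?_
    rw [interior_closedBall]
    intro h
    rw [h, dist_eq_zero] at hdist
    exact hy (hdist.trans (dist_eq_zero.1 h).symm)
  · refine h0.fderiv_pos_of_ball_subset hW0 e0 (c := c) (by rwa [hdist]) ?_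
    linarith [key y₀ y₁ hdist]
  · have : 0 < fderiv ℝ φ₁ y₁ (y₀ - y₁) := by
      refine h1.fderiv_pos_of_ball_subset hW1 e1 (c := c) hball ?_
      have := key y₁ y₀ hdist.symm
      rw [norm_sub_rev] at this
      linarith
    rw [← neg_sub, map_neg]
    linarith

/-! ### Tubes of parallel straight lines -/

/-- A point, a unit direction, and an isometric parametrization of the orthogonal complement of
the direction. -/
structure ChordFrame (d : ℕ) where
  base : E d
  dir : E d
  emb : E (d - 1) →ₗᵢ[ℝ] E d
  norm_dir : ‖dir‖ = 1
  inner_emb : ∀ w, inner ℝ (emb w) dir = 0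
  decomp : ∀ x, x = (inner ℝ dir x : ℝ) • dir + emb (ContinuousLinearMap.adjoint
    emb.toContinuousLinearMap x)

lemma exists_chordFrame {d : ℕ} (hd : 1 ≤ d) (y e : E d) (he : ‖e‖ = 1) :
    ∃ F : ChordFrame d, F.base = y ∧ F.dir = e := by
  have : Fact (Module.finrank ℝ (E d) = (d - 1) + 1) := ⟨by simp; omega⟩
  have he0 : e ≠ 0 := by rintro rfl; simp at he
  have hfr : Module.finrank ℝ (ℝ ∙ e)ᗮ = d - 1 := Submodule.finrank_orthogonal_span_singleton he0
  let b := (stdOrthonormalBasis ℝ (ℝ ∙ e)ᗮ).reindex (finCongr hfr)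
  let ι : E (d - 1) →ₗᵢ[ℝ] E d := (ℝ ∙ e)ᗮ.subtypeₗᵢ.comp b.repr.symm.toLinearIsometry
  have hι : ∀ w, inner ℝ (ι w) e = 0 := fun w =>
    Submodule.mem_orthogonal_singleton_iff_inner_left.1 (b.repr.symm w).2
  refine ⟨⟨y, e, ι, he, hι, fun x => ?_⟩, rfl, rfl⟩
  have hz : x - (inner ℝ e x : ℝ) • e ∈ (ℝ ∙ e)ᗮ := by
    rw [Submodule.mem_orthogonal_singleton_iff_inner_right, inner_sub_right, inner_smul_right,
      real_inner_self_eq_norm_sq, he]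
    ring
  obtain ⟨w, hw⟩ : ∃ w, ι w = x - (inner ℝ e x : ℝ) • e :=
    ⟨b.repr ⟨_, hz⟩, by simp [ι]⟩
  have hx : x = (inner ℝ e x : ℝ) • e + ι w := by rw [hw]; abel
  have hadj : ContinuousLinearMap.adjoint ι.toContinuousLinearMap x = w := by
    refine ext_inner_right ℝ fun u => ?_
    rw [ContinuousLinearMap.adjoint_inner_left]
    conv_lhs => rw [hx]
    rw [inner_add_left, inner_smul_left]
    have h1 : inner ℝ e (ι.toContinuousLinearMap u) = 0 := by
      rw [real_inner_comm]; exact hι u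
    rw [h1, mul_zero, zero_add]
    exact ι.inner_map_map w u
  rw [hadj]; exact hx

/-! ### Coordinates along and across a bundle of parallel lines -/

namespace ChordFrame

variable {d : ℕ} (F : ChordFrame d)

/-- The velocity with transversal component `a`. -/
def vel (a : E (d - 1)) : E d := F.dir + F.emb a

/-- The position at time `t` on the line with velocity `vel a` through the cross section at `w`. -/
def pt (a w : E (d - 1)) (t : ℝ) : E d := F.base + F.emb w + t • F.vel a

/-- The coordinate along the chord. -/
def time (x : E d) : ℝ := inner ℝ F.dir (x - F.base)

/-- The adjoint of the parametrization of the cross section. -/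
def proj : E d →L[ℝ] E (d - 1) := ContinuousLinearMap.adjoint F.emb.toContinuousLinearMap

/-- The point of the cross section on the line with velocity `vel a` through `x`. -/
def cross (a : E (d - 1)) (x : E d) : E (d - 1) := F.proj (x - F.base) - F.time x • a

lemma inner_dir_emb (w : E (d - 1)) : inner ℝ F.dir (F.emb w) = 0 := by
  rw [real_inner_comm]; exact F.inner_emb w

lemma proj_emb (w : E (d - 1)) : F.proj (F.emb w) = w := by
  refine ext_inner_right ℝ fun u => ?_
  rw [proj, ContinuousLinearMap.adjoint_inner_left]
  exact F.emb.inner_map_map w u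

lemma proj_dir : F.proj F.dir = 0 := by
  refine ext_inner_right ℝ fun u => ?_
  rw [proj, ContinuousLinearMap.adjoint_inner_left, inner_zero_left]
  exact F.inner_dir_emb u

lemma norm_proj_le (x : E d) : ‖F.proj x‖ ≤ ‖x‖ := by
  have h : ‖F.proj‖ ≤ 1 := by
    rw [proj, LinearIsometryEquiv.norm_map]; exact F.emb.norm_toContinuousLinearMap_le
  simpa using F.proj.le_of_opNorm_le h x

lemma time_pt (a w : E (d - 1)) (t : ℝ) : F.time (F.pt a w t) = t := by
  have : F.pt a w t - F.base = F.emb w + t • F.dir + t • F.emb a := by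
    simp only [pt, vel, smul_add]; abel
  rw [time, this, inner_add_right, inner_add_right, inner_smul_right, inner_smul_right,
    F.inner_dir_emb, F.inner_dir_emb, real_inner_self_eq_norm_sq, F.norm_dir]
  ring

lemma cross_pt (a w : E (d - 1)) (t : ℝ) : F.cross a (F.pt a w t) = w := by
  have : F.pt a w t - F.base = F.emb w + t • F.dir + t • F.emb a := by
    simp only [pt, vel, smul_add]; abel
  rw [cross, F.time_pt, this]
  simp [F.proj_emb, F.proj_dir]

lemma pt_cross_time (a : E (d - 1)) (x : E d) : F.pt a (F.cross a x) (F.time x) = x := by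
  have h := F.decomp (x - F.base)
  have : F.pt a (F.cross a x) (F.time x) =
      F.base + (F.time x • F.dir + F.emb (F.proj (x - F.base))) := by
    simp only [pt, cross, vel, map_sub, map_smul, smul_add]; abel
  rw [this, time, proj, ← h]; abel

lemma pt_add_smul (a w : E (d - 1)) (t s : ℝ) :
    F.pt a w t + s • F.vel a = F.pt a w (t + s) := by
  simp only [pt, add_smul]; abel

lemma cross_add_smul (a : E (d - 1)) (x : E d) (s : ℝ) :
    F.cross a (x + s • F.vel a) = F.cross a x := by
  conv_lhs => rw [← F.pt_cross_time a x, F.pt_add_smul, F.cross_pt]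

lemma time_add_smul (a : E (d - 1)) (x : E d) (s : ℝ) :
    F.time (x + s • F.vel a) = F.time x + s := by
  conv_lhs => rw [← F.pt_cross_time a x, F.pt_add_smul, F.time_pt]

lemma abs_time_sub_le (x y : E d) : |F.time x - F.time y| ≤ ‖x - y‖ := by
  have : F.time x - F.time y = inner ℝ F.dir (x - y) := by
    rw [time, time, ← inner_sub_right]; congr 1; abel
  rw [this]
  simpa [F.norm_dir] using abs_real_inner_le_norm F.dir (x - y)

lemma norm_cross_sub_le (a : E (d - 1)) (x y : E d) :
    ‖F.cross a x - F.cross a y‖ ≤ (1 + ‖a‖) * ‖x - y‖ := by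
  have : F.cross a x - F.cross a y = F.proj (x - y) - (F.time x - F.time y) • a := by
    simp only [cross, map_sub, sub_smul]; abel
  rw [this]
  calc _ ≤ ‖F.proj (x - y)‖ + ‖(F.time x - F.time y) • a‖ := norm_sub_le _ _
    _ ≤ ‖x - y‖ + ‖x - y‖ * ‖a‖ := by
        rw [norm_smul]
        gcongr
        · exact F.norm_proj_le _
        · exact F.abs_time_sub_le _ _
    _ = _ := by ring

lemma norm_vel_le (a : E (d - 1)) : ‖F.vel a‖ ≤ 1 + ‖a‖ := by
  calc _ ≤ ‖F.dir‖ + ‖F.emb a‖ := norm_add_le _ _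
    _ = _ := by rw [F.norm_dir, F.emb.norm_map]

lemma norm_pt_sub_le (a w : E (d - 1)) (t : ℝ) (w' : E (d - 1)) (t' : ℝ) :
    ‖F.pt a w t - F.pt a w' t'‖ ≤ ‖w - w'‖ + |t - t'| * (1 + ‖a‖) := by
  have : F.pt a w t - F.pt a w' t' = F.emb (w - w') + (t - t') • F.vel a := by
    simp only [pt, map_sub, sub_smul]; abel
  rw [this]
  calc _ ≤ ‖F.emb (w - w')‖ + ‖(t - t') • F.vel a‖ := norm_add_le _ _
    _ ≤ _ := by
      rw [F.emb.norm_map, norm_smul, Real.norm_eq_abs]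
      gcongr
      exact F.norm_vel_le a

lemma continuous_time : Continuous F.time := by unfold time; fun_prop

lemma continuous_cross (a : E (d - 1)) : Continuous (F.cross a) := by
  have := F.continuous_time
  unfold cross; fun_prop

end ChordFrame

/-- Lines in directions close to a chord cross the boundary of `Ω` in two Lipschitz graphs `α` and
`β`, where they enter and leave `Ω`. -/
structure TubeFamily {d : ℕ} (Ω : Set (E d)) extends ChordFrame d where
  ρ : ℝ
  lo : ℝ
  hi : ℝ
  -- The time `-ℓ` separates entry from exit on all lines. As the outflow end of the chord is at
  -- time zero, `ℓ` is also the lever arm by which a change of direction moves the entry point.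
  ℓ : ℝ
  M : ℝ
  α : E (d - 1) → E (d - 1) → ℝ
  β : E (d - 1) → E (d - 1) → ℝ
  ρ_pos : 0 < ρ
  ρ_le : ρ ≤ 1 / 4
  hi_pos : 0 < hi
  ℓ_pos : 0 < ℓ
  M_nonneg : 0 ≤ M
  base_mem : base ∈ frontier Ω
  lo_lt : ∀ a w, ‖a‖ < ρ → ‖w‖ < ρ → lo < α a w
  α_le : ∀ a w, ‖a‖ < ρ → ‖w‖ < ρ → α a w ≤ -ℓ
  lt_β : ∀ a w, ‖a‖ < ρ → ‖w‖ < ρ → -ℓ < β a w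
  β_lt : ∀ a w, ‖a‖ < ρ → ‖w‖ < ρ → β a w < hi
  mem_iff : ∀ a w t, ‖a‖ < ρ → ‖w‖ < ρ → t ∈ Ioo lo hi →
    (toChordFrame.pt a w t ∈ Ω ↔ α a w < t ∧ t < β a w)
  frontier_iff : ∀ a w t, ‖a‖ < ρ → ‖w‖ < ρ → t ∈ Ioo lo hi →
    (toChordFrame.pt a w t ∈ frontier Ω ↔ t = α a w ∨ t = β a w)
  α_lip : ∀ a w a' w', ‖a‖ < ρ → ‖w‖ < ρ → ‖a'‖ < ρ → ‖w'‖ < ρ →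
    |α a w - α a' w'| ≤ M * (‖a - a'‖ + ‖w - w'‖)
  β_lip : ∀ a w a' w', ‖a‖ < ρ → ‖w‖ < ρ → ‖a'‖ < ρ → ‖w'‖ < ρ →
    |β a w - β a' w'| ≤ M * (‖a - a'‖ + ‖w - w'‖)
  α_inflow : ∀ a w, ‖a‖ < ρ → ‖w‖ < ρ →
    toChordFrame.pt a w (α a w) ∈ inflow Ω fun _ => toChordFrame.vel a
  β_outflow : ∀ a w, ‖a‖ < ρ → ‖w‖ < ρ →
    toChordFrame.pt a w (β a w) ∈ outflow Ω fun _ => toChordFrame.vel a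
  α_cone : ∀ a w, ‖a‖ < ρ → ‖w‖ < ρ → ∃ c > 0, ∀ᶠ r : ℝ in 𝓝[>] 0,
    Metric.ball (toChordFrame.pt a w (α a w) + r • toChordFrame.vel a) (c * r) ⊆ Ω
  β_cone : ∀ a w, ‖a‖ < ρ → ‖w‖ < ρ → ∃ c > 0, ∀ᶠ r : ℝ in 𝓝[>] 0,
    Metric.ball (toChordFrame.pt a w (β a w) + r • -toChordFrame.vel a) (c * r) ⊆ Ω

/-- Near a point where a defining function increases in the direction `e`, it increases along all
directions close to `e`. -/
lemma IsDefiningOn.exists_cone {d : ℕ} {Ω W : Set (E d)} {φ : E d → ℝ} {x e : E d}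
    (h : IsDefiningOn Ω φ W) (hx : x ∈ W) (he : 0 < fderiv ℝ φ x e) :
    ∃ R > 0, ∃ η > 0, Metric.ball x R ⊆ W ∧
      (∀ z ∈ Metric.ball x R, ∀ ξ, ‖ξ - e‖ ≤ η → 0 < fderiv ℝ φ z ξ) ∧
      (∀ z ∈ Metric.ball x R, ∀ s > (0 : ℝ), ∀ ξ, ‖ξ - e‖ ≤ η → z + s • ξ ∈ Metric.ball x R →
        φ z < φ (z + s • ξ)) := by
  have hc : ContinuousAt (fun p : E d × E d => fderiv ℝ φ p.1 p.2) (x, e) := by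
    have h1 : ContinuousAt (fun p : E d × E d => fderiv ℝ φ p.1) (x, e) :=
      ContinuousAt.comp (f := fun p : E d × E d => p.1) (x := (x, e))
        (h.continuousOn_fderiv.continuousAt (h.isOpen.mem_nhds hx)) continuousAt_fst
    exact h1.clm_apply continuousAt_snd
  have hpos := (hc.eventually_const_lt (u := 0) he).and
    ((h.isOpen.prod isOpen_univ).mem_nhds (show (x, e) ∈ W ×ˢ univ from ⟨hx, mem_univ _⟩))
  obtain ⟨r, hr, H⟩ := Metric.eventually_nhds_iff_ball.1 hpos
  have hfd : ∀ z ∈ Metric.ball x r, ∀ ξ, ‖ξ - e‖ ≤ r / 2 → 0 < fderiv ℝ φ z ξ := by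
    intro z hz ξ hξ
    refine (H (z, ξ) ?_).1
    rw [← ball_prod_same]
    refine ⟨hz, ?_⟩
    rw [Metric.mem_ball, dist_eq_norm]; linarith
  have hW : Metric.ball x r ⊆ W := fun z hz => by
    refine (H (z, e) ?_).2.1
    rw [← ball_prod_same]
    exact ⟨hz, Metric.mem_ball_self hr⟩
  refine ⟨r, hr, r / 2, by positivity, hW, hfd, fun z hz s hs ξ hξ hz' => ?_⟩
  obtain ⟨y, hy, hy'⟩ := domain_mvt (f := φ) (s := Metric.ball x r) (x := z) (y := z + s • ξ)
    (f' := fun y => fderiv ℝ φ y)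
    (fun y hy => (h.hasFDerivAt (hW hy)).hasFDerivWithinAt) (convex_ball x r) hz hz'
  have hyb := (convex_ball x r).segment_subset hz hz' hy
  have := hfd y hyb ξ hξ
  rw [add_sub_cancel_left, map_smul, smul_eq_mul] at hy'
  have := mul_pos hs this
  linarith

/-- Two zeros of a function that increases along a cone differ mostly in directions transversal to
the cone. -/
lemma abs_mul_le_norm_of_cone {X : Type*} [NormedAddCommGroup X] [NormedSpace ℝ X] {φ : X → ℝ}
    {B : Set X} {e : X} {η : ℝ}
    (H : ∀ z ∈ B, ∀ s > (0 : ℝ), ∀ ξ, ‖ξ - e‖ ≤ η → z + s • ξ ∈ B → φ z < φ (z + s • ξ))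
    {z z' v ζ : X} {s : ℝ} (hz : z ∈ B) (hz' : z' ∈ B) (h0 : φ z = 0) (h0' : φ z' = 0)
    (hv : ‖v - e‖ ≤ η / 2) (h : z' = z + s • v + ζ) : |s| * (η / 2) ≤ ‖ζ‖ := by
  by_contra! hlt
  have hs0 : s ≠ 0 := by
    rintro rfl
    simp at hlt
    exact absurd hlt (norm_nonneg ζ).not_gt
  have hsa : 0 < |s| := abs_pos.2 hs0
  -- If `ζ` is small compared with `s`, the displacement from `z` to `z'` is a multiple of a vector
  -- in the cone, and `φ` would be strictly monotone between its two zeros.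
  have hξ : ‖v + s⁻¹ • ζ - e‖ ≤ η := by
    have h1 : ‖s⁻¹ • ζ‖ ≤ η / 2 := by
      rw [norm_smul, norm_inv, Real.norm_eq_abs, inv_mul_le_iff₀ hsa]; exact hlt.le
    calc _ = ‖(v - e) + s⁻¹ • ζ‖ := by congr 1; abel
      _ ≤ ‖v - e‖ + ‖s⁻¹ • ζ‖ := norm_add_le _ _
      _ ≤ η := by linarith
  have e1 : z' = z + s • (v + s⁻¹ • ζ) := by
    rw [h, smul_add, smul_inv_smul₀ hs0, add_assoc]
  rcases lt_or_gt_of_ne hs0 with hs | hs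
  · have e2 : z = z' + (-s) • (v + s⁻¹ • ζ) := by rw [e1, neg_smul]; abel
    have := H z' hz' (-s) (by linarith) _ hξ (by rwa [← e2])
    rw [← e2, h0, h0'] at this
    exact lt_irrefl _ this
  · have := H z hz s hs _ hξ (by rwa [← e1])
    rw [← e1, h0, h0'] at this
    exact lt_irrefl _ this

set_option maxHeartbeats 1000000 in
/-- A bounded domain contains a family of tubes. -/
theorem exists_tubeFamily {d k : ℕ} (hd : 1 ≤ d) (hk : 1 ≤ k) {Ω : Set (E d)} (hΩ : IsOpen Ω)
    (hb : Bornology.IsBounded Ω) (hne : Ω.Nonempty) (A : BoundaryAtlas k Ω) :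
    Nonempty (TubeFamily Ω) := by
  obtain ⟨y₀, y₁, φ₀, φ₁, W₀, W₁, hy, hseg, h0, h1, hW0, hW1, e0, e1, hp0, hp1⟩ :=
    exists_transversal_chord hd hk hΩ hb hne A
  set L := ‖y₁ - y₀‖ with hL
  have hL0 : 0 < L := norm_pos_iff.2 (sub_ne_zero.2 hy.symm)
  set e := L⁻¹ • (y₁ - y₀) with he
  have hen : ‖e‖ = 1 := by
    rw [he, norm_smul, norm_inv, Real.norm_of_nonneg hL0.le, inv_mul_cancel₀ hL0.ne']
  have hLe : L • e = y₁ - y₀ := by rw [he, smul_inv_smul₀ hL0.ne']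
  obtain ⟨F, hFb, hFd⟩ := exists_chordFrame hd y₁ e hen
  have hq0 : 0 < fderiv ℝ φ₀ y₀ e := by rw [he, map_smul]; exact mul_pos (by positivity) hp0
  have hq1 : 0 < fderiv ℝ φ₁ y₁ (-e) := by
    rw [map_neg, he, map_smul, smul_eq_mul, ← mul_neg]
    exact mul_pos (by positivity) (by linarith)
  obtain ⟨R₀, hR0, η₀, hη0, hBW0, hD0, hC0⟩ := h0.exists_cone hW0 hq0
  obtain ⟨R₁, hR1, η₁, hη1, hBW1, hD1, hC1⟩ := h1.exists_cone hW1 hq1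
  -- Within time `δ` of an end the lines remain in the ball where the cone property holds, with room
  -- for a lateral displacement `τ ≤ δ`. The bound `L / 4` keeps the two ends apart.
  set δ := min (L / 4) (min (R₀ / 4) (R₁ / 4)) with hδ
  have hδ0 : 0 < δ := by positivity
  have hδL : δ ≤ L / 4 := min_le_left _ _
  have hδR0 : δ ≤ R₀ / 4 := (min_le_right _ _).trans (min_le_left _ _)
  have hδR1 : δ ≤ R₁ / 4 := (min_le_right _ _).trans (min_le_right _ _)
  have hax : ∀ t : ℝ, y₁ + t • e = y₀ + (t + L) • e := fun t => by
    rw [add_smul, hLe]; abel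
  have dist_smul_e : ∀ (y : E d) (t : ℝ), dist (y + t • e) y = |t| := fun y t => by
    rw [dist_eq_norm, add_sub_cancel_left, norm_smul, hen, mul_one, Real.norm_eq_abs]
  -- the middle part of the chord
  have hKc : IsCompact ((fun t : ℝ => y₁ + t • e) '' Icc (-L + δ) (-δ)) :=
    isCompact_Icc.image (by fun_prop)
  have hKΩ : (fun t : ℝ => y₁ + t • e) '' Icc (-L + δ) (-δ) ⊆ Ω := by
    rintro _ ⟨t, ht, rfl⟩
    apply hseg
    refine ⟨-t / L, 1 + t / L, ?_, ?_, by ring, ?_⟩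
    · have : 0 < -t := by linarith [ht.2]
      positivity
    · have : 1 + t / L = (L + t) / L := by field_simp
      rw [this]
      have : 0 < L + t := by linarith [ht.1]
      positivity
    · have : t • e = (t / L) • (y₁ - y₀) := by rw [he, smul_smul, div_eq_mul_inv]
      simp only [this]
      module
  obtain ⟨θ, hθ0, hθ⟩ := hKc.exists_thickening_subset_open hΩ hKΩ
  -- the points behind the ends of the chord
  have hback0 : ∃ θ₀ > 0, ∀ z ∈ Metric.ball (y₁ + (-L - δ) • e) θ₀, φ₀ z < 0 := by
    have hm : y₁ + (-L - δ) • e ∈ Metric.ball y₀ R₀ := by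
      rw [hax, Metric.mem_ball, dist_smul_e]
      rw [show -L - δ + L = -δ by ring, abs_neg, abs_of_pos hδ0]; linarith
    have hneg : φ₀ (y₁ + (-L - δ) • e) < 0 := by
      have h2 : y₁ + (-L - δ) • e + δ • e = y₀ := by
        rw [hax, add_assoc, ← add_smul, show -L - δ + L + δ = 0 by ring, zero_smul, add_zero]
      have := hC0 _ hm δ hδ0 e (by simpa using hη0.le)
        (by rw [h2]; exact Metric.mem_ball_self hR0)
      rwa [h2, e0] at this
    have hcont := (h0.hasFDerivAt (hBW0 hm)).continuousAt
    obtain ⟨r, hr, H⟩ := Metric.eventually_nhds_iff_ball.1 (hcont.eventually_lt_const hneg)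
    exact ⟨r, hr, H⟩
  have hback1 : ∃ θ₁ > 0, ∀ z ∈ Metric.ball (y₁ + δ • e) θ₁, φ₁ z < 0 := by
    have hm : y₁ + δ • e ∈ Metric.ball y₁ R₁ := by
      rw [Metric.mem_ball, dist_smul_e, abs_of_pos hδ0]; linarith
    have hneg : φ₁ (y₁ + δ • e) < 0 := by
      have h2 : y₁ + δ • e + δ • (-e) = y₁ := by simp
      have := hC1 _ hm δ hδ0 (-e) (by simpa using hη1.le)
        (by rw [h2]; exact Metric.mem_ball_self hR1)
      rwa [h2, e1] at this
    have hcont := (h1.hasFDerivAt (hBW1 hm)).continuousAt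
    obtain ⟨r, hr, H⟩ := Metric.eventually_nhds_iff_ball.1 (hcont.eventually_lt_const hneg)
    exact ⟨r, hr, H⟩
  obtain ⟨θ₀, hθ00, hθ₀⟩ := hback0
  obtain ⟨θ₁, hθ10, hθ₁⟩ := hback1
  set κ := 1 + L + δ with hκ
  have hκ0 : 0 < κ := by positivity
  -- Lines closer than `τ` to the chord keep their middle part in `Ω` and have a negative defining
  -- function just beyond each end.
  set τ := min (min δ θ) (min θ₀ θ₁) with hτ
  have hτ0 : 0 < τ := by positivity
  have hτδ : τ ≤ δ := (min_le_left _ _).trans (min_le_left _ _)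
  have hτθ : τ ≤ θ := (min_le_left _ _).trans (min_le_right _ _)
  have hτ₀ : τ ≤ θ₀ := (min_le_right _ _).trans (min_le_left _ _)
  have hτ₁ : τ ≤ θ₁ := (min_le_right _ _).trans (min_le_right _ _)
  -- Directions use at most half the opening of the cones; the other half yields the Lipschitz
  -- bounds. The factor `κ` bounds the drift from the chord over all times considered.
  set ρ := min (1 / 4) (min (min (η₀ / 2) (η₁ / 2)) (τ / (2 * κ))) with hρ
  have hρ0 : 0 < ρ := by positivity
  have hρ4 : ρ ≤ 1 / 4 := min_le_left _ _
  have hρη0 : ρ ≤ η₀ / 2 := (min_le_right _ _).trans ((min_le_left _ _).trans (min_le_left _ _))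
  have hρη1 : ρ ≤ η₁ / 2 := (min_le_right _ _).trans ((min_le_left _ _).trans (min_le_right _ _))
  have hρκ : ρ * κ ≤ τ / 2 := by
    have : ρ ≤ τ / (2 * κ) := (min_le_right _ _).trans (min_le_right _ _)
    rw [le_div_iff₀ (by positivity)] at this
    linarith
  have hclose : ∀ a w t, ‖a‖ < ρ → ‖w‖ < ρ → |t| ≤ L + δ →
      dist (F.pt a w t) (y₁ + t • e) < τ := by
    intro a w t ha hw ht
    have : F.pt a w t - (y₁ + t • e) = F.emb w + t • F.emb a := by
      simp only [ChordFrame.pt, ChordFrame.vel, hFb, hFd, smul_add]; abel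
    rw [dist_eq_norm, this]
    calc _ ≤ ‖F.emb w‖ + ‖t • F.emb a‖ := norm_add_le _ _
      _ = ‖w‖ + |t| * ‖a‖ := by
          rw [norm_smul, F.emb.norm_map, F.emb.norm_map, Real.norm_eq_abs]
      _ ≤ ρ + (L + δ) * ρ := by gcongr
      _ = ρ * κ := by rw [hκ]; ring
      _ < τ := by linarith
  have near1 : ∀ a w t, ‖a‖ < ρ → ‖w‖ < ρ → |t| ≤ δ → F.pt a w t ∈ Metric.ball y₁ R₁ := by
    intro a w t ha hw ht
    rw [Metric.mem_ball]
    have h2 := hclose a w t ha hw (by linarith)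
    have h3 := dist_triangle (F.pt a w t) (y₁ + t • e) y₁
    rw [dist_smul_e] at h3
    linarith
  have near0 : ∀ a w t, ‖a‖ < ρ → ‖w‖ < ρ → |t + L| ≤ δ → F.pt a w t ∈ Metric.ball y₀ R₀ := by
    intro a w t ha hw ht
    rw [Metric.mem_ball]
    have h2 := hclose a w t ha hw (by
      rw [abs_le] at ht ⊢; constructor <;> linarith)
    have h3 := dist_triangle (F.pt a w t) (y₁ + t • e) y₀
    have h4 : dist (y₁ + t • e) y₀ = |t + L| := by rw [hax, dist_smul_e]
    rw [h4] at h3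
    linarith
  have hmid : ∀ a w t, ‖a‖ < ρ → ‖w‖ < ρ → -L + δ ≤ t → t ≤ -δ → F.pt a w t ∈ Ω := by
    intro a w t ha hw ht ht'
    refine hθ (Metric.mem_thickening_iff.2 ⟨y₁ + t • e, ⟨t, ⟨ht, ht'⟩, rfl⟩, ?_⟩)
    exact (hclose a w t ha hw (by rw [abs_le]; constructor <;> linarith)).trans_le hτθ
  have hvel : ∀ a, ‖F.vel a - e‖ = ‖a‖ := fun a => by
    rw [ChordFrame.vel, hFd, add_sub_cancel_left, F.emb.norm_map]
  have hvel' : ∀ a, ‖-F.vel a - -e‖ = ‖a‖ := fun a => by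
    rw [neg_sub_neg, norm_sub_rev, hvel]
  have mono0 : ∀ a w t t', ‖a‖ < ρ → ‖w‖ < ρ → |t + L| ≤ δ → |t' + L| ≤ δ → t < t' →
      φ₀ (F.pt a w t) < φ₀ (F.pt a w t') := by
    intro a w t t' ha hw ht ht' htt
    have h2 : F.pt a w t' = F.pt a w t + (t' - t) • F.vel a := by
      rw [F.pt_add_smul]; congr 1; ring
    rw [h2]
    exact hC0 _ (near0 a w t ha hw ht) _ (by linarith) _ (by rw [hvel]; linarith)
      (by rw [← h2]; exact near0 a w t' ha hw ht')
  have mono1 : ∀ a w t t', ‖a‖ < ρ → ‖w‖ < ρ → |t| ≤ δ → |t'| ≤ δ → t < t' →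
      φ₁ (F.pt a w t') < φ₁ (F.pt a w t) := by
    intro a w t t' ha hw ht ht' htt
    have h2 : F.pt a w t = F.pt a w t' + (t' - t) • -F.vel a := by
      rw [smul_neg, ← neg_smul, F.pt_add_smul]; congr 1; ring
    rw [h2]
    exact hC1 _ (near1 a w t' ha hw ht') _ (by linarith) _ (by rw [hvel']; linarith)
      (by rw [← h2]; exact near1 a w t ha hw ht)
  have hcpt : ∀ a w, Continuous (F.pt a w) := fun a w => by unfold ChordFrame.pt; fun_prop
  -- The entry time is a zero of `φ₀`, found by the intermediate value theorem. The smallness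
  -- conditions are inside the existential so that a total function can be chosen, with an arbitrary
  -- value elsewhere.
  have exα : ∀ a w, ∃ t, ‖a‖ < ρ → ‖w‖ < ρ → t ∈ Ioo (-L - δ) (-L + δ) ∧ φ₀ (F.pt a w t) = 0 := by
    intro a w
    by_cases ha : ‖a‖ < ρ
    · by_cases hw : ‖w‖ < ρ
      · have hco : ContinuousOn (fun t => φ₀ (F.pt a w t)) (Icc (-L - δ) (-L + δ)) := by
          refine h0.contDiffOn.continuousOn.comp (hcpt a w).continuousOn fun t ht => ?_
          exact hBW0 (near0 a w t ha hw (by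
            rw [abs_le]; constructor <;> linarith [ht.1, ht.2]))
        have habs : |(-L - δ)| ≤ L + δ := by rw [abs_le]; constructor <;> linarith
        have habs' : |-L + δ + L| ≤ δ := by rw [abs_le]; constructor <;> linarith
        have hn : φ₀ (F.pt a w (-L - δ)) < 0 := hθ₀ _ ((hclose a w _ ha hw habs).trans_le hτ₀)
        have hp : 0 < φ₀ (F.pt a w (-L + δ)) :=
          (h0.mem_iff _ (hBW0 (near0 a w _ ha hw habs'))).1 (hmid a w _ ha hw le_rfl (by linarith))
        obtain ⟨t, ht, ht'⟩ := intermediate_value_Ioo (by linarith) hco ⟨hn, hp⟩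
        exact ⟨t, fun _ _ => ⟨ht, ht'⟩⟩
      · exact ⟨0, fun _ h => absurd h hw⟩
    · exact ⟨0, fun h => absurd h ha⟩
  have exβ : ∀ a w, ∃ t, ‖a‖ < ρ → ‖w‖ < ρ → t ∈ Ioo (-δ) δ ∧ φ₁ (F.pt a w t) = 0 := by
    intro a w
    by_cases ha : ‖a‖ < ρ
    · by_cases hw : ‖w‖ < ρ
      · have hco : ContinuousOn (fun t => φ₁ (F.pt a w t)) (Icc (-δ) δ) := by
          refine h1.contDiffOn.continuousOn.comp (hcpt a w).continuousOn fun t ht => ?_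
          exact hBW1 (near1 a w t ha hw (by
            rw [abs_le]; constructor <;> linarith [ht.1, ht.2]))
        have habs : |δ| ≤ L + δ := by rw [abs_le]; constructor <;> linarith
        have habs' : |-δ| ≤ δ := by rw [abs_le]; constructor <;> linarith
        have hn : φ₁ (F.pt a w δ) < 0 := hθ₁ _ ((hclose a w _ ha hw habs).trans_le hτ₁)
        have hp : 0 < φ₁ (F.pt a w (-δ)) :=
          (h1.mem_iff _ (hBW1 (near1 a w _ ha hw habs'))).1 (hmid a w _ ha hw (by linarith) le_rfl)
        obtain ⟨t, ht, ht'⟩ := intermediate_value_Ioo' (by linarith) hco ⟨hn, hp⟩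
        exact ⟨t, fun _ _ => ⟨ht, ht'⟩⟩
      · exact ⟨0, fun _ h => absurd h hw⟩
    · exact ⟨0, fun h => absurd h ha⟩
  choose α hα using exα
  choose β hβ using exβ
  have absα : ∀ a w, ‖a‖ < ρ → ‖w‖ < ρ → |α a w + L| ≤ δ := fun a w ha hw => by
    have := (hα a w ha hw).1
    rw [abs_le]; constructor <;> linarith [this.1, this.2]
  have absβ : ∀ a w, ‖a‖ < ρ → ‖w‖ < ρ → |β a w| ≤ δ := fun a w ha hw => by
    have := (hβ a w ha hw).1
    rw [abs_le]; constructor <;> linarith [this.1, this.2]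
  have iff0 : ∀ a w t, ‖a‖ < ρ → ‖w‖ < ρ → |t + L| ≤ δ →
      (0 < φ₀ (F.pt a w t) ↔ α a w < t) ∧ (φ₀ (F.pt a w t) = 0 ↔ t = α a w) := by
    intro a w t ha hw ht
    have hz := (hα a w ha hw).2
    rcases lt_trichotomy t (α a w) with h | h | h
    · have := mono0 a w _ _ ha hw ht (absα a w ha hw) h
      rw [hz] at this
      exact ⟨⟨fun h' => absurd h' this.not_gt, fun h' => absurd h h'.not_gt⟩,
        ⟨fun h' => absurd h' this.ne, fun h' => absurd h' h.ne⟩⟩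
    · rw [h, hz]; simp
    · have := mono0 a w _ _ ha hw (absα a w ha hw) ht h
      rw [hz] at this
      exact ⟨⟨fun _ => h, fun _ => this⟩,
        ⟨fun h' => absurd h' this.ne', fun h' => absurd h' h.ne'⟩⟩
  have iff1 : ∀ a w t, ‖a‖ < ρ → ‖w‖ < ρ → |t| ≤ δ →
      (0 < φ₁ (F.pt a w t) ↔ t < β a w) ∧ (φ₁ (F.pt a w t) = 0 ↔ t = β a w) := by
    intro a w t ha hw ht
    have hz := (hβ a w ha hw).2
    rcases lt_trichotomy t (β a w) with h | h | h
    · have := mono1 a w _ _ ha hw ht (absβ a w ha hw) h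
      rw [hz] at this
      exact ⟨⟨fun _ => h, fun _ => this⟩,
        ⟨fun h' => absurd h' this.ne', fun h' => absurd h' h.ne⟩⟩
    · rw [h, hz]; simp
    · have := mono1 a w _ _ ha hw (absβ a w ha hw) ht h
      rw [hz] at this
      exact ⟨⟨fun h' => absurd h' this.not_gt, fun h' => absurd h h'.not_gt⟩,
        ⟨fun h' => absurd h' this.ne, fun h' => absurd h' h.ne'⟩⟩
  have hMα : 2 * κ / η₀ ≤ 2 * κ / η₀ + 2 * κ / η₁ := le_add_of_nonneg_right (by positivity)
  have hMβ : 2 * κ / η₁ ≤ 2 * κ / η₀ + 2 * κ / η₁ := le_add_of_nonneg_left (by positivity)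
  -- Two crossing points differ by a multiple of the velocity plus a transversal error that is
  -- linear in the change of data. With the cone property this gives the Lipschitz bounds for `α`
  -- and `β`.
  have hdiff : ∀ a w t a' w' t', F.pt a' w' t' =
      F.pt a w t + (t' - t) • F.vel a + (F.emb (w' - w) + t' • F.emb (a' - a)) := by
    intro a w t a' w' t'
    simp only [ChordFrame.pt, ChordFrame.vel, map_sub]; module
  have hζ : ∀ a w a' w' (t' : ℝ), |t'| ≤ L + δ →
      ‖F.emb (w' - w) + t' • F.emb (a' - a)‖ ≤ κ * (‖a - a'‖ + ‖w - w'‖) := by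
    intro a w a' w' t' ht'
    calc _ ≤ ‖F.emb (w' - w)‖ + ‖t' • F.emb (a' - a)‖ := norm_add_le _ _
      _ = ‖w - w'‖ + |t'| * ‖a - a'‖ := by
          rw [norm_smul, F.emb.norm_map, F.emb.norm_map, Real.norm_eq_abs, norm_sub_rev w',
            norm_sub_rev a']
      _ ≤ ‖w - w'‖ + (L + δ) * ‖a - a'‖ := by gcongr
      _ ≤ _ := by rw [hκ]; nlinarith [norm_nonneg (a - a'), norm_nonneg (w - w')]
  -- Since `δ ≤ L / 4`, entry happens before `-3 * L / 4` and exit after `-L / 4`, so `ℓ = L / 2` is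
  -- admissible.
  refine ⟨{ F with
    ρ := ρ, lo := -L - δ, hi := δ, ℓ := L / 2, M := 2 * κ / η₀ + 2 * κ / η₁, α := α, β := β
    ρ_pos := hρ0, ρ_le := hρ4, hi_pos := hδ0, ℓ_pos := by positivity, M_nonneg := by positivity
    base_mem := ?_, lo_lt := fun a w ha hw => (hα a w ha hw).1.1
    α_le := fun a w ha hw => ?_, lt_β := fun a w ha hw => ?_
    β_lt := fun a w ha hw => (hβ a w ha hw).1.2
    mem_iff := fun a w t ha hw ht => ?_, frontier_iff := fun a w t ha hw ht => ?_
    α_lip := fun a w a' w' ha hw ha' hw' => ?_, β_lip := fun a w a' w' ha hw ha' hw' => ?_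
    α_inflow := fun a w ha hw => ?_, β_outflow := fun a w ha hw => ?_
    α_cone := fun a w ha hw => ?_, β_cone := fun a w ha hw => ?_ }⟩
  · rw [hFb, h1.frontier_iff hΩ hW1, e1]
  · linarith [(hα a w ha hw).1.2]
  · linarith [(hβ a w ha hw).1.1]
  · have hαb := (hα a w ha hw).1
    have hβb := (hβ a w ha hw).1
    rcases le_total t (-L + δ) with h2 | h2
    · have h3 : |t + L| ≤ δ := by rw [abs_le]; constructor <;> linarith [ht.1]
      rw [h0.mem_iff _ (hBW0 (near0 a w t ha hw h3)), (iff0 a w t ha hw h3).1]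
      exact ⟨fun h => ⟨h, by linarith [hβb.1]⟩, fun h => h.1⟩
    · rcases le_total t (-δ) with h3 | h3
      · exact ⟨fun _ => ⟨by linarith [hαb.2], by linarith [hβb.1]⟩,
          fun _ => hmid a w t ha hw h2 h3⟩
      · have h4 : |t| ≤ δ := abs_le.2 ⟨h3, ht.2.le⟩
        rw [h1.mem_iff _ (hBW1 (near1 a w t ha hw h4)), (iff1 a w t ha hw h4).1]
        exact ⟨fun h => ⟨by linarith [hαb.2], h⟩, fun h => h.2⟩
  · have hαb := (hα a w ha hw).1
    have hβb := (hβ a w ha hw).1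
    rcases le_total t (-L + δ) with h2 | h2
    · have h3 : |t + L| ≤ δ := by rw [abs_le]; constructor <;> linarith [ht.1]
      rw [h0.frontier_iff hΩ (hBW0 (near0 a w t ha hw h3)), (iff0 a w t ha hw h3).2]
      exact ⟨fun h => Or.inl h, fun h => h.resolve_right fun h => by linarith [hβb.1]⟩
    · rcases lt_or_ge t (-δ) with h3 | h3
      · have h4 : F.pt a w t ∉ frontier Ω := by
          rw [hΩ.frontier_eq]; exact fun h => h.2 (hmid a w t ha hw h2 h3.le)
        refine ⟨fun h => absurd h h4, ?_⟩
        rintro (h | h)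
        · linarith [hαb.2]
        · linarith [hβb.1]
      · have h4 : |t| ≤ δ := abs_le.2 ⟨h3, ht.2.le⟩
        rw [h1.frontier_iff hΩ (hBW1 (near1 a w t ha hw h4)), (iff1 a w t ha hw h4).2]
        exact ⟨fun h => Or.inr h, fun h => h.resolve_left fun h => by linarith [hαb.2]⟩
  · have h2 := abs_mul_le_norm_of_cone (X := E d) hC0 (near0 a w _ ha hw (absα a w ha hw))
      (near0 a' w' _ ha' hw' (absα a' w' ha' hw')) (hα a w ha hw).2 (hα a' w' ha' hw').2
      (v := F.vel a) (by rw [hvel]; linarith) (hdiff a w _ a' w' _)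
    have h3 := hζ a w a' w' (α a' w') (by
      have := absα a' w' ha' hw'
      rw [abs_le] at this ⊢; constructor <;> linarith)
    rw [abs_sub_comm]
    have h4 : |α a' w' - α a w| ≤ 2 * κ / η₀ * (‖a - a'‖ + ‖w - w'‖) := by
      rw [div_mul_eq_mul_div, le_div_iff₀ hη0]; linarith
    exact h4.trans (by gcongr)
  · have h2 := abs_mul_le_norm_of_cone (X := E d) hC1 (near1 a w _ ha hw (absβ a w ha hw))
      (near1 a' w' _ ha' hw' (absβ a' w' ha' hw')) (hβ a w ha hw).2 (hβ a' w' ha' hw').2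
      (v := -F.vel a) (s := -(β a' w' - β a w)) (by rw [hvel']; linarith)
      (by rw [neg_smul_neg]; exact hdiff a w _ a' w' _)
    have h3 := hζ a w a' w' (β a' w') (by linarith [absβ a' w' ha' hw'])
    rw [abs_sub_comm]
    rw [abs_neg] at h2
    have h4 : |β a' w' - β a w| ≤ 2 * κ / η₁ * (‖a - a'‖ + ‖w - w'‖) := by
      rw [div_mul_eq_mul_div, le_div_iff₀ hη1]; linarith
    exact h4.trans (by gcongr)
  · have h2 := near0 a w _ ha hw (absα a w ha hw)
    exact h0.mem_inflow hΩ (hBW0 h2) (hα a w ha hw).2 (hD0 _ h2 _ (by rw [hvel]; linarith))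
  · have h2 := near1 a w _ ha hw (absβ a w ha hw)
    refine h1.mem_outflow hΩ (hBW1 h2) (hβ a w ha hw).2 ?_
    have := hD1 _ h2 (-F.vel a) (by rw [hvel']; linarith)
    rw [map_neg] at this
    linarith
  · have h2 := near0 a w _ ha hw (absα a w ha hw)
    exact h0.eventually_ball_subset (hBW0 h2) (hα a w ha hw).2
      (hD0 _ h2 _ (by rw [hvel]; linarith))
  · have h2 := near1 a w _ ha hw (absβ a w ha hw)
    exact h1.eventually_ball_subset (hBW1 h2) (hβ a w ha hw).2
      (hD1 _ h2 _ (by rw [hvel']; linarith))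

/-! ### Weak derivatives in one direction and translations -/

/-- A function whose weak derivative in the direction `v` vanishes is invariant under translations
in this direction. -/
lemma ae_eq_add_of_integral_fderiv_eq_zero {d : ℕ} {O : Set (E d)} {f : E d → ℝ} {v : E d}
    (hf : LocallyIntegrableOn f O volume)
    (hw : ∀ φ : E d → ℝ, ContDiff ℝ (⊤ : ℕ∞) φ → HasCompactSupport φ → tsupport φ ⊆ O →
      ∫ x, f x * fderiv ℝ φ x v = 0) {x₀ : E d} {r τ : ℝ}
    (hB : ∀ s ∈ Icc (0 : ℝ) 1, Metric.closedBall (x₀ + (s * τ) • v) r ⊆ O) :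
    ∀ᵐ x ∂(volume : Measure (E d)), x ∈ Metric.ball x₀ r → f (x + τ • v) - f x = 0 := by
  -- Truncation to the compact set swept by the moving ball makes `f` integrable on the whole space
  -- without changing it where it is tested.
  set K := (fun p : ℝ × E d => p.2 + (p.1 * τ) • v) '' (Icc 0 1 ×ˢ Metric.closedBall x₀ r) with hK
  have hKc : IsCompact K := (isCompact_Icc.prod (isCompact_closedBall x₀ r)).image (by fun_prop)
  have hKs : ∀ s ∈ Icc (0 : ℝ) 1, Metric.closedBall (x₀ + (s * τ) • v) r ⊆ K := by
    intro s hs x hx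
    refine ⟨(s, x - (s * τ) • v), ⟨hs, ?_⟩, by simp⟩
    rw [mem_closedBall_iff_norm] at hx ⊢
    rwa [sub_sub, add_comm]
  have hKO : K ⊆ O := by
    rintro _ ⟨⟨s, y⟩, ⟨hs, hy⟩, rfl⟩
    refine hB s hs ?_
    simp only [mem_closedBall_iff_norm] at hy ⊢
    simpa using hy
  set F := K.indicator f with hF
  have hFi : Integrable F volume :=
    (integrable_indicator_iff hKc.measurableSet).2 (hf.integrableOn_compact_subset hKO hKc)
  have hFs : Integrable (fun x => F (x + τ • v)) volume := hFi.comp_add_right _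
  have key : ∀ᵐ x ∂(volume : Measure (E d)), x ∈ Metric.ball x₀ r → F (x + τ • v) - F x = 0 := by
    refine Metric.isOpen_ball.ae_eq_zero_of_integral_contDiff_smul_eq_zero
      ((hFs.sub hFi).locallyIntegrable.locallyIntegrableOn _) fun Φ hΦ hΦc hΦs => ?_
    have hΦ1 : Differentiable ℝ Φ := hΦ.differentiable (by simp)
    obtain ⟨C, hC⟩ := hΦc.exists_bound_of_continuous hΦ.continuous
    have hcf : Continuous (fderiv ℝ Φ) := hΦ.continuous_fderiv (by simp)
    obtain ⟨C', hC'⟩ := (hΦc.fderiv ℝ).exists_bound_of_continuous hcf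
    -- The test function is moved instead of `f`. The derivative in `s` is a weak derivative of `f`
    -- in the direction `v` against the translated test function, hence zero.
    set J : ℝ → ℝ := fun s => ∫ x, F x * Φ (x - (s * τ) • v) with hJ
    have hJd : ∀ s, HasDerivAt J
        (∫ x, F x * -(fderiv ℝ Φ (x - (s * τ) • v) (τ • v))) s := by
      intro s
      refine (hasDerivAt_integral_of_dominated_loc_of_deriv_le (𝕜 := ℝ)
        (F := fun s x => F x * Φ (x - (s * τ) • v)) (s := univ)
        (F' := fun s x => F x * -(fderiv ℝ Φ (x - (s * τ) • v) (τ • v)))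
        (bound := fun x => ‖F x‖ * (C' * ‖τ • v‖)) univ_mem
        (Eventually.of_forall fun s => ?_) ?_ ?_ ?_ ?_ ?_).2
      · exact hFi.1.mul (hΦ.continuous.comp (by fun_prop)).aestronglyMeasurable
      · exact hFi.mul_bdd (c := C) (hΦ.continuous.comp (by fun_prop)).aestronglyMeasurable
          (Eventually.of_forall fun x => hC _)
      · refine hFi.1.mul (Continuous.aestronglyMeasurable ?_)
        exact ((hcf.comp (by fun_prop)).clm_apply continuous_const).neg
      · refine Eventually.of_forall fun x s _ => ?_
        rw [norm_mul, norm_neg]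
        gcongr
        exact (ContinuousLinearMap.le_opNorm _ _).trans (by gcongr; exact hC' _)
      · exact hFi.norm.mul_const _
      · refine Eventually.of_forall fun x s _ => HasDerivAt.const_mul _ ?_
        have h1 : HasDerivAt (fun s : ℝ => x - (s * τ) • v) (-(τ • v)) s := by
          have := ((hasDerivAt_id s).mul_const τ).smul_const v
          simpa using this.const_sub x
        have h2 := (hΦ1 (x - (s * τ) • v)).hasFDerivAt.comp_hasDerivAt s h1
        rwa [map_neg] at h2
    have hJ0 : ∀ s ∈ Icc (0 : ℝ) 1, HasDerivAt J 0 s := by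
      intro s hs
      convert hJd s using 1
      set φ : E d → ℝ := fun x => Φ (x - (s * τ) • v) with hφ
      have hφs : tsupport φ ⊆ Metric.closedBall (x₀ + (s * τ) • v) r := by
        refine closure_minimal (fun x hx => ?_) Metric.isClosed_closedBall
        have := hΦs (subset_tsupport Φ hx)
        rw [mem_ball_iff_norm] at this
        rw [mem_closedBall_iff_norm, add_comm, ← sub_sub]
        exact this.le
      have hφd : ∀ x, fderiv ℝ φ x = fderiv ℝ Φ (x - (s * τ) • v) := fun x => by
        rw [hφ]; exact fderiv_comp_sub _
      have h0 := hw φ (hΦ.comp (by fun_prop))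
        (HasCompactSupport.of_support_subset_isCompact (isCompact_closedBall _ r)
          ((subset_tsupport _).trans hφs)) (hφs.trans (hB s hs))
      have h1 : ∀ x, F x * -(fderiv ℝ Φ (x - (s * τ) • v) (τ • v)) =
          (-τ) * (f x * fderiv ℝ φ x v) := by
        intro x
        rw [← hφd, map_smul, smul_eq_mul]
        by_cases hx : x ∈ K
        · rw [hF, indicator_of_mem hx]; ring
        · have : fderiv ℝ φ x = 0 := by
            refine image_eq_zero_of_notMem_tsupport fun h => hx ?_
            exact hKs s hs (hφs (tsupport_fderiv_subset ℝ h))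
          rw [this]; simp
      simp_rw [h1]
      rw [integral_const_mul, h0, mul_zero]
    have hJ1 : J 1 = J 0 := by
      refine constant_of_has_deriv_right_zero (a := 0) (b := 1)
        (fun s hs => (hJ0 s hs).continuousAt.continuousWithinAt)
        (fun s hs => (hJ0 s ⟨hs.1, hs.2.le⟩).hasDerivWithinAt) 1 ⟨zero_le_one, le_rfl⟩
    have e0 : J 0 = ∫ x, Φ x * F x := by
      simp only [hJ]; congr 1; ext x; rw [zero_mul, zero_smul, sub_zero, mul_comm]
    have e1 : J 1 = ∫ x, Φ x * F (x + τ • v) := by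
      rw [← integral_sub_right_eq_self (fun x => Φ x * F (x + τ • v)) (τ • v)]
      simp only [hJ]; congr 1; ext x; rw [one_mul, sub_add_cancel, mul_comm]
    simp only [smul_eq_mul, mul_sub]
    rw [integral_sub, ← e0, ← e1, hJ1, sub_self]
    · exact hFs.bdd_mul hΦ.continuous.aestronglyMeasurable (Eventually.of_forall fun x => hC _)
    · exact hFi.bdd_mul hΦ.continuous.aestronglyMeasurable (Eventually.of_forall fun x => hC _)
  filter_upwards [key] with x hx hxB
  have h1 : x ∈ K := by
    refine hKs 0 ⟨le_rfl, zero_le_one⟩ ?_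
    simpa using Metric.ball_subset_closedBall hxB
  have h2 : x + τ • v ∈ K := by
    refine hKs 1 ⟨zero_le_one, le_rfl⟩ ?_
    rw [mem_closedBall_iff_norm]
    rw [mem_ball_iff_norm] at hxB
    simpa using hxB.le
  have := hx hxB
  rwa [hF, indicator_of_mem h1, indicator_of_mem h2] at this

/-- The integral of the modulus over balls of a function whose weak derivative in the direction `v`
vanishes is invariant under translations in this direction. -/
lemma lintegral_ball_add_eq {d : ℕ} {O : Set (E d)} {f : E d → ℝ} {v : E d}
    (hf : LocallyIntegrableOn f O volume)
    (hw : ∀ φ : E d → ℝ, ContDiff ℝ (⊤ : ℕ∞) φ → HasCompactSupport φ → tsupport φ ⊆ O →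
      ∫ x, f x * fderiv ℝ φ x v = 0) {x₀ : E d} {r τ : ℝ}
    (hB : ∀ s ∈ Icc (0 : ℝ) 1, Metric.closedBall (x₀ + (s * τ) • v) r ⊆ O) :
    ∫⁻ x in Metric.ball x₀ r, ‖f x‖ₑ = ∫⁻ x in Metric.ball (x₀ + τ • v) r, ‖f x‖ₑ := by
  have h := ae_eq_add_of_integral_fderiv_eq_zero hf hw hB
  have h1 : ∫⁻ x in Metric.ball x₀ r, ‖f x‖ₑ = ∫⁻ x in Metric.ball x₀ r, ‖f (x + τ • v)‖ₑ := by
    refine setLIntegral_congr_fun_ae Metric.isOpen_ball.measurableSet ?_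
    filter_upwards [h] with x hx hxB
    rw [sub_eq_zero.1 (hx hxB)]
  rw [h1]
  have hp := (measurePreserving_add_right (volume : Measure (E d)) (τ • v)).setLIntegral_comp_emb
    (MeasurableEquiv.addRight (τ • v)).measurableEmbedding (fun x => ‖f x‖ₑ)
    (Metric.ball x₀ r)
  have himg : (fun x => x + τ • v) '' Metric.ball x₀ r = Metric.ball (x₀ + τ • v) r := by
    ext y
    simp only [mem_image, mem_ball_iff_norm]
    constructor
    · rintro ⟨x, hx, rfl⟩; simpa using hx
    · intro hy; exact ⟨y - τ • v, by rwa [sub_sub, add_comm], by simp⟩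
  rw [himg] at hp
  exact hp

/-! ### Traces -/

lemma volume_ball_ratio {d : ℕ} (hd : 1 ≤ d) (x y : E d) {r s : ℝ} (hr : 0 < r) (hs : 0 < s) :
    volume (Metric.ball x r) = ENNReal.ofReal ((r / s) ^ d) * volume (Metric.ball y s) := by
  have : Nonempty (Fin d) := ⟨⟨0, hd⟩⟩
  rw [Measure.addHaar_ball _ x hr.le, Measure.addHaar_ball _ y hs.le, ← mul_assoc,
    ← ENNReal.ofReal_mul (by positivity)]
  congr 2
  simp only [finrank_euclideanSpace, Fintype.card_fin]
  rw [← mul_pow, div_mul_cancel₀ _ hs.ne']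

lemma setLAverage_le_of_subset {X : Type*} [MeasurableSpace X] {μ : Measure X} {s t : Set X}
    {f : X → ℝ≥0∞} {C : ℝ≥0∞} (hst : s ⊆ t) (ht : μ t ≤ C * μ s) (hs0 : μ s ≠ 0) (hs : μ t ≠ ∞) :
    ⨍⁻ x in s, f x ∂μ ≤ C * ⨍⁻ x in t, f x ∂μ := by
  have ht0 : μ t ≠ 0 := fun h => hs0 (measure_mono_null hst h)
  have hs' : μ s ≠ ∞ := ((measure_mono hst).trans_lt hs.lt_top).ne
  rw [setLAverage_eq, setLAverage_eq, ENNReal.div_eq_inv_mul, ENNReal.div_eq_inv_mul, ← mul_assoc]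
  refine mul_le_mul' ?_ (lintegral_mono_set hst)
  rw [ENNReal.inv_le_iff_inv_le, ENNReal.mul_inv (Or.inr (by simpa using ht0))
    (Or.inr (by simpa using hs)), inv_inv, ← ENNReal.div_eq_inv_mul]
  exact ENNReal.div_le_of_le_mul' ht

/-- The means over balls in an interior cone tend to the trace. -/
lemma HasTrace.tendsto_ball {d : ℕ} (hd : 1 ≤ d) {Ω : Set (E d)} {u : E d → ℝ} {x ζ : E d}
    {a c : ℝ} (h : HasTrace Ω u x a) (hc : 0 < c)
    (hcone : ∀ᶠ r : ℝ in 𝓝[>] 0, Metric.ball (x + r • ζ) (c * r) ⊆ Ω) :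
    Tendsto (fun r : ℝ => ⨍⁻ y in Metric.ball (x + r • ζ) (c * r), ‖u y - a‖ₑ ∂volume)
      (𝓝[>] 0) (𝓝 0) := by
  set κ := ‖ζ‖ + c with hκ
  have hκ0 : 0 < κ := by positivity
  have hlim : Tendsto (fun r : ℝ => κ * r) (𝓝[>] 0) (𝓝[>] 0) := by
    refine tendsto_nhdsWithin_iff.2 ⟨?_, ?_⟩
    · have : Tendsto (fun r : ℝ => κ * r) (𝓝 0) (𝓝 (κ * 0)) := tendsto_id.const_mul κ
      rw [mul_zero] at this
      exact this.mono_left nhdsWithin_le_nhds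
    · filter_upwards [self_mem_nhdsWithin] with r (hr : 0 < r)
      exact mul_pos hκ0 hr
  have h1 := h.comp hlim
  have h2 := ENNReal.Tendsto.const_mul (a := ENNReal.ofReal ((κ / c) ^ d)) h1
    (Or.inr ENNReal.ofReal_ne_top)
  rw [mul_zero] at h2
  refine tendsto_of_tendsto_of_tendsto_of_le_of_le' tendsto_const_nhds h2
    (Eventually.of_forall fun _ => zero_le) ?_
  filter_upwards [hcone, self_mem_nhdsWithin] with r h3 (hr : 0 < r)
  have hcr : 0 < c * r := by positivity
  refine setLAverage_le_of_subset (subset_inter ?_ h3) ?_ (Metric.measure_ball_pos _ _ hcr).ne'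
    ((measure_mono inter_subset_left).trans_lt measure_ball_lt_top).ne
  · refine Metric.ball_subset_ball' ?_
    rw [dist_eq_norm, add_sub_cancel_left, norm_smul, Real.norm_of_nonneg hr.le, hκ]
    apply le_of_eq; ring
  · refine (measure_mono inter_subset_left).trans (le_of_eq ?_)
    rw [volume_ball_ratio hd x (x + r • ζ) (r := κ * r) (s := c * r) (by positivity) hcr]
    rw [mul_div_mul_right _ _ hr.ne']

/-- A criterion for traces at points with an interior cone. -/
lemma hasTrace_of_cone {d : ℕ} (hd : 1 ≤ d) {Ω : Set (E d)} {u : E d → ℝ} {x ζ : E d}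
    {a c : ℝ} (hc : 0 < c)
    (hcone : ∀ᶠ r : ℝ in 𝓝[>] 0, Metric.ball (x + r • ζ) (c * r) ⊆ Ω)
    (h : Tendsto (fun r : ℝ => ⨍⁻ y in Metric.ball x r, ‖u y - a‖ₑ ∂volume) (𝓝[>] 0) (𝓝 0)) :
    HasTrace Ω u x a := by
  set κ := ‖ζ‖ + c with hκ
  have hκ0 : 0 < κ := by positivity
  have hlim : Tendsto (fun r : ℝ => κ⁻¹ * r) (𝓝[>] 0) (𝓝[>] 0) := by
    refine tendsto_nhdsWithin_iff.2 ⟨?_, ?_⟩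
    · have : Tendsto (fun r : ℝ => κ⁻¹ * r) (𝓝 0) (𝓝 (κ⁻¹ * 0)) := tendsto_id.const_mul κ⁻¹
      rw [mul_zero] at this
      exact this.mono_left nhdsWithin_le_nhds
    · filter_upwards [self_mem_nhdsWithin] with r (hr : 0 < r)
      exact mul_pos (inv_pos.2 hκ0) hr
  have h2 := ENNReal.Tendsto.const_mul (a := ENNReal.ofReal ((κ / c) ^ d)) h
    (Or.inr ENNReal.ofReal_ne_top)
  rw [mul_zero] at h2
  refine tendsto_of_tendsto_of_tendsto_of_le_of_le' tendsto_const_nhds h2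
    (Eventually.of_forall fun _ => zero_le) ?_
  filter_upwards [hlim.eventually hcone, self_mem_nhdsWithin] with r h3 (hr : 0 < r)
  have hcr : 0 < c * (κ⁻¹ * r) := by positivity
  -- The cone ball, scaled to fit into `B(x, r)`, bounds the volume of `B(x, r) ∩ Ω` from below by a
  -- fixed fraction of that of `B(x, r)`.
  have hsub : Metric.ball (x + (κ⁻¹ * r) • ζ) (c * (κ⁻¹ * r)) ⊆ Metric.ball x r ∩ Ω := by
    refine subset_inter (Metric.ball_subset_ball' ?_) h3
    rw [dist_eq_norm, add_sub_cancel_left, norm_smul, Real.norm_of_nonneg (by positivity)]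
    apply le_of_eq
    have : c * (κ⁻¹ * r) + κ⁻¹ * r * ‖ζ‖ = κ⁻¹ * κ * r := by rw [hκ]; ring
    rw [this, inv_mul_cancel₀ hκ0.ne', one_mul]
  have hpos := (Metric.measure_ball_pos volume (x + (κ⁻¹ * r) • ζ) hcr)
  refine setLAverage_le_of_subset inter_subset_left ?_
    (hpos.trans_le (measure_mono hsub)).ne' measure_ball_lt_top.ne
  rw [volume_ball_ratio hd x (x + (κ⁻¹ * r) • ζ) hr hcr]
  have : r / (c * (κ⁻¹ * r)) = κ / c := by field_simp
  rw [this]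
  gcongr

/-- Traces of functions that agree near the boundary point agree. -/
lemma HasTrace.unique {d : ℕ} (hd : 1 ≤ d) {Ω U : Set (E d)} (hU : IsOpen U) {u v : E d → ℝ}
    {x ζ : E d} {a b c : ℝ} (hx : x ∈ U) (hu : HasTrace Ω u x a) (hv : HasTrace Ω v x b)
    (hum : LocallyIntegrableOn u (Ω ∩ U) volume)
    (huv : ∀ᵐ y ∂(volume : Measure (E d)), y ∈ Ω ∩ U → u y = v y) (hc : 0 < c)
    (hcone : ∀ᶠ r : ℝ in 𝓝[>] 0, Metric.ball (x + r • ζ) (c * r) ⊆ Ω) : a = b := by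
  have h1 := (hu.tendsto_ball hd hc hcone).add (hv.tendsto_ball hd hc hcone)
  rw [add_zero] at h1
  have hev : ∀ᶠ r : ℝ in 𝓝[>] 0, Metric.ball (x + r • ζ) (c * r) ⊆ U := by
    obtain ⟨δ, hδ, hB⟩ := Metric.isOpen_iff.1 hU x hx
    have h2 : ∀ᶠ r : ℝ in 𝓝[>] 0, r < δ / (‖ζ‖ + c) :=
      (eventually_lt_nhds (by positivity)).filter_mono nhdsWithin_le_nhds
    filter_upwards [h2, self_mem_nhdsWithin] with r h3 (hr : 0 < r)
    refine (Metric.ball_subset_ball' ?_).trans hB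
    rw [lt_div_iff₀ (by positivity)] at h3
    rw [dist_eq_norm, add_sub_cancel_left, norm_smul, Real.norm_of_nonneg hr.le]
    linarith
  -- On the cone balls `u` and `v` coincide almost everywhere, so the triangle inequality can be
  -- averaged.
  have h3 : ∀ᶠ r : ℝ in 𝓝[>] 0, ‖a - b‖ₑ ≤
      (⨍⁻ y in Metric.ball (x + r • ζ) (c * r), ‖u y - a‖ₑ ∂volume) +
      ⨍⁻ y in Metric.ball (x + r • ζ) (c * r), ‖v y - b‖ₑ ∂volume := by
    filter_upwards [hev, hcone, self_mem_nhdsWithin] with r h4 h5 (hr : 0 < r)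
    set B := Metric.ball (x + r • ζ) (c * r) with hB
    have hB0 : volume B ≠ 0 := (Metric.measure_ball_pos _ _ (by positivity)).ne'
    have hBt : volume B ≠ ∞ := measure_ball_lt_top.ne
    have hm : AEStronglyMeasurable u (volume.restrict B) :=
      hum.aestronglyMeasurable.mono_set (subset_inter h5 h4)
    have e1 : ∫⁻ y in B, ‖v y - b‖ₑ = ∫⁻ y in B, ‖u y - b‖ₑ := by
      refine setLIntegral_congr_fun_ae Metric.isOpen_ball.measurableSet ?_
      filter_upwards [huv] with y hy hyB
      rw [hy ⟨h5 hyB, h4 hyB⟩]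
    have hm' : AEMeasurable (fun y => ‖u y - a‖ₑ) (volume.restrict B) :=
      (AEStronglyMeasurable.sub hm aestronglyMeasurable_const).enorm
    rw [setLAverage_eq, setLAverage_eq, e1, ← ENNReal.add_div, ENNReal.le_div_iff_mul_le
      (Or.inl hB0) (Or.inl hBt), ← lintegral_add_left' hm',
      ← setLIntegral_const]
    refine lintegral_mono fun y => ?_
    have : a - b = -(u y - a) + (u y - b) := by ring
    rw [this, ← enorm_neg (u y - a)]
    exact enorm_add_le _ _
  have h4 := ge_of_tendsto h1 h3
  rw [nonpos_iff_eq_zero, enorm_eq_zero, sub_eq_zero] at h4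
  exact h4

/-! ### Measures in the coordinates of a tube -/

/-- The normalizing factor relative to the Hausdorff measure depends on the dimension `n` alone, so
it cancels in the Lipschitz estimate between two different spaces. -/
lemma euclideanHausdorffMeasure_image_le {X Y : Type*} [EMetricSpace X] [MeasurableSpace X]
    [BorelSpace X] [EMetricSpace Y] [MeasurableSpace Y] [BorelSpace Y] {K : ℝ≥0} {f : X → Y}
    {s : Set X} (h : LipschitzOnWith K f s) (n : ℕ) :
    (μHE[n] : Measure Y) (f '' s) ≤ (K : ℝ≥0∞) ^ n * (μHE[n] : Measure X) s := by
  rw [Measure.euclideanHausdorffMeasure_def, Measure.euclideanHausdorffMeasure_def,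
    Measure.smul_apply, Measure.smul_apply, ENNReal.smul_def, ENNReal.smul_def, smul_eq_mul,
    smul_eq_mul]
  have := h.hausdorffMeasure_image_le (d := n) (Nat.cast_nonneg n)
  rw [ENNReal.rpow_natCast] at this
  calc _ ≤ _ * ((K : ℝ≥0∞) ^ n * μH[n] s) := by gcongr
    _ = _ := by ring

namespace ChordFrame

variable {d : ℕ} (F : ChordFrame d)

/-- The linear part of the coordinates of a tube. -/
def lin (a : E (d - 1)) : (ℝ × E (d - 1)) ≃L[ℝ] E d :=
  ContinuousLinearEquiv.equivOfInverse
    ((ContinuousLinearMap.fst ℝ ℝ (E (d - 1))).smulRight (F.vel a) +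
      F.emb.toContinuousLinearMap.comp (ContinuousLinearMap.snd ℝ ℝ (E (d - 1))))
    ((innerSL ℝ F.dir).prod (F.proj - (innerSL ℝ F.dir).smulRight a))
    (fun p => by
      have h1 := F.time_pt a p.2 p.1
      have h2 := F.cross_pt a p.2 p.1
      have h3 : F.pt a p.2 p.1 - F.base = p.1 • F.vel a + F.emb p.2 := by
        simp only [pt]; abel
      simp only [cross, time] at h1 h2
      rw [h3] at h1 h2
      rw [h1] at h2
      ext1
      · simpa using h1
      · have h1' : inner ℝ F.dir (p.1 • F.vel a + F.emb p.2) = p.1 := h1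
        simp only [ContinuousLinearMap.prod_apply, sub_apply,
          add_apply, ContinuousLinearMap.smulRight_apply,
          ContinuousLinearMap.coe_fst', ContinuousLinearMap.comp_apply,
          ContinuousLinearMap.coe_snd', innerSL_apply_apply,
          LinearIsometry.coe_toContinuousLinearMap]
        rw [h1']; exact h2)
    (fun x => by
      have h := F.pt_cross_time a (F.base + x)
      simp only [pt, cross, time, add_sub_cancel_left] at h
      have h' := congrArg (fun z => z - F.base) h
      simp only [add_sub_cancel_left] at h'
      conv_rhs => rw [← h']
      simp; abel)

lemma lin_apply (a : E (d - 1)) (p : ℝ × E (d - 1)) :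
    F.lin a p = p.1 • F.vel a + F.emb p.2 := rfl

lemma pt_eq_lin (a w : E (d - 1)) (t : ℝ) : F.pt a w t = F.base + F.lin a (t, w) := by
  rw [lin_apply, pt]; simp only; abel

lemma measurableEmbedding_pt (a : E (d - 1)) :
    MeasurableEmbedding fun p : ℝ × E (d - 1) => F.pt a p.2 p.1 := by
  simp only [pt_eq_lin]
  exact ((Homeomorph.addLeft F.base).measurableEmbedding).comp
    (F.lin a).toHomeomorph.measurableEmbedding

/-- The coordinates are affine, so this is uniqueness of Haar measure. The value of the constant
never matters: only null sets and bounds up to constants are used. -/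
lemma exists_volume_eq (a : E (d - 1)) : ∃ c : ℝ≥0, (volume : Measure (E d)) =
    c • Measure.map (fun p : ℝ × E (d - 1) => F.pt a p.2 p.1) volume := by
  have h0 : (volume : Measure (ℝ × E (d - 1))).IsAddHaarMeasure :=
    inferInstanceAs ((volume : Measure ℝ).prod (volume : Measure (E (d - 1)))).IsAddHaarMeasure
  have h : (Measure.map (F.lin a) volume).IsAddHaarMeasure :=
    (F.lin a).isAddHaarMeasure_map volume
  refine ⟨(volume : Measure (E d)).addHaarScalarFactor (Measure.map (F.lin a) volume), ?_⟩
  have h1 : (fun p : ℝ × E (d - 1) => F.pt a p.2 p.1) = (fun x => F.base + x) ∘ F.lin a := by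
    ext1 p; exact F.pt_eq_lin a p.2 p.1
  rw [h1, ← Measure.map_map (measurable_const_add _) (F.lin a).continuous.measurable,
    ← Measure.map_smul, ← Measure.isAddLeftInvariant_eq_smul]
  exact ((measurePreserving_add_left volume F.base).map_eq).symm

lemma volume_cross_preimage {N : Set (E (d - 1))} (hN : volume N = 0) (a : E (d - 1)) :
    volume (F.cross a ⁻¹' N) = 0 := by
  obtain ⟨c, hc⟩ := F.exists_volume_eq a
  rw [hc, Measure.smul_apply, (F.measurableEmbedding_pt a).map_apply]
  have : (fun p : ℝ × E (d - 1) => F.pt a p.2 p.1) ⁻¹' (F.cross a ⁻¹' N) = univ ×ˢ N := by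
    ext p; simp [F.cross_pt]
  rw [this, Measure.volume_eq_prod, Measure.prod_prod, hN, mul_zero, smul_zero]

lemma quasiMeasurePreserving_cross (a : E (d - 1)) :
    Measure.QuasiMeasurePreserving (F.cross a) volume volume := by
  refine ⟨(F.continuous_cross a).measurable, ?_⟩
  refine Measure.AbsolutelyContinuous.mk fun s hs h0 => ?_
  rw [Measure.map_apply (F.continuous_cross a).measurable hs]
  exact F.volume_cross_preimage h0 a

/-- Integrals over balls of functions that are constant along the lines. -/
lemma exists_lintegral_cross_le {a : E (d - 1)} (ha : ‖a‖ ≤ 1) : ∃ C : ℝ≥0,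
    ∀ f : E (d - 1) → ℝ≥0∞, AEMeasurable f volume → ∀ (x : E d) (r : ℝ), 0 ≤ r →
      ∫⁻ y in Metric.ball x r, f (F.cross a y) ≤
        C * ENNReal.ofReal r * ∫⁻ w in Metric.closedBall (F.cross a x) (2 * r), f w := by
  obtain ⟨c, hc⟩ := F.exists_volume_eq a
  refine ⟨c * 2, fun f hf x r hr => ?_⟩
  rw [hc, Measure.restrict_smul, lintegral_smul_measure,
    (F.measurableEmbedding_pt a).restrict_map, (F.measurableEmbedding_pt a).lintegral_map]
  simp only [F.cross_pt]
  -- In tube coordinates a ball lies in a box: time is `1`-Lipschitz, and the cross-section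
  -- coordinate has Lipschitz constant `1 + ‖a‖ ≤ 2`.
  have hsub : (fun p : ℝ × E (d - 1) => F.pt a p.2 p.1) ⁻¹' Metric.ball x r ⊆
      Icc (F.time x - r) (F.time x + r) ×ˢ Metric.closedBall (F.cross a x) (2 * r) := by
    intro p hp
    rw [mem_preimage, mem_ball_iff_norm] at hp
    have h1 := F.abs_time_sub_le (F.pt a p.2 p.1) x
    have h2 := F.norm_cross_sub_le a (F.pt a p.2 p.1) x
    rw [F.time_pt] at h1
    rw [F.cross_pt] at h2
    have h3 := abs_le.1 (h1.trans hp.le)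
    refine ⟨⟨by linarith, by linarith⟩, ?_⟩
    rw [mem_closedBall_iff_norm]
    refine h2.trans ?_
    have := norm_nonneg (F.pt a p.2 p.1 - x)
    nlinarith
  calc c • ∫⁻ p in (fun p : ℝ × E (d - 1) => F.pt a p.2 p.1) ⁻¹' Metric.ball x r, f p.2
      ≤ c • ∫⁻ p in Icc (F.time x - r) (F.time x + r) ×ˢ Metric.closedBall (F.cross a x) (2 * r),
          f p.2 := by
        gcongr
    _ = c • (ENNReal.ofReal (2 * r) *
          ∫⁻ w in Metric.closedBall (F.cross a x) (2 * r), f w) := by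
        congr 1
        rw [Measure.volume_eq_prod, ← Measure.prod_restrict]
        have := lintegral_prod_mul (μ := volume.restrict (Icc (F.time x - r) (F.time x + r)))
          (ν := volume.restrict (Metric.closedBall (F.cross a x) (2 * r)))
          (f := fun _ => 1) (g := f) aemeasurable_const hf.restrict
        simp only [one_mul] at this
        rw [this, lintegral_const, Measure.restrict_apply_univ, Real.volume_Icc, one_mul]
        congr 2; ring
    _ = _ := by
        rw [ENNReal.smul_def, smul_eq_mul, ENNReal.ofReal_mul (by norm_num)]
        push_cast
        rw [ENNReal.ofReal_ofNat]
        ring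

lemma locallyIntegrable_comp_cross {a : E (d - 1)} (ha : ‖a‖ ≤ 1) {G : E (d - 1) → ℝ}
    (hG : Integrable G volume) : LocallyIntegrable (fun x => G (F.cross a x)) volume := by
  obtain ⟨C, hC⟩ := F.exists_lintegral_cross_le ha
  intro x
  refine ⟨Metric.ball x 1, Metric.ball_mem_nhds x one_pos, ?_, ?_⟩
  · exact (hG.1.comp_quasiMeasurePreserving (F.quasiMeasurePreserving_cross a)).restrict
  · refine (hC (fun w => ‖G w‖ₑ) hG.1.enorm x 1 zero_le_one).trans_lt ?_
    refine ENNReal.mul_lt_top (ENNReal.mul_lt_top ENNReal.coe_lt_top ENNReal.ofReal_lt_top) ?_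
    exact (setLIntegral_le_lintegral _ _).trans_lt hG.2

/-- At a Lebesgue point of `G` the means of `G ∘ cross a` converge. -/
lemma tendsto_laverage_cross (hd : 1 ≤ d) {a : E (d - 1)} (ha : ‖a‖ ≤ 1) {G : E (d - 1) → ℝ}
    (hG : Integrable G volume) (x : E d)
    (h : Tendsto (fun r : ℝ => (∫⁻ w in Metric.closedBall (F.cross a x) r,
      ‖G w - G (F.cross a x)‖ₑ) / volume (Metric.closedBall (F.cross a x) r)) (𝓝[>] 0) (𝓝 0)) :
    Tendsto (fun r : ℝ => ⨍⁻ y in Metric.ball x r, ‖G (F.cross a y) - G (F.cross a x)‖ₑ ∂volume)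
      (𝓝[>] 0) (𝓝 0) := by
  have : Nonempty (Fin d) := ⟨⟨0, hd⟩⟩
  obtain ⟨C, hC⟩ := F.exists_lintegral_cross_le ha
  have hlim : Tendsto (fun r : ℝ => 2 * r) (𝓝[>] 0) (𝓝[>] 0) := by
    refine tendsto_nhdsWithin_iff.2 ⟨?_, ?_⟩
    · have : Tendsto (fun r : ℝ => 2 * r) (𝓝 0) (𝓝 (2 * 0)) := tendsto_id.const_mul 2
      rw [mul_zero] at this
      exact this.mono_left nhdsWithin_le_nhds
    · filter_upwards [self_mem_nhdsWithin] with r (hr : 0 < r)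
      exact mul_pos two_pos hr
  set V := volume (Metric.ball (0 : E d) 1) with hV
  set V' := volume (Metric.ball (0 : E (d - 1)) 1) with hV'
  have hV0 : V ≠ 0 := (Metric.measure_ball_pos _ _ one_pos).ne'
  have hVt : V ≠ ∞ := measure_ball_lt_top.ne
  have hVt' : V' ≠ ∞ := measure_ball_lt_top.ne
  -- The ratio of `C * r` times the volume of a cross-section ball of radius `2 * r` to the volume
  -- of a ball of radius `r`; it does not depend on `r`.
  set K : ℝ≥0∞ := C * ENNReal.ofReal (2 ^ (d - 1)) * V' / V with hK
  have hKt : K ≠ ∞ := by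
    rw [hK]
    exact ENNReal.div_ne_top (ENNReal.mul_ne_top (ENNReal.mul_ne_top ENNReal.coe_ne_top
      ENNReal.ofReal_ne_top) hVt') hV0
  have h2 := ENNReal.Tendsto.const_mul (a := K) (h.comp hlim) (Or.inr hKt)
  rw [mul_zero] at h2
  refine tendsto_of_tendsto_of_tendsto_of_le_of_le' tendsto_const_nhds h2
    (Eventually.of_forall fun _ => zero_le) ?_
  filter_upwards [self_mem_nhdsWithin] with r (hr : 0 < r)
  have h3 := hC (fun w => ‖G w - G (F.cross a x)‖ₑ)
    (hG.1.sub aestronglyMeasurable_const).enorm x r hr.le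
  rw [setLAverage_eq]
  refine ENNReal.div_le_of_le_mul (h3.trans (le_of_eq ?_))
  set I := ∫⁻ w in Metric.closedBall (F.cross a x) (2 * r), ‖G w - G (F.cross a x)‖ₑ with hI
  have hcb : volume (Metric.closedBall (F.cross a x) (2 * r)) =
      ENNReal.ofReal ((2 * r) ^ (d - 1)) * V' := by
    rw [Measure.addHaar_closedBall _ _ (by positivity)]; simp [hV']
  have hb : volume (Metric.ball x r) = ENNReal.ofReal (r ^ d) * V := by
    rw [Measure.addHaar_ball _ _ hr.le]; simp [hV]
  have hcb0 : volume (Metric.closedBall (F.cross a x) (2 * r)) ≠ 0 :=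
    (Metric.measure_closedBall_pos _ _ (by positivity)).ne'
  have hcbt : volume (Metric.closedBall (F.cross a x) (2 * r)) ≠ ∞ := measure_closedBall_lt_top.ne
  have hid : C * ENNReal.ofReal r * volume (Metric.closedBall (F.cross a x) (2 * r)) =
      K * volume (Metric.ball x r) := by
    rw [hcb, hb, hK, mul_pow, ENNReal.ofReal_mul (by positivity)]
    have : ENNReal.ofReal (r ^ d) = ENNReal.ofReal r * ENNReal.ofReal (r ^ (d - 1)) := by
      rw [← ENNReal.ofReal_mul hr.le, ← pow_succ']; congr 2; omega
    rw [this]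
    calc _ = (C * ENNReal.ofReal (2 ^ (d - 1)) * V') * (ENNReal.ofReal r *
        ENNReal.ofReal (r ^ (d - 1))) := by ring
      _ = (C * ENNReal.ofReal (2 ^ (d - 1)) * V') / V * V * (ENNReal.ofReal r *
        ENNReal.ofReal (r ^ (d - 1))) := by rw [ENNReal.div_mul_cancel hV0 hVt]
      _ = _ := by ring
  calc C * ENNReal.ofReal r * I
      = C * ENNReal.ofReal r * (I / volume (Metric.closedBall (F.cross a x) (2 * r)) *
        volume (Metric.closedBall (F.cross a x) (2 * r))) := by
          rw [ENNReal.div_mul_cancel hcb0 hcbt]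
    _ = (C * ENNReal.ofReal r * volume (Metric.closedBall (F.cross a x) (2 * r))) *
        (I / volume (Metric.closedBall (F.cross a x) (2 * r))) := by ring
    _ = _ := by rw [hid]; simp only [Function.comp]; ring

end ChordFrame

/-! ### Uniqueness of solutions on tubes -/

/-- A rank-one map has the expected trace. For a constant field the weak equation thus says that a
directional weak derivative vanishes. -/
lemma divergence_smul_const {d : ℕ} {φ : E d → ℝ} (hφ : Differentiable ℝ φ) (v x : E d) :
    divergence (fun y => φ y • v) x = fderiv ℝ φ x v := by
  rw [divergence, fderiv_smul_const (hφ x)]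
  exact LinearMap.trace_smulRight (fderiv ℝ φ x : E d →ₗ[ℝ] ℝ) v

lemma LocallyIntegrableOn.integrable_mul_of_tsupport {d : ℕ} {O : Set (E d)} {f ψ : E d → ℝ}
    (hf : LocallyIntegrableOn f O volume) (hψ : Continuous ψ) (hc : HasCompactSupport ψ)
    (hs : tsupport ψ ⊆ O) : Integrable (fun x => f x * ψ x) volume := by
  obtain ⟨C, hC⟩ := hc.exists_bound_of_continuous hψ
  have h1 : Integrable ((tsupport ψ).indicator f) volume :=
    (integrable_indicator_iff (isClosed_tsupport ψ).measurableSet).2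
      (hf.integrableOn_compact_subset hs hc)
  refine (h1.mul_bdd (c := C) hψ.aestronglyMeasurable (Eventually.of_forall hC)).congr
    (Eventually.of_forall fun x => ?_)
  by_cases hx : x ∈ tsupport ψ
  · simp [indicator_of_mem hx]
  · simp [image_eq_zero_of_notMem_tsupport hx]

/-- This is Lebesgue's differentiation theorem for truncations of `f` to closed balls in `O`; being
a null set is a local property. -/
lemma ae_tendsto_laverage_of_locallyIntegrableOn {d : ℕ} {O : Set (E d)} (hO : IsOpen O)
    {f : E d → ℝ} (hf : LocallyIntegrableOn f O volume) :
    ∀ᵐ x ∂(volume : Measure (E d)), x ∈ O → Tendsto (fun r : ℝ =>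
      ⨍⁻ y in Metric.closedBall x r, ‖f y - f x‖ₑ ∂volume) (𝓝[>] 0) (𝓝 0) := by
  rw [ae_iff]
  refine measure_null_of_locally_null _ fun x hx => ?_
  simp only [mem_ofPred_eq, Classical.not_imp] at hx
  obtain ⟨R, hR, hB⟩ := Metric.isOpen_iff.1 hO x hx.1
  have hsub : Metric.closedBall x (R / 2) ⊆ O :=
    (Metric.closedBall_subset_ball (by linarith)).trans hB
  set F := (Metric.closedBall x (R / 2)).indicator f with hF
  have hFi : Integrable F volume :=
    (integrable_indicator_iff Metric.isClosed_closedBall.measurableSet).2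
      (hf.integrableOn_compact_subset hsub (isCompact_closedBall _ _))
  have h1 := (Besicovitch.vitaliFamily (volume : Measure (E d))).ae_tendsto_lintegral_enorm_sub_div
    hFi.locallyIntegrable
  refine ⟨Metric.ball x (R / 2) ∩ {y | ¬(y ∈ O → Tendsto (fun r : ℝ =>
      ⨍⁻ z in Metric.closedBall y r, ‖f z - f y‖ₑ ∂volume) (𝓝[>] 0) (𝓝 0))}, ?_, ?_⟩
  · exact inter_mem (nhdsWithin_le_nhds (Metric.ball_mem_nhds x (by linarith))) self_mem_nhdsWithin
  · refine measure_mono_null ?_ (ae_iff.1 h1)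
    rintro y ⟨hy, hy2⟩ h3
    refine hy2 fun _ => ?_
    have h4 := h3.comp (Besicovitch.tendsto_filterAt volume y)
    refine h4.congr' ?_
    have h5 : ∀ᶠ r : ℝ in 𝓝[>] 0, r < R / 2 - dist y x := by
      refine (eventually_lt_nhds ?_).filter_mono nhdsWithin_le_nhds
      rw [Metric.mem_ball] at hy; linarith
    filter_upwards [h5] with r hr
    have hsubset : Metric.closedBall y r ⊆ Metric.closedBall x (R / 2) :=
      Metric.closedBall_subset_closedBall' (by linarith)
    have hFy : F y = f y := indicator_of_mem (Metric.ball_subset_closedBall hy) _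
    simp only [Function.comp, setLAverage_eq]
    congr 1
    refine setLIntegral_congr_fun Metric.isClosed_closedBall.measurableSet fun z hz => ?_
    change ‖F z - F y‖ₑ = _
    rw [hFy, hF, indicator_of_mem (hsubset hz)]

lemma HasTrace.sub {d : ℕ} {Ω U : Set (E d)} (hU : IsOpen U)
    {u v : E d → ℝ} {x : E d} {a b : ℝ} (hx : x ∈ U)
    (hum : LocallyIntegrableOn u (Ω ∩ U) volume) (hu : HasTrace Ω u x a) (hv : HasTrace Ω v x b) :
    HasTrace Ω (fun y => u y - v y) x (a - b) := by
  have h1 := hu.add hv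
  rw [add_zero] at h1
  refine tendsto_of_tendsto_of_tendsto_of_le_of_le' tendsto_const_nhds h1
    (Eventually.of_forall fun _ => zero_le) ?_
  obtain ⟨δ, hδ, hB⟩ := Metric.isOpen_iff.1 hU x hx
  have h2 : ∀ᶠ r : ℝ in 𝓝[>] 0, r < δ := (eventually_lt_nhds hδ).filter_mono nhdsWithin_le_nhds
  filter_upwards [h2] with r hr
  have hm : AEStronglyMeasurable u (volume.restrict (Metric.ball x r ∩ Ω)) :=
    hum.aestronglyMeasurable.mono_set
      (subset_inter inter_subset_right
        (inter_subset_left.trans ((Metric.ball_subset_ball hr.le).trans hB)))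
  have hm' : AEMeasurable (fun y => ‖u y - a‖ₑ) (volume.restrict (Metric.ball x r ∩ Ω)) :=
    (AEStronglyMeasurable.sub hm aestronglyMeasurable_const).enorm
  rw [setLAverage_eq, setLAverage_eq, setLAverage_eq, ← ENNReal.add_div, ← lintegral_add_left' hm']
  refine ENNReal.div_le_div_right (lintegral_mono fun y => ?_) _
  have : u y - v y - (a - b) = (u y - a) - (v y - b) := by ring
  rw [this]
  exact enorm_sub_le

namespace TubeFamily

variable {d : ℕ} {Ω : Set (E d)} (T : TubeFamily Ω)

/-- The tube of lines with velocity `vel a`. -/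
def tube (a : E (d - 1)) : Set (E d) := {x | ‖T.cross a x‖ < T.ρ ∧ T.time x ∈ Ioo T.lo T.hi}

/-- The point where a line enters `Ω`. -/
def entry (a w : E (d - 1)) : E d := T.pt a w (T.α a w)

/-- The point where a line leaves `Ω`. -/
def exit (a w : E (d - 1)) : E d := T.pt a w (T.β a w)

lemma isOpen_tube (a : E (d - 1)) : IsOpen (T.tube a) :=
  (isOpen_lt (T.continuous_cross a).norm continuous_const).inter
    (isOpen_Ioo.preimage T.continuous_time)

variable {T} {a w : E (d - 1)} {x : E d}

lemma norm_le_one (ha : ‖a‖ < T.ρ) : ‖a‖ ≤ 1 := by linarith [T.ρ_le]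

lemma α_mem_Ioo (ha : ‖a‖ < T.ρ) (hw : ‖w‖ < T.ρ) : T.α a w ∈ Ioo T.lo T.hi :=
  ⟨T.lo_lt a w ha hw, by linarith [T.α_le a w ha hw, T.ℓ_pos, T.hi_pos]⟩

lemma entry_mem_tube (ha : ‖a‖ < T.ρ) (hw : ‖w‖ < T.ρ) : T.entry a w ∈ T.tube a := by
  refine ⟨?_, ?_⟩
  · rwa [entry, T.cross_pt]
  · rw [entry, T.time_pt]; exact α_mem_Ioo ha hw

lemma mem_iff_of_mem_tube (ha : ‖a‖ < T.ρ) (hx : x ∈ T.tube a) :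
    x ∈ Ω ↔ T.α a (T.cross a x) < T.time x ∧ T.time x < T.β a (T.cross a x) := by
  have := T.mem_iff a _ _ ha hx.1 hx.2
  rwa [T.pt_cross_time] at this

lemma mem_frontier_iff_of_mem_tube (ha : ‖a‖ < T.ρ) (hx : x ∈ T.tube a) :
    x ∈ frontier Ω ↔ x = T.entry a (T.cross a x) ∨ x = T.exit a (T.cross a x) := by
  have := T.frontier_iff a _ _ ha hx.1 hx.2
  rw [T.pt_cross_time] at this
  rw [this]
  have key : ∀ t, T.time x = t ↔ x = T.pt a (T.cross a x) t := fun t =>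
    ⟨fun h => by rw [← h, T.pt_cross_time], fun h => by rw [h, T.time_pt]⟩
  rw [key, key, entry, exit]

lemma exists_cone (ha : ‖a‖ < T.ρ) (hx : x ∈ T.tube a) (hf : x ∈ frontier Ω) :
    ∃ ζ : E d, ∃ c > 0, ∀ᶠ r : ℝ in 𝓝[>] 0, Metric.ball (x + r • ζ) (c * r) ⊆ Ω := by
  rcases (mem_frontier_iff_of_mem_tube ha hx).1 hf with h | h
  · have := T.α_cone a _ ha hx.1
    rw [← entry, ← h] at this
    exact ⟨_, this⟩
  · have := T.β_cone a _ ha hx.1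
    rw [← exit, ← h] at this
    exact ⟨_, this⟩

/-- On lines of the tube, `Ω` is convex. -/
lemma add_smul_mem (ha : ‖a‖ < T.ρ) {s τ : ℝ} (hs : s ∈ Icc (0 : ℝ) 1)
    (hx : x ∈ Ω ∩ T.tube a) (hy : x + τ • T.vel a ∈ Ω ∩ T.tube a) :
    x + (s * τ) • T.vel a ∈ Ω ∩ T.tube a := by
  have h1 := (mem_iff_of_mem_tube ha hx.2).1 hx.1
  have h2 := (mem_iff_of_mem_tube ha hy.2).1 hy.1
  have h3 := hx.2.2
  have h4 := hy.2.2
  rw [T.cross_add_smul, T.time_add_smul] at h2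
  rw [T.time_add_smul] at h4
  have key : ∀ l u : ℝ, l < T.time x ∧ T.time x < u → l < T.time x + τ ∧ T.time x + τ < u →
      l < T.time x + s * τ ∧ T.time x + s * τ < u := by
    intro l u h h'
    have e : T.time x + s * τ = (1 - s) * T.time x + s * (T.time x + τ) := by ring
    rw [e]
    have := convex_Ioo l u (show T.time x ∈ Ioo l u from h)
      (show T.time x + τ ∈ Ioo l u from h') (sub_nonneg.2 hs.2) hs.1 (by ring)
    simpa using this
  have hmem : x + (s * τ) • T.vel a ∈ T.tube a := by
    refine ⟨?_, ?_⟩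
    · rw [T.cross_add_smul]; exact hx.2.1
    · rw [T.time_add_smul]; exact key _ _ h3 h4
  refine ⟨(mem_iff_of_mem_tube ha hmem).2 ?_, hmem⟩
  rw [T.cross_add_smul, T.time_add_smul]
  exact key _ _ h1 h2

lemma lipschitzOnWith_pt {τ : E (d - 1) → ℝ} (ha : ‖a‖ < T.ρ)
    (hτ : ∀ w w', ‖w‖ < T.ρ → ‖w'‖ < T.ρ → |τ w - τ w'| ≤ T.M * ‖w - w'‖) :
    LipschitzOnWith (1 + 2 * T.M).toNNReal (fun w => T.pt a w (τ w)) (Metric.ball 0 T.ρ) := by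
  have hM := T.M_nonneg
  refine LipschitzOnWith.of_dist_le_mul fun w hw w' hw' => ?_
  rw [mem_ball_zero_iff] at hw hw'
  rw [dist_eq_norm, dist_eq_norm, Real.coe_toNNReal _ (by positivity)]
  refine (T.norm_pt_sub_le a w (τ w) w' (τ w')).trans ?_
  have h1 := hτ w w' hw hw'
  have h2 : |τ w - τ w'| * (1 + ‖a‖) ≤ T.M * ‖w - w'‖ * 2 := by
    gcongr
    linarith [norm_le_one ha]
  linarith

lemma lipschitzOnWith_entry (ha : ‖a‖ < T.ρ) :
    LipschitzOnWith (1 + 2 * T.M).toNNReal (T.entry a) (Metric.ball 0 T.ρ) := by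
  refine lipschitzOnWith_pt ha fun w w' hw hw' => ?_
  simpa using T.α_lip a w a w' ha hw ha hw'

lemma lipschitzOnWith_exit (ha : ‖a‖ < T.ρ) :
    LipschitzOnWith (1 + 2 * T.M).toNNReal (T.exit a) (Metric.ball 0 T.ρ) := by
  refine lipschitzOnWith_pt ha fun w w' hw hw' => ?_
  simpa using T.β_lip a w a w' ha hw ha hw'

/-- Null sets of the cross section correspond to null sets of the boundary. -/
lemma ae_surfaceMeasure_cross (ha : ‖a‖ < T.ρ) {N : Set (E (d - 1))} (hN : volume N = 0) :
    ∀ᵐ x ∂surfaceMeasure Ω, x ∈ T.tube a → T.cross a x ∉ N := by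
  rw [surfaceMeasure, ae_restrict_iff' isClosed_frontier.measurableSet]
  have hN' : (μHE[d - 1] : Measure (E (d - 1))) (Metric.ball 0 T.ρ ∩ N) = 0 := by
    rw [EuclideanSpace.euclideanHausdorffMeasure_eq_volume]
    exact measure_mono_null inter_subset_right hN
  have h1 := euclideanHausdorffMeasure_image_le
    ((lipschitzOnWith_entry ha).mono (inter_subset_left (t := N))) (d - 1)
  have h2 := euclideanHausdorffMeasure_image_le
    ((lipschitzOnWith_exit ha).mono (inter_subset_left (t := N))) (d - 1)
  rw [hN', mul_zero, nonpos_iff_eq_zero] at h1 h2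
  refine measure_mono_null (fun x hx => ?_) (measure_union_null h1 h2)
  simp only [mem_compl_iff, mem_ofPred_eq, Classical.not_imp, not_not] at hx
  obtain ⟨hf, hx, hN⟩ := hx
  have hw : T.cross a x ∈ Metric.ball 0 T.ρ ∩ N := ⟨by simpa using hx.1, hN⟩
  rcases (mem_frontier_iff_of_mem_tube ha hx).1 hf with h | h
  · exact Or.inl ⟨_, hw, h.symm⟩
  · exact Or.inr ⟨_, hw, h.symm⟩

/-- The projection along the lines is Lipschitz. A null set of bad boundary points therefore spoils
only a null set of lines, the converse direction to `ae_surfaceMeasure_cross`. -/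
lemma volume_cross_image (a : E (d - 1)) {B : Set (E d)}
    (hB : (μHE[d - 1] : Measure (E d)) B = 0) : volume (T.cross a '' B) = 0 := by
  have hL : LipschitzOnWith (1 + ‖a‖).toNNReal (T.cross a) B := by
    refine LipschitzOnWith.of_dist_le_mul fun x _ y _ => ?_
    rw [dist_eq_norm, dist_eq_norm, Real.coe_toNNReal _ (by positivity)]
    exact T.norm_cross_sub_le a x y
  have := euclideanHausdorffMeasure_image_le hL (d - 1)
  rwa [hB, mul_zero, nonpos_iff_eq_zero, EuclideanSpace.euclideanHausdorffMeasure_eq_volume] at this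

/-- A solution with zero inflow traces vanishes. -/
lemma ae_eq_zero_of_trace_zero (hd : 1 ≤ d) (hΩ : IsOpen Ω) (ha : ‖a‖ < T.ρ) {f : E d → ℝ}
    (hf : LocallyIntegrableOn f (Ω ∩ T.tube a) volume)
    (hw : ∀ φ : E d → ℝ, ContDiff ℝ (⊤ : ℕ∞) φ → HasCompactSupport φ →
      tsupport φ ⊆ Ω ∩ T.tube a → ∫ x, f x * fderiv ℝ φ x (T.vel a) = 0)
    (htr : ∀ᵐ w ∂(volume : Measure (E (d - 1))), ‖w‖ < T.ρ → HasTrace Ω f (T.entry a w) 0) :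
    ∀ᵐ x ∂(volume : Measure (E d)), x ∈ Ω ∩ T.tube a → f x = 0 := by
  have : Nonempty (Fin d) := ⟨⟨0, hd⟩⟩
  have hO : IsOpen (Ω ∩ T.tube a) := hΩ.inter (T.isOpen_tube a)
  -- Almost every point lies on a line whose entry point has a zero trace, because null sets of the
  -- cross section have null preimages.
  have h1 : ∀ᵐ x ∂(volume : Measure (E d)), ‖T.cross a x‖ < T.ρ →
      HasTrace Ω f (T.entry a (T.cross a x)) 0 :=
    (T.quasiMeasurePreserving_cross a).ae htr
  filter_upwards [h1, ae_tendsto_laverage_of_locallyIntegrableOn hO hf] with x htr hleb hx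
  replace hleb := hleb hx
  replace htr := htr hx.2.1
  obtain ⟨c, hc, hcone⟩ := T.α_cone a _ ha hx.2.1
  set P := T.entry a (T.cross a x) with hP
  rw [← entry, ← hP] at hcone
  have hPt : P ∈ T.tube a := entry_mem_tube ha hx.2.1
  have hconeT : ∀ᶠ r : ℝ in 𝓝[>] 0, Metric.ball (P + r • T.vel a) (c * r) ⊆ T.tube a := by
    obtain ⟨δ, hδ, hB⟩ := Metric.isOpen_iff.1 (T.isOpen_tube a) P hPt
    have h2 : ∀ᶠ r : ℝ in 𝓝[>] 0, r < δ / (‖T.vel a‖ + c) :=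
      (eventually_lt_nhds (by positivity)).filter_mono nhdsWithin_le_nhds
    filter_upwards [h2, self_mem_nhdsWithin] with r h3 (hr : 0 < r)
    refine (Metric.ball_subset_ball' ?_).trans hB
    rw [lt_div_iff₀ (by positivity)] at h3
    rw [dist_eq_norm, add_sub_cancel_left, norm_smul, Real.norm_of_nonneg hr.le]
    linarith
  -- Halving the opening lets closed balls fit into the open cone balls.
  set c' := c / 2 with hc'
  have hc'0 : 0 < c' := by positivity
  have hsub' : ∀ r : ℝ, 0 < r → Metric.closedBall (P + r • T.vel a) (c' * r) ⊆
      Metric.ball (P + r • T.vel a) (c * r) := fun r hr =>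
    Metric.closedBall_subset_ball (by rw [hc']; nlinarith)
  have htend := htr.tendsto_ball hd hc'0 (ζ := T.vel a) (by
    filter_upwards [hcone, self_mem_nhdsWithin] with r h2 (hr : 0 < r)
    exact (Metric.ball_subset_closedBall.trans (hsub' r hr)).trans h2)
  have hlim : Tendsto (fun r : ℝ => c' * r) (𝓝[>] 0) (𝓝[>] 0) := by
    refine tendsto_nhdsWithin_iff.2 ⟨?_, ?_⟩
    · have : Tendsto (fun r : ℝ => c' * r) (𝓝 0) (𝓝 (c' * 0)) := tendsto_id.const_mul c'
      rw [mul_zero] at this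
      exact this.mono_left nhdsWithin_le_nhds
    · filter_upwards [self_mem_nhdsWithin] with r (hr : 0 < r)
      exact mul_pos hc'0 hr
  have hsum := (hleb.comp hlim).add htend
  rw [add_zero] at hsum
  have hsmall : ∀ᶠ r : ℝ in 𝓝[>] 0, Metric.closedBall x (c' * r) ⊆ Ω ∩ T.tube a := by
    obtain ⟨δ, hδ, hB⟩ := Metric.isOpen_iff.1 hO x hx
    have h2 : ∀ᶠ r : ℝ in 𝓝[>] 0, r < δ / c' :=
      (eventually_lt_nhds (by positivity)).filter_mono nhdsWithin_le_nhds
    filter_upwards [h2] with r h3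
    rw [lt_div_iff₀ hc'0] at h3
    exact (Metric.closedBall_subset_ball (by linarith)).trans hB
  -- By translation along the flow, the mean of `|f|` near `x` equals that over a ball of the same
  -- radius in the cone at the entry point. The first summand vanishes in the limit at a Lebesgue
  -- point, the second by the trace.
  have hle : ∀ᶠ r : ℝ in 𝓝[>] 0, ‖f x‖ₑ ≤
      (⨍⁻ y in Metric.closedBall x (c' * r), ‖f y - f x‖ₑ ∂volume) +
      ⨍⁻ y in Metric.ball (P + r • T.vel a) (c' * r), ‖f y - 0‖ₑ ∂volume := by
    filter_upwards [hsmall, hcone, hconeT, self_mem_nhdsWithin] with r h2 h3 h4 (hr : 0 < r)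
    have hcr : 0 < c' * r := by positivity
    set τ := T.α a (T.cross a x) + r - T.time x with hτ
    have hPx : P + r • T.vel a = x + τ • T.vel a := by
      rw [hP, entry, T.pt_add_smul]
      conv_rhs => rw [← T.pt_cross_time a x, T.pt_add_smul]
      congr 1; rw [hτ]; ring
    -- The balls at both ends of the translation are in `Ω` and in the tube; convexity along the
    -- lines adds all intermediate balls.
    have hB : ∀ s ∈ Icc (0 : ℝ) 1,
        Metric.closedBall (x + (s * τ) • T.vel a) (c' * r) ⊆ Ω ∩ T.tube a := by
      intro s hs y hy
      rw [mem_closedBall_iff_norm] at hy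
      have e1 : y - (s * τ) • T.vel a ∈ Ω ∩ T.tube a := by
        refine h2 ?_
        rwa [mem_closedBall_iff_norm, sub_sub, add_comm]
      have e2 : y - (s * τ) • T.vel a + τ • T.vel a ∈ Ω ∩ T.tube a := by
        have : y - (s * τ) • T.vel a + τ • T.vel a ∈
            Metric.closedBall (P + r • T.vel a) (c' * r) := by
          rw [hPx, mem_closedBall_iff_norm, add_sub_add_right_eq_sub, sub_sub,
            add_comm ((s * τ) • T.vel a)]
          exact hy
        exact ⟨h3 (hsub' r hr this), h4 (hsub' r hr this)⟩
      have := add_smul_mem ha hs e1 e2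
      rwa [sub_add_cancel] at this
    have hshift := lintegral_ball_add_eq hf hw hB
    rw [← hPx] at hshift
    have hvol : volume (Metric.ball (P + r • T.vel a) (c' * r)) =
        volume (Metric.ball x (c' * r)) := by
      rw [volume_ball_ratio hd _ x hcr hcr, div_self hcr.ne']; simp
    have hvol' : volume (Metric.closedBall x (c' * r)) = volume (Metric.ball x (c' * r)) :=
      Measure.addHaar_closedBall_eq_addHaar_ball _ _ _
    have hB0 : volume (Metric.ball x (c' * r)) ≠ 0 := (Metric.measure_ball_pos _ _ hcr).ne'
    have hBt : volume (Metric.ball x (c' * r)) ≠ ∞ := measure_ball_lt_top.ne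
    simp only [sub_zero]
    rw [setLAverage_eq, setLAverage_eq, hvol, hvol', ← hshift, ← ENNReal.add_div,
      ENNReal.le_div_iff_mul_le (Or.inl hB0) (Or.inl hBt)]
    have hm : AEMeasurable (fun y => ‖f y - f x‖ₑ) (volume.restrict (Metric.ball x (c' * r))) :=
      (AEStronglyMeasurable.sub (hf.aestronglyMeasurable.mono_set
        (Metric.ball_subset_closedBall.trans h2)) aestronglyMeasurable_const).enorm
    calc ‖f x‖ₑ * volume (Metric.ball x (c' * r))
        = ∫⁻ _ in Metric.ball x (c' * r), ‖f x‖ₑ := (setLIntegral_const _ _).symm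
      _ ≤ ∫⁻ y in Metric.ball x (c' * r), (‖f y - f x‖ₑ + ‖f y‖ₑ) := by
          refine lintegral_mono fun y => ?_
          have : f x = -(f y - f x) + f y := by ring
          conv_lhs => rw [this]
          refine (enorm_add_le _ _).trans ?_
          rw [enorm_neg]
      _ = (∫⁻ y in Metric.ball x (c' * r), ‖f y - f x‖ₑ) +
          ∫⁻ y in Metric.ball x (c' * r), ‖f y‖ₑ := lintegral_add_left' hm _
      _ ≤ _ := by
          gcongr
          exact Metric.ball_subset_closedBall
  have h5 := ge_of_tendsto hsum hle
  rw [nonpos_iff_eq_zero, enorm_eq_zero] at h5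
  exact h5

/-- Solutions on a tube are unique. -/
theorem solution_unique (hd : 1 ≤ d) (hΩ : IsOpen Ω) (ha : ‖a‖ < T.ρ) {g u v : E d → ℝ}
    (hu : IsTransportSolution Ω (T.tube a) (fun _ => T.vel a) g u)
    (hv : IsTransportSolution Ω (T.tube a) (fun _ => T.vel a) g v) :
    (∀ᵐ x ∂volume, x ∈ Ω ∩ T.tube a → u x = v x) ∧
      ∀ᵐ x ∂surfaceMeasure Ω, x ∈ (inflow Ω (fun _ => T.vel a) ∪ outflow Ω fun _ => T.vel a) ∩
        T.tube a → u x = v x := by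
  have hf : LocallyIntegrableOn (fun x => u x - v x) (Ω ∩ T.tube a) volume :=
    hu.locallyIntegrableOn.sub hv.locallyIntegrableOn
  have hae : ∀ᵐ x ∂(volume : Measure (E d)), x ∈ Ω ∩ T.tube a → u x - v x = 0 := by
    refine ae_eq_zero_of_trace_zero hd hΩ ha hf (fun φ hφ hφc hφs => ?_) ?_
    · have hφ1 : Differentiable ℝ φ := hφ.differentiable (by simp)
      have e1 := hu.weak_eq φ hφ hφc hφs
      have e2 := hv.weak_eq φ hφ hφc hφs
      simp only [divergence_smul_const hφ1] at e1 e2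
      have hcont : Continuous fun x => fderiv ℝ φ x (T.vel a) :=
        (hφ.continuous_fderiv (by simp)).clm_apply continuous_const
      have hsupp : tsupport (fun x => fderiv ℝ φ x (T.vel a)) ⊆ tsupport φ :=
        tsupport_fderiv_apply_subset ℝ _
      have hcs : HasCompactSupport fun x => fderiv ℝ φ x (T.vel a) :=
        hφc.fderiv_apply ℝ _
      simp only [sub_mul]
      rw [integral_sub, e1, e2, sub_zero]
      · exact LocallyIntegrableOn.integrable_mul_of_tsupport hu.locallyIntegrableOn hcont hcs
          (hsupp.trans hφs)
      · exact LocallyIntegrableOn.integrable_mul_of_tsupport hv.locallyIntegrableOn hcont hcs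
          (hsupp.trans hφs)
    · have h1 := (hu.hasTrace.and hv.hasTrace).and (hu.inflow_eq.and hv.inflow_eq)
      rw [surfaceMeasure, ae_restrict_iff' isClosed_frontier.measurableSet] at h1
      -- The inflow conditions hold almost everywhere on the boundary; projection turns this into
      -- almost every line, so the difference has zero trace at almost every entry point.
      have h2 := T.volume_cross_image a (ae_iff.1 h1)
      refine measure_mono_null (fun w hw => ?_) h2
      simp only [mem_compl_iff, mem_ofPred_eq, Classical.not_imp] at hw
      obtain ⟨hwρ, hw⟩ := hw
      refine ⟨T.entry a w, fun hgood => hw ?_, T.cross_pt a w _⟩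
      have hin := T.α_inflow a w ha hwρ
      have htub : T.entry a w ∈ T.tube a := entry_mem_tube ha hwρ
      obtain ⟨⟨g1, g2⟩, g3, g4⟩ := hgood hin.1
      have t1 := g1 ⟨Or.inl hin, htub⟩
      have t2 := g2 ⟨Or.inl hin, htub⟩
      rw [g3 ⟨hin, htub⟩] at t1
      rw [g4 ⟨hin, htub⟩] at t2
      have := t1.sub (T.isOpen_tube a) htub hu.locallyIntegrableOn t2
      rwa [sub_self] at this
  have hae' : ∀ᵐ x ∂(volume : Measure (E d)), x ∈ Ω ∩ T.tube a → u x = v x := by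
    filter_upwards [hae] with x hx hxO using sub_eq_zero.1 (hx hxO)
  refine ⟨hae', ?_⟩
  -- Boundary values are traces, so equality inside `Ω` determines them at inflow and outflow points
  -- alike.
  filter_upwards [hu.hasTrace, hv.hasTrace] with x h1 h2 hx
  have hf : x ∈ frontier Ω := by
    rcases hx.1 with h | h
    · exact h.1
    · exact h.1
  obtain ⟨ζ, c, hc, hcone⟩ := exists_cone ha hx.2 hf
  exact (h1 hx).unique hd (T.isOpen_tube a) hx.2 (h2 hx) hu.locallyIntegrableOn hae' hc hcone

/-! ### Existence of solutions on tubes -/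

/-- The transported inflow data are a solution on the tube. -/
theorem isTransportSolution (hd : 1 ≤ d) (ha : ‖a‖ < T.ρ) {g : E d → ℝ}
    {G : E (d - 1) → ℝ} (hG : Integrable G volume)
    (hGg : ∀ w, ‖w‖ < T.ρ → G w = g (T.entry a w)) :
    IsTransportSolution Ω (T.tube a) (fun _ => T.vel a) g fun x => G (T.cross a x) := by
  have hloc : LocallyIntegrable (fun x => G (T.cross a x)) volume :=
    T.locallyIntegrable_comp_cross (norm_le_one ha) hG
  refine ⟨hloc.locallyIntegrableOn _, fun φ hφ hφc hφs => ?_, ?_, ?_⟩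
  · have hφ1 : Differentiable ℝ φ := hφ.differentiable (by simp)
    simp only [divergence_smul_const hφ1]
    have hcont : Continuous fun x => fderiv ℝ φ x (T.vel a) :=
      (hφ.continuous_fderiv (by simp)).clm_apply continuous_const
    have hcs : HasCompactSupport fun x => fderiv ℝ φ x (T.vel a) := hφc.fderiv_apply ℝ _
    have hO := hloc.locallyIntegrableOn univ
    -- The function is constant along each line, so its line derivative in the flow direction is
    -- zero everywhere even if `G` is irregular. This suffices for the integration by parts.
    have := integral_bilinear_hasLineDerivAt_right_eq_neg_left_of_integrable
      (μ := (volume : Measure (E d))) (v := T.vel a) (f := fun x => G (T.cross a x))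
      (f' := fun _ => 0) (g := φ) (g' := fun x => fderiv ℝ φ x (T.vel a))
      (B := ContinuousLinearMap.mul ℝ ℝ) (by simp)
      (LocallyIntegrableOn.integrable_mul_of_tsupport hO hcont hcs (subset_univ _))
      (LocallyIntegrableOn.integrable_mul_of_tsupport hO hφ.continuous hφc (subset_univ _))
      (fun x _ => by
        rw [HasLineDerivAt]
        simp only [T.cross_add_smul]
        exact hasDerivAt_const _ _)
      (fun x _ => (hφ1 x).hasFDerivAt.hasLineDerivAt _)
    simpa using this
  · have hleb := (Besicovitch.vitaliFamily (volume :
      Measure (E (d - 1)))).ae_tendsto_lintegral_enorm_sub_div hG.locallyIntegrable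
    filter_upwards [ae_surfaceMeasure_cross ha (ae_iff.1 hleb)] with x hx hxT
    have hx1 := hx hxT.2
    simp only [not_not] at hx1
    have hf : x ∈ frontier Ω := by
      rcases hxT.1 with h | h
      · exact h.1
      · exact h.1
    obtain ⟨ζ, c, hc, hcone⟩ := exists_cone ha hxT.2 hf
    refine hasTrace_of_cone hd hc hcone ?_
    exact T.tendsto_laverage_cross hd (norm_le_one ha) hG x
      (hx1.comp (Besicovitch.tendsto_filterAt volume _))
  -- A boundary point in the tube is an entry or an exit point, and exits are outflow points, which
  -- cannot be inflow points.
  · refine Eventually.of_forall fun x hx => ?_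
    rw [hGg _ hx.2.1]
    rcases (mem_frontier_iff_of_mem_tube ha hx.2).1 hx.1.1 with h | h
    · rw [← h]
    · have := T.β_outflow a _ ha hx.2.1
      rw [← exit, ← h] at this
      exact absurd this ((disjoint_inflow_outflow Ω _).notMem_of_mem_left hx.1)

end TubeFamily

/-! ### Integrability of the inflow data and well-posedness -/

/-- Composition with a map that has a continuously differentiable left inverse preserves
integrability. -/
lemma integrableOn_comp_of_leftInverse {n : ℕ} {L : E n → ℝ} (hL : LocallyIntegrable L volume)
    {S V D : Set (E n)} (hS : IsCompact S) (hV : IsOpen V) (hSV : S ⊆ V) {Q m : E n → E n}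
    (hQ : ContDiffOn ℝ 1 Q V) (hD : MeasurableSet D) (hm : ContinuousOn m D) (hmS : MapsTo m D S)
    (hinv : ∀ w ∈ D, Q (m w) = w) : IntegrableOn (fun w => L (m w)) D volume := by
  have hcont : ContinuousOn (fun y => |(fderiv ℝ Q y).det|) S :=
    (ContinuousLinearMap.continuous_det.comp_continuousOn
      ((hQ.continuousOn_fderiv_of_isOpen hV le_rfl).mono hSV)).abs
  obtain ⟨c, hc⟩ := hS.bddAbove_image hcont
  have hcb : ∀ y ∈ S, |(fderiv ℝ Q y).det| ≤ c := fun y hy => hc ⟨y, hy, rfl⟩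
  have hmm : AEMeasurable m (volume.restrict D) := hm.aemeasurable hD
  -- The map `m` need not be differentiable. Its push-forward of Lebesgue measure is controlled
  -- through the left inverse: the preimage of `A` is contained in the image of `A ∩ S` under `Q`,
  -- whose Jacobian is bounded.
  have hν : Measure.map m (volume.restrict D) ≤ ENNReal.ofReal c • volume.restrict S := by
    refine Measure.le_iff.2 fun A hA => ?_
    rw [Measure.map_apply_of_aemeasurable hmm hA, Measure.restrict_apply₀' hD.nullMeasurableSet,
      Measure.smul_apply, Measure.restrict_apply hA, smul_eq_mul]
    have hsub : m ⁻¹' A ∩ D ⊆ Q '' (A ∩ S) := fun w hw => ⟨m w, ⟨hw.1, hmS hw.2⟩, hinv w hw.2⟩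
    have hmeas : MeasurableSet (A ∩ S) := hA.inter hS.measurableSet
    calc volume (m ⁻¹' A ∩ D) ≤ volume (Q '' (A ∩ S)) := measure_mono hsub
      _ ≤ ∫⁻ y in A ∩ S, ENNReal.ofReal |(fderiv ℝ Q y).det| := by
          refine addHaar_image_le_lintegral_abs_det_fderiv volume hmeas fun y hy => ?_
          exact (((hQ.differentiableOn one_ne_zero).differentiableAt
            (hV.mem_nhds (hSV hy.2))).hasFDerivAt).hasFDerivWithinAt
      _ ≤ ∫⁻ _ in A ∩ S, ENNReal.ofReal c :=
          setLIntegral_mono' hmeas fun y hy => ENNReal.ofReal_le_ofReal (hcb y hy.2)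
      _ = _ := setLIntegral_const _ _
  have hLS : Integrable L (ENNReal.ofReal c • volume.restrict S) :=
    (hL.integrableOn_isCompact hS).smul_measure ENNReal.ofReal_ne_top
  have hLν := hLS.mono_measure hν
  exact (integrable_map_measure hLν.1 hmm).1 hLν

/-- A finite norm forces weak derivatives to exist, and the definition of a weak derivative, already
of order zero, contains local integrability of the function. -/
lemma BoundaryAtlas.locallyIntegrable_localize {d k : ℕ} {Ω : Set (E d)} (A : BoundaryAtlas k Ω)
    {s : ℝ} {p : ℝ≥0∞} {g : E d → ℝ} (hg : A.sobolevNorm s p g < ∞) (i : Fin A.N) :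
    LocallyIntegrable (A.localize g i) volume := by
  have h1 : TransportROM.sobolevNorm s p (A.localize g i) < ∞ :=
    (Finset.single_le_sum (f := fun i => TransportROM.sobolevNorm s p (A.localize g i))
      (fun _ _ => zero_le) (Finset.mem_univ i)).trans_lt hg
  simp only [TransportROM.sobolevNorm, iInf_lt_iff] at h1
  obtain ⟨G, hG, -⟩ := h1
  exact (hG 0 (Nat.zero_le _)).1

namespace TubeFamily

variable {d k : ℕ} {Ω : Set (E d)} {T : TubeFamily Ω} {a : E (d - 1)}

lemma entry_mem_frontier (ha : ‖a‖ < T.ρ) {w : E (d - 1)} (hw : ‖w‖ < T.ρ) :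
    T.entry a w ∈ frontier Ω := (T.α_inflow a w ha hw).1

/-- Data with finite norm are integrable in the coordinates of the cross section. -/
lemma integrable_indicator_entry (hk : 1 ≤ k) (hΩ : IsOpen Ω) (hΩb : Bornology.IsBounded Ω)
    (A : BoundaryAtlas k Ω) {s : ℝ} {p : ℝ≥0∞} {g : E d → ℝ} (hg : A.sobolevNorm s p g < ∞)
    (ha : ‖a‖ < T.ρ) :
    Integrable ((Metric.ball 0 T.ρ).indicator fun w => g (T.entry a w)) volume := by
  set B := Metric.ball (0 : E (d - 1)) T.ρ with hB
  have hcont : ContinuousOn (T.entry a) B := (lipschitzOnWith_entry ha).continuousOn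
  have hk' : (1 : WithTop ℕ∞) ≤ k := by exact_mod_cast hk
  have hfrc : IsCompact (frontier Ω) := by
    refine hΩb.isCompact_closure.of_isClosed_subset isClosed_frontier frontier_subset_closure
  -- The partition of unity reduces the claim to data localized in one chart, where integrability is
  -- known in chart coordinates.
  have key : ∀ i : Fin A.N, Integrable (B.indicator
      fun w => A.weight i (T.entry a w) * g (T.entry a w)) volume := by
    intro i
    set c := A.chart i with hc
    set D := B ∩ T.entry a ⁻¹' tsupport (A.weight i) with hD
    have hDm : MeasurableSet D := by
      obtain ⟨F, hF, hF'⟩ := continuousOn_iff_isClosed.1 hcont _ (isClosed_tsupport (A.weight i))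
      rw [hD, inter_comm, hF']
      exact hF.measurableSet.inter Metric.isOpen_ball.measurableSet
    have hsrc : ∀ x ∈ tsupport (A.weight i), x ∈ c.source := fun x hx => A.tsupport_weight i hx
    have hzero : ∀ x ∈ c.source, x ∈ frontier Ω → (c x).1 = 0 := fun x hx hf =>
      ((A.isDefiningOn hk i).frontier_iff hΩ hx).1 hf
    have hpair : ∀ x ∈ c.source, x ∈ frontier Ω → ((0 : ℝ), (c x).2) = c x := fun x hx hf =>
      Prod.ext (hzero x hx hf).symm rfl
    set S := (fun x => (c x).2) '' (tsupport (A.weight i) ∩ frontier Ω) with hS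
    set V := {y : E (d - 1) | ((0 : ℝ), y) ∈ c.target} with hV
    have hSc : IsCompact S := by
      refine ((A.hasCompactSupport_weight i).isCompact.inter hfrc).image_of_continuousOn ?_
      exact continuous_snd.comp_continuousOn (c.continuousOn.mono fun x hx => hsrc x hx.1)
    have hVo : IsOpen V := c.open_target.preimage (by fun_prop)
    have hSV : S ⊆ V := by
      rintro _ ⟨x, ⟨hx, hf⟩, rfl⟩
      change ((0 : ℝ), (c x).2) ∈ c.target
      rw [hpair x (hsrc x hx) hf]
      exact c.map_source (hsrc x hx)
    -- The point of the cross section is recovered from the chart coordinates of its entry point by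
    -- a `C¹` map, although the entry map is only known to be Lipschitz.
    have hQ : ContDiffOn ℝ 1 (fun y : E (d - 1) => T.cross a (c.symm (0, y))) V := by
      have h1 : ContDiff ℝ 1 (T.cross a) := by
        have h : ContDiff ℝ 1 fun x : E d => x - T.base := contDiff_id.sub contDiff_const
        exact (T.proj.contDiff.comp h).sub
          (((innerSL ℝ T.dir).contDiff.comp h).smul contDiff_const)
      have h2 : ContDiff ℝ 1 fun y : E (d - 1) => ((0 : ℝ), y) := by fun_prop
      exact h1.comp_contDiffOn (((A.contDiffOn_symm i).of_le hk').comp h2.contDiffOn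
        fun y hy => hy)
    have hmem : ∀ w ∈ D, T.entry a w ∈ c.source ∧ T.entry a w ∈ frontier Ω := fun w hw =>
      ⟨hsrc _ hw.2, entry_mem_frontier ha (by simpa [hB] using hw.1)⟩
    have hint := integrableOn_comp_of_leftInverse (A.locallyIntegrable_localize hg i) hSc hVo hSV
      hQ hDm (m := fun w => (c (T.entry a w)).2)
      (continuous_snd.comp_continuousOn (c.continuousOn.comp (hcont.mono inter_subset_left)
        fun w hw => (hmem w hw).1))
      (fun w hw => ⟨_, ⟨hw.2, (hmem w hw).2⟩, rfl⟩)
      (fun w hw => by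
        rw [hpair _ (hmem w hw).1 (hmem w hw).2, c.left_inv (hmem w hw).1]
        exact T.cross_pt a w _)
    rw [← integrable_indicator_iff hDm] at hint
    refine hint.congr (Eventually.of_forall fun w => ?_)
    by_cases hw : w ∈ D
    · have h1 := hmem w hw
      rw [indicator_of_mem hw, indicator_of_mem hw.1, BoundaryAtlas.localize, ← hc,
        hpair _ h1.1 h1.2, if_pos (c.map_source h1.1), c.left_inv h1.1]
    · rw [indicator_of_notMem hw]
      by_cases hwB : w ∈ B
      · have : A.weight i (T.entry a w) = 0 :=
          image_eq_zero_of_notMem_tsupport fun h => hw ⟨hwB, h⟩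
        rw [indicator_of_mem hwB, this, zero_mul]
      · rw [indicator_of_notMem hwB]
  refine (integrable_finsetSum Finset.univ fun i _ => key i).congr
    (Eventually.of_forall fun w => ?_)
  by_cases hw : w ∈ B
  · simp only [indicator_of_mem hw]
    rw [← Finset.sum_mul, A.sum_weight _ (entry_mem_frontier ha (by simpa [hB] using hw)), one_mul]
  · simp [indicator_of_notMem hw]

/-- The transport equation with a constant field is well posed on a tube. -/
theorem wellPosedOn (hd : 1 ≤ d) (hk : 1 ≤ k) (hΩ : IsOpen Ω) (hΩb : Bornology.IsBounded Ω)
    (A : BoundaryAtlas k Ω) (s : ℝ) (p : ℝ≥0∞) (ha : ‖a‖ < T.ρ) :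
    WellPosedOn A s p (T.tube a) fun _ => T.vel a := by
  refine fun g hg => ⟨⟨_, isTransportSolution hd ha
    (integrable_indicator_entry hk hΩ hΩb A hg ha) fun w hw => ?_⟩,
    fun u v hu hv => solution_unique hd hΩ ha hu hv⟩
  rw [indicator_of_mem (by simpa using hw)]

end TubeFamily

/-! ### The quantity of interest of a constant field -/

namespace TubeFamily

variable {d k : ℕ} {Ω : Set (E d)} (T : TubeFamily Ω)

/-- The radius of a ball around the base point that is contained in all tubes. -/
def r₀ : ℝ := min (T.ρ / 4) (min (T.hi / 2) (T.ℓ / 2))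

/-- The quantity of interest for the field `vel a`. -/
def qoi (gm gp : E d → ℝ) (a : E (d - 1)) : ℝ :=
  ∫ x, gp x * gm (T.entry a (T.cross a x)) ∂surfaceMeasure Ω

variable {T} {a : E (d - 1)} {x : E d}

lemma r₀_pos : 0 < T.r₀ := by
  have := T.ρ_pos
  have := T.hi_pos
  have := T.ℓ_pos
  unfold r₀; positivity

lemma cross_base (a : E (d - 1)) : T.cross a T.base = 0 := by
  have := T.cross_pt a 0 0
  simpa [ChordFrame.pt] using this

lemma time_base : T.time T.base = 0 := by
  have := T.time_pt 0 0 0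
  simpa [ChordFrame.pt] using this

lemma norm_cross_lt (ha : ‖a‖ < T.ρ) (hx : x ∈ Metric.closedBall T.base T.r₀) :
    ‖T.cross a x‖ < T.ρ := by
  have h := T.norm_cross_sub_le a x T.base
  rw [cross_base, sub_zero] at h
  rw [mem_closedBall_iff_norm] at hx
  have h1 : T.r₀ ≤ T.ρ / 4 := min_le_left _ _
  have h2 := norm_le_one ha
  have h3 := norm_nonneg (x - T.base)
  have h4 := T.ρ_pos
  nlinarith

lemma mem_tube_of_mem_closedBall (ha : ‖a‖ < T.ρ) (hx : x ∈ Metric.closedBall T.base T.r₀) :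
    x ∈ T.tube a ∧ T.α a (T.cross a x) < T.time x := by
  have hc := norm_cross_lt ha hx
  have h := T.abs_time_sub_le x T.base
  rw [time_base, sub_zero] at h
  rw [mem_closedBall_iff_norm] at hx
  have h1 : T.r₀ ≤ T.hi / 2 := (min_le_right _ _).trans (min_le_left _ _)
  have h2 : T.r₀ ≤ T.ℓ / 2 := (min_le_right _ _).trans (min_le_right _ _)
  have h3 := abs_le.1 (h.trans hx)
  have h4 := T.α_le a _ ha hc
  have h5 := T.lo_lt a _ ha hc
  have h6 := T.ℓ_pos
  have h7 := T.hi_pos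
  exact ⟨⟨hc, by linarith, by linarith⟩, by linarith⟩

/-- Near the base point the time coordinate exceeds every entry time, which is at most `-ℓ`, so a
boundary point there can only be an exit. -/
lemma eq_exit_of_mem_closedBall (ha : ‖a‖ < T.ρ) (hx : x ∈ Metric.closedBall T.base T.r₀)
    (hf : x ∈ frontier Ω) : x = T.exit a (T.cross a x) := by
  obtain ⟨h1, h2⟩ := mem_tube_of_mem_closedBall ha hx
  refine ((mem_frontier_iff_of_mem_tube ha h1).1 hf).resolve_left fun h => ?_
  rw [h, entry, T.time_pt, T.cross_pt] at h2
  exact lt_irrefl _ h2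

lemma mem_outflow_of_mem_closedBall (ha : ‖a‖ < T.ρ) (hx : x ∈ Metric.closedBall T.base T.r₀)
    (hf : x ∈ frontier Ω) : x ∈ outflow Ω fun _ => T.vel a := by
  have h := T.β_outflow a _ ha (norm_cross_lt ha hx)
  rwa [← exit, ← eq_exit_of_mem_closedBall ha hx hf] at h

lemma zero_norm_lt : ‖(0 : E (d - 1))‖ < T.ρ := by rw [norm_zero]; exact T.ρ_pos

/-- Near the base point the boundary is contained in the Lipschitz image of a ball of the cross
section. -/
lemma surfaceMeasure_closedBall_lt_top :
    surfaceMeasure Ω (Metric.closedBall T.base T.r₀) < ∞ := by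
  rw [surfaceMeasure, Measure.restrict_apply Metric.isClosed_closedBall.measurableSet]
  have hsub : Metric.closedBall T.base T.r₀ ∩ frontier Ω ⊆
      T.exit 0 '' Metric.ball 0 T.ρ := fun x hx =>
    ⟨T.cross 0 x, by simpa using norm_cross_lt zero_norm_lt hx.1,
      (eq_exit_of_mem_closedBall zero_norm_lt hx.1 hx.2).symm⟩
  refine (measure_mono hsub).trans_lt ?_
  refine (euclideanHausdorffMeasure_image_le (lipschitzOnWith_exit zero_norm_lt)
    (d - 1)).trans_lt ?_
  rw [EuclideanSpace.euclideanHausdorffMeasure_eq_volume]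
  exact ENNReal.mul_lt_top (ENNReal.pow_lt_top ENNReal.coe_lt_top) measure_ball_lt_top

/-- The projection to the cross section is `1`-Lipschitz for `a = 0`, and it maps the boundary near
the base point onto a set containing a ball of radius `h / K`, because the exit map has Lipschitz
constant `K`. This yields the summand `d - 1` in the rate. -/
lemma exists_le_surfaceMeasure_closedBall (T : TubeFamily Ω) : ∃ c > 0, ∀ h, 0 < h → h ≤ T.r₀ →
    c * h ^ (d - 1) ≤ (surfaceMeasure Ω).real (Metric.closedBall T.base h) := by
  have hM := T.M_nonneg
  set K := 1 + 2 * T.M with hK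
  have hK1 : 1 ≤ K := by linarith
  set V := volume.real (Metric.ball (0 : E (d - 1)) 1) with hV
  have hV0 : 0 < V := ENNReal.toReal_pos (Metric.measure_ball_pos _ _ one_pos).ne'
    measure_ball_lt_top.ne
  refine ⟨K⁻¹ ^ (d - 1) * V, by positivity, fun h hh hhr => ?_⟩
  have hexit0 : T.exit 0 0 = T.base := by
    have := eq_exit_of_mem_closedBall (T := T) zero_norm_lt
      (Metric.mem_closedBall_self r₀_pos.le) T.base_mem
    rw [cross_base] at this
    exact this.symm
  have hρ : h / K < T.ρ := by
    have h1 : T.r₀ ≤ T.ρ / 4 := min_le_left _ _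
    have h2 := T.ρ_pos
    have : h / K ≤ h := div_le_self hh.le hK1
    linarith
  have hsub : Metric.closedBall (0 : E (d - 1)) (h / K) ⊆
      T.cross 0 '' (Metric.closedBall T.base h ∩ frontier Ω) := by
    intro w hw
    rw [mem_closedBall_zero_iff] at hw
    have hwρ : ‖w‖ < T.ρ := hw.trans_lt hρ
    refine ⟨T.exit 0 w, ⟨?_, ?_⟩, T.cross_pt 0 w _⟩
    · have h1 := (lipschitzOnWith_exit (T := T) zero_norm_lt).dist_le_mul w (by simpa using hwρ) 0
        (by simpa using T.ρ_pos)
      rw [hexit0, Real.coe_toNNReal _ (by positivity), dist_zero_right] at h1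
      rw [Metric.mem_closedBall]
      refine h1.trans ?_
      rw [le_div_iff₀ (by positivity)] at hw
      linarith
    · exact (T.β_outflow 0 w zero_norm_lt hwρ).1
  have hL : LipschitzOnWith 1 (T.cross 0) (Metric.closedBall T.base h ∩ frontier Ω) := by
    refine LipschitzOnWith.of_dist_le_mul fun x _ y _ => ?_
    rw [dist_eq_norm, dist_eq_norm]
    simpa using T.norm_cross_sub_le 0 x y
  have h1 := (measure_mono hsub).trans_eq
    (congrFun (congrArg _ (EuclideanSpace.euclideanHausdorffMeasure_eq_volume (d - 1)).symm) _)
  have h2 := h1.trans (euclideanHausdorffMeasure_image_le hL (d - 1))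
  rw [ENNReal.coe_one, one_pow, one_mul,
    ← Measure.restrict_apply Metric.isClosed_closedBall.measurableSet] at h2
  have hfin : surfaceMeasure Ω (Metric.closedBall T.base h) ≠ ∞ :=
    ((measure_mono (Metric.closedBall_subset_closedBall hhr)).trans_lt
      surfaceMeasure_closedBall_lt_top).ne
  have h3 := ENNReal.toReal_mono hfin h2
  refine le_trans (le_of_eq ?_) h3
  rw [Measure.addHaar_closedBall _ _ (by positivity), ENNReal.toReal_mul,
    ENNReal.toReal_ofReal (by positivity)]
  simp only [finrank_euclideanSpace, Fintype.card_fin]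
  rw [← Measure.real, ← hV, div_eq_inv_mul, mul_pow]
  ring

lemma norm_entry_sub_le (ha : ‖a‖ < T.ρ) {y : E d} (hx : x ∈ Metric.closedBall T.base T.r₀)
    (hy : y ∈ Metric.closedBall T.base T.r₀) :
    ‖T.entry a (T.cross a x) - T.entry a (T.cross a y)‖ ≤ 2 * (1 + 2 * T.M) * ‖x - y‖ := by
  have hM := T.M_nonneg
  have h1 := (lipschitzOnWith_entry ha).dist_le_mul (T.cross a x)
    (by simpa using norm_cross_lt ha hx) (T.cross a y) (by simpa using norm_cross_lt ha hy)
  rw [Real.coe_toNNReal _ (by positivity), dist_eq_norm, dist_eq_norm] at h1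
  have h2 := T.norm_cross_sub_le a x y
  have h3 : (1 + ‖a‖) * ‖x - y‖ ≤ 2 * ‖x - y‖ := by
    gcongr; linarith [norm_le_one ha]
  calc _ ≤ (1 + 2 * T.M) * (2 * ‖x - y‖) := h1.trans (by gcongr; exact h2.trans h3)
    _ = _ := by ring

/-- Different directions have well separated entry points. -/
lemma le_norm_entry_sub (ha : ‖a‖ < T.ρ) {a' : E (d - 1)} (ha' : ‖a'‖ < T.ρ) :
    T.ℓ / 2 * ‖a - a'‖ ≤ ‖T.entry a 0 - T.entry a' 0‖ := by
  set t := T.α a 0 with ht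
  set t' := T.α a' 0 with ht'
  have hℓ := T.ℓ_pos
  have ht1 : t ≤ -T.ℓ := T.α_le a 0 ha zero_norm_lt
  set δ := T.entry a 0 - T.entry a' 0 with hδ
  have e1 : δ = (t - t') • T.dir + T.emb (t • a - t' • a') := by
    simp only [hδ, entry, ChordFrame.pt, ChordFrame.vel, map_sub, map_smul]; module
  have e2 : |t - t'| ≤ ‖δ‖ := by
    have := T.abs_time_sub_le (T.entry a 0) (T.entry a' 0)
    rwa [entry, entry, T.time_pt, T.time_pt] at this
  have e3 : ‖t • a - t' • a'‖ ≤ ‖δ‖ := by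
    have h := T.norm_proj_le δ
    rw [e1, map_add, map_smul, T.proj_dir, smul_zero, zero_add, T.proj_emb, ← e1] at h
    exact h
  -- The components of `δ` across and along the chord bound the two differences on the right, and
  -- `|t| ≥ ℓ`. The loss from `‖a'‖ ≤ 1 / 4` is absorbed by the factor `1 / 2`.
  have e4 : t • (a - a') = (t • a - t' • a') - (t - t') • a' := by module
  have e5 : |t| * ‖a - a'‖ ≤ ‖δ‖ + ‖δ‖ * (1 / 4) := by
    rw [← Real.norm_eq_abs, ← norm_smul, e4]
    refine (norm_sub_le _ _).trans ?_
    rw [norm_smul, Real.norm_eq_abs]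
    gcongr
    linarith [T.ρ_le]
  have e6 : T.ℓ ≤ |t| := by rw [abs_of_neg (by linarith)]; linarith
  have := mul_le_mul_of_nonneg_right e6 (norm_nonneg (a - a'))
  nlinarith [norm_nonneg δ]

lemma continuousOn_entry_cross (ha : ‖a‖ < T.ρ) :
    ContinuousOn (fun x => T.entry a (T.cross a x)) (Metric.closedBall T.base T.r₀) :=
  (lipschitzOnWith_entry ha).continuousOn.comp (T.continuous_cross a).continuousOn
    fun x hx => by simpa using norm_cross_lt ha hx

lemma continuousOn_entry_param (hx : x ∈ Metric.closedBall T.base T.r₀) :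
    ContinuousOn (fun a => T.entry a (T.cross a x)) (Metric.ball 0 T.ρ) := by
  have hα : ContinuousOn (fun p : E (d - 1) × E (d - 1) => T.α p.1 p.2)
      (Metric.ball 0 T.ρ ×ˢ Metric.ball 0 T.ρ) := by
    have hM := T.M_nonneg
    have hL : LipschitzOnWith (2 * T.M).toNNReal (fun p : E (d - 1) × E (d - 1) => T.α p.1 p.2)
        (Metric.ball 0 T.ρ ×ˢ Metric.ball 0 T.ρ) := by
      refine LipschitzOnWith.of_dist_le_mul fun p hp q hq => ?_
      rw [Real.dist_eq, Real.coe_toNNReal _ (by positivity)]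
      have h0 := T.α_lip p.1 p.2 q.1 q.2 (mem_ball_zero_iff.1 hp.1) (mem_ball_zero_iff.1 hp.2)
        (mem_ball_zero_iff.1 hq.1) (mem_ball_zero_iff.1 hq.2)
      have h1 : ‖p.1 - q.1‖ ≤ dist p q := by
        rw [← dist_eq_norm, Prod.dist_eq]; exact le_max_left _ _
      have h2 : ‖p.2 - q.2‖ ≤ dist p q := by
        rw [← dist_eq_norm, Prod.dist_eq]; exact le_max_right _ _
      calc _ ≤ T.M * (‖p.1 - q.1‖ + ‖p.2 - q.2‖) := h0
        _ ≤ T.M * (dist p q + dist p q) := by gcongr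
        _ = _ := by ring
    exact hL.continuousOn
  have hc : Continuous fun a => T.cross a x := by
    unfold ChordFrame.cross; fun_prop
  have hp : ContinuousOn (fun a => (a, T.cross a x)) (Metric.ball 0 T.ρ) :=
    (continuous_id.prodMk hc).continuousOn
  have hmaps : MapsTo (fun a => (a, T.cross a x)) (Metric.ball 0 T.ρ)
      (Metric.ball 0 T.ρ ×ˢ Metric.ball 0 T.ρ) := fun a ha =>
    mk_mem_prod ha (by simpa using norm_cross_lt (by simpa using ha) hx)
  have h1 : ContinuousOn (fun a => T.α a (T.cross a x)) (Metric.ball 0 T.ρ) := hα.comp hp hmaps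
  have h2 : ContinuousOn (fun a => T.emb (T.cross a x)) (Metric.ball 0 T.ρ) :=
    (T.emb.continuous.comp hc).continuousOn
  have h3 : ContinuousOn (fun a => T.vel a) (Metric.ball 0 T.ρ) :=
    (continuous_const.add T.emb.continuous).continuousOn
  exact (continuousOn_const.add h2).add (h1.smul h3)

/-! ### The quantity of interest for continuous data concentrated near the base point -/

section

variable {gm gp : E d → ℝ}

lemma aestronglyMeasurable_qoi (hgm : Continuous gm) (hgp : Continuous gp)
    (hsupp : Function.support gp ⊆ Metric.closedBall T.base T.r₀) (ha : ‖a‖ < T.ρ) :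
    AEStronglyMeasurable (fun x => gp x * gm (T.entry a (T.cross a x))) (surfaceMeasure Ω) := by
  have h1 : ContinuousOn (fun x => gp x * gm (T.entry a (T.cross a x)))
      (Metric.closedBall T.base T.r₀) :=
    hgp.continuousOn.mul (hgm.comp_continuousOn (continuousOn_entry_cross ha))
  have h2 := (aestronglyMeasurable_indicator_iff Metric.isClosed_closedBall.measurableSet).2
    (h1.aestronglyMeasurable (μ := surfaceMeasure Ω) Metric.isClosed_closedBall.measurableSet)
  refine h2.congr (Eventually.of_forall fun x => ?_)
  by_cases hx : x ∈ Metric.closedBall T.base T.r₀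
  · simp only [indicator_of_mem hx]
  · have : gp x = 0 := Function.notMem_support.1 fun h => hx (hsupp h)
    simp only [indicator_of_notMem hx, this, zero_mul]

lemma integrable_gp (hgp : Continuous gp)
    (hsupp : Function.support gp ⊆ Metric.closedBall T.base T.r₀) :
    Integrable gp (surfaceMeasure Ω) := by
  have h1 : IntegrableOn gp (Metric.closedBall T.base T.r₀) (surfaceMeasure Ω) := by
    have : IsFiniteMeasure ((surfaceMeasure Ω).restrict (Metric.closedBall T.base T.r₀)) :=
      ⟨by rw [Measure.restrict_apply_univ]; exact surfaceMeasure_closedBall_lt_top⟩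
    have hcs : HasCompactSupport gp :=
      HasCompactSupport.of_support_subset_isCompact (isCompact_closedBall _ _) hsupp
    obtain ⟨C, hC⟩ := hcs.exists_bound_of_continuous hgp
    exact Integrable.of_bound hgp.aestronglyMeasurable C (Eventually.of_forall hC)
  exact (integrableOn_iff_integrable_of_support_subset hsupp).1 h1

lemma integrable_qoi (hgm : Continuous gm) {C : ℝ} (hC : ∀ x, ‖gm x‖ ≤ C) (hgp : Continuous gp)
    (hsupp : Function.support gp ⊆ Metric.closedBall T.base T.r₀) (ha : ‖a‖ < T.ρ) :
    Integrable (fun x => gp x * gm (T.entry a (T.cross a x))) (surfaceMeasure Ω) := by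
  refine ((integrable_gp hgp hsupp).norm.mul_const C).mono'
    (aestronglyMeasurable_qoi hgm hgp hsupp ha) (Eventually.of_forall fun x => ?_)
  rw [norm_mul]
  gcongr
  exact hC _

/-- Dominated convergence applies because entry points depend continuously on the direction.
Continuity is what later turns values at single parameters into bounds in `L_∞`. -/
lemma continuousOn_qoi (hgm : Continuous gm) {C : ℝ} (hC : ∀ x, ‖gm x‖ ≤ C) (hgp : Continuous gp)
    (hsupp : Function.support gp ⊆ Metric.closedBall T.base T.r₀) :
    ContinuousOn (T.qoi gm gp) (Metric.ball 0 T.ρ) := by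
  refine continuousOn_of_dominated (bound := fun x => ‖gp x‖ * C)
    (fun a ha => aestronglyMeasurable_qoi hgm hgp hsupp (by simpa using ha))
    (fun a _ => Eventually.of_forall fun x => ?_) ((integrable_gp hgp hsupp).norm.mul_const C)
    (Eventually.of_forall fun x => ?_)
  · rw [norm_mul]
    gcongr
    exact hC _
  · by_cases hx : x ∈ Metric.closedBall T.base T.r₀
    · exact continuousOn_const.mul (hgm.comp_continuousOn (continuousOn_entry_param hx))
    · have : gp x = 0 := Function.notMem_support.1 fun h => hx (hsupp h)
      simp only [this, zero_mul]
      exact continuousOn_const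

lemma isSolvabilityDomain (hd : 1 ≤ d) (hk : 1 ≤ k) (hΩ : IsOpen Ω) (hΩb : Bornology.IsBounded Ω)
    (A : BoundaryAtlas k Ω) (s : ℝ) (p : ℝ≥0∞)
    (hsupp : Function.support gp ⊆ Metric.closedBall T.base T.r₀) (ha : ‖a‖ < T.ρ) :
    IsSolvabilityDomain A s p gp (fun _ => T.vel a) (T.tube a) := by
  refine ⟨T.isOpen_tube a, ?_, wellPosedOn hd hk hΩ hΩb A s p ha⟩
  refine (closure_minimal (inter_subset_right.trans hsupp) Metric.isClosed_closedBall).trans ?_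
  exact fun x hx => (mem_tube_of_mem_closedBall ha hx).1

theorem isQuantityOfInterest (hd : 1 ≤ d) (hk : 1 ≤ k) (hΩ : IsOpen Ω)
    (hΩb : Bornology.IsBounded Ω) (A : BoundaryAtlas k Ω) {s : ℝ} {p : ℝ≥0∞}
    (hgm : Continuous gm) {C : ℝ} (hC : ∀ x, ‖gm x‖ ≤ C) (hgms : A.sobolevNorm s p gm < ∞)
    (hgp : Continuous gp) (hsupp : Function.support gp ⊆ Metric.closedBall T.base T.r₀)
    (ha : ‖a‖ < T.ρ) :
    IsQuantityOfInterest A s p gm gp (fun _ => T.vel a) (T.qoi gm gp a) := by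
  set G := (Metric.ball 0 T.ρ).indicator fun w => gm (T.entry a w) with hG
  have hu := isTransportSolution hd ha (integrable_indicator_entry hk hΩ hΩb A hgms ha)
    (g := gm) (fun w hw => by rw [indicator_of_mem (by simpa using hw)])
  have heq : ∀ x, gp x * G (T.cross a x) = gp x * gm (T.entry a (T.cross a x)) := by
    intro x
    by_cases hx : x ∈ Metric.closedBall T.base T.r₀
    · rw [hG, indicator_of_mem (by simpa using norm_cross_lt ha hx)]
    · have : gp x = 0 := Function.notMem_support.1 fun h => hx (hsupp h)
      rw [this, zero_mul, zero_mul]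
  refine ⟨T.tube a, _, isSolvabilityDomain hd hk hΩ hΩb A s p hsupp ha, hu, ?_, ?_⟩
  · simp only [← hG, heq]
    exact (integrable_qoi hgm hC hgp hsupp ha).integrableOn
  · simp only [← hG, heq]
    -- The boundary points in the support of `gp` are all outflow points, so the integral over the
    -- outflow boundary is one over the whole boundary and its domain no longer depends on `a`.
    rw [qoi, setIntegral_eq_integral_of_ae_compl_eq_zero]
    rw [surfaceMeasure, ae_restrict_iff' isClosed_frontier.measurableSet]
    refine Eventually.of_forall fun x hf hx => ?_
    have : gp x = 0 := by
      refine Function.notMem_support.1 fun h => hx ?_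
      exact mem_outflow_of_mem_closedBall ha (hsupp h) hf
    rw [this, zero_mul]

/-- The quantity of interest vanishes if the inflow data vanish near the entry point. -/
lemma qoi_eq_zero {h : ℝ} (hh : h ≤ T.r₀) (hsupp : Function.support gp ⊆ Metric.closedBall T.base h)
    (ha : ‖a‖ < T.ρ) (hgm : ∀ z, ‖z - T.entry a 0‖ ≤ 2 * (1 + 2 * T.M) * h → gm z = 0) :
    T.qoi gm gp a = 0 := by
  rw [qoi]
  refine integral_eq_zero_of_ae (Eventually.of_forall fun x => ?_)
  by_cases hx : x ∈ Metric.closedBall T.base h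
  · have hM := T.M_nonneg
    have h1 := norm_entry_sub_le ha (Metric.closedBall_subset_closedBall hh hx)
      (Metric.mem_closedBall_self r₀_pos.le)
    rw [cross_base] at h1
    rw [mem_closedBall_iff_norm] at hx
    have : gm (T.entry a (T.cross a x)) = 0 := hgm _ (h1.trans (by gcongr))
    simp [this]
  · have : gp x = 0 := Function.notMem_support.1 fun h => hx (hsupp h)
    simp [this]

/-- A lower bound of the quantity of interest if the inflow data are positive near the entry
point. -/
lemma exists_le_qoi (T : TubeFamily Ω) : ∃ c > 0, ∀ (gm gp : E d → ℝ) (a : E (d - 1)) (h N P C : ℝ),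
    ‖a‖ < T.ρ → 0 < h → h ≤ T.r₀ → 0 ≤ N → 0 ≤ P → Continuous gm → Continuous gp →
    (∀ x, ‖gm x‖ ≤ C) → Function.support gp ⊆ Metric.closedBall T.base T.r₀ →
    (∀ x, 0 ≤ gm x) → (∀ x, 0 ≤ gp x) → (∀ x ∈ Metric.closedBall T.base h, P ≤ gp x) →
    (∀ x ∈ Metric.closedBall (T.entry a 0) h, N ≤ gm x) →
    c * (P * N * h ^ (d - 1)) ≤ T.qoi gm gp a := by
  obtain ⟨c, hc, H⟩ := T.exists_le_surfaceMeasure_closedBall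
  have hM := T.M_nonneg
  -- A Lipschitz constant for the map from outflow points to the entry points of their lines:
  -- boundary points within `h / Λ` of the base start within `h` of `T.entry a 0`.
  set Λ := 2 * (1 + 2 * T.M) with hΛ
  have hΛ1 : 1 ≤ Λ := by linarith
  refine ⟨c * Λ⁻¹ ^ (d - 1), by positivity, ?_⟩
  intro gm gp a h N P C ha hh hhr hN hP hgm hgp hC hsupp hgm0 hgp0 hPgp hNgm
  have hh' : h / Λ ≤ h := div_le_self hh.le hΛ1
  have h1 := H (h / Λ) (by positivity) (hh'.trans hhr)
  have hfin : surfaceMeasure Ω (Metric.closedBall T.base (h / Λ)) ≠ ∞ :=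
    ((measure_mono (Metric.closedBall_subset_closedBall (hh'.trans hhr))).trans_lt
      surfaceMeasure_closedBall_lt_top).ne
  have hint := integrable_qoi hgm hC hgp hsupp ha
  have h2 : P * N * (surfaceMeasure Ω).real (Metric.closedBall T.base (h / Λ)) ≤
      ∫ x in Metric.closedBall T.base (h / Λ), gp x * gm (T.entry a (T.cross a x))
        ∂surfaceMeasure Ω := by
    rw [mul_comm, ← smul_eq_mul, ← setIntegral_const]
    refine setIntegral_mono_on (integrableOn_const hfin) hint.integrableOn
      Metric.isClosed_closedBall.measurableSet fun x hx => ?_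
    have hxr := Metric.closedBall_subset_closedBall (hh'.trans hhr) hx
    refine mul_le_mul (hPgp x (Metric.closedBall_subset_closedBall hh' hx)) (hNgm _ ?_) hN
      (hgp0 x)
    have h3 := norm_entry_sub_le ha hxr (Metric.mem_closedBall_self r₀_pos.le)
    rw [cross_base, ← hΛ] at h3
    rw [mem_closedBall_iff_norm] at hx ⊢
    rw [le_div_iff₀ (by positivity)] at hx
    linarith
  have h3 : ∫ x in Metric.closedBall T.base (h / Λ), gp x * gm (T.entry a (T.cross a x))
        ∂surfaceMeasure Ω ≤ T.qoi gm gp a :=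
    setIntegral_le_integral hint (Eventually.of_forall fun x => mul_nonneg (hgp0 x) (hgm0 _))
  refine le_trans ?_ (h2.trans h3)
  calc c * Λ⁻¹ ^ (d - 1) * (P * N * h ^ (d - 1)) = P * N * (c * (h / Λ) ^ (d - 1)) := by
        rw [div_eq_inv_mul, mul_pow]; ring
    _ ≤ _ := by gcongr

end

end TubeFamily

/-! ### Sobolev norms of smooth functions with compact support -/

/-- Each integration by parts removes the first argument of the derivative of `φ` and appends it as
the last argument for `f`, so the arguments come out reversed. Reversal is isometric, so this order
is harmless for the norms. -/
theorem integral_mul_iteratedFDeriv {n : ℕ} {φ : E n → ℝ} (hφ : ContDiff ℝ (⊤ : ℕ∞) φ)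
    (j : ℕ) :
    ∀ f : E n → ℝ, ContDiff ℝ j f → HasCompactSupport f → ∀ v : Fin j → E n,
      ∫ x, f x * iteratedFDeriv ℝ j φ x v =
        (-1) ^ j * ∫ x, φ x * iteratedFDeriv ℝ j f x (fun i => v i.rev) := by
  induction j with
  | zero =>
    intro f _ _ v
    simp [mul_comm]
  | succ j ih =>
    intro f hf hfc v
    have hDφ : ContDiff ℝ 1 (fun x => iteratedFDeriv ℝ j φ x (Fin.tail v)) := by
      have h1 : ContDiff ℝ 1 (iteratedFDeriv ℝ j φ) :=
        hφ.iteratedFDeriv_right (m := 1) (by exact_mod_cast le_top)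
      exact (ContinuousMultilinearMap.apply ℝ (fun _ : Fin j => E n) ℝ
        (Fin.tail v)).contDiff.comp h1
    have h1 : ∀ x, iteratedFDeriv ℝ (j + 1) φ x v =
        fderiv ℝ (fun x => iteratedFDeriv ℝ j φ x (Fin.tail v)) x (v 0) := by
      intro x
      rw [iteratedFDeriv_succ_apply_left]
      have hd : DifferentiableAt ℝ (iteratedFDeriv ℝ j φ) x :=
        (hφ.differentiable_iteratedFDeriv (by exact_mod_cast WithTop.coe_lt_top _)) x
      have := ((ContinuousMultilinearMap.apply ℝ (fun _ : Fin j => E n) ℝ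
        (Fin.tail v)).hasFDerivAt.comp x hd.hasFDerivAt).fderiv
      have h2 : (fun x => iteratedFDeriv ℝ j φ x (Fin.tail v)) =
        (ContinuousMultilinearMap.apply ℝ (fun _ : Fin j => E n) ℝ (Fin.tail v)) ∘
          iteratedFDeriv ℝ j φ := rfl
      rw [h2, this]
      rfl
    have hf1 : ContDiff ℝ 1 f := hf.of_le (by norm_cast; omega)
    have hf' : ContDiff ℝ j (fun x => fderiv ℝ f x (v 0)) :=
      (hf.fderiv_right (m := j) (by norm_cast)).clm_apply contDiff_const
    have hfc' : HasCompactSupport (fun x => fderiv ℝ f x (v 0)) :=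
      hfc.fderiv_apply ℝ (v 0)
    have key : ∫ x, f x * fderiv ℝ (fun x => iteratedFDeriv ℝ j φ x (Fin.tail v)) x (v 0) =
        -∫ x, fderiv ℝ f x (v 0) * iteratedFDeriv ℝ j φ x (Fin.tail v) := by
      apply integral_mul_fderiv_eq_neg_fderiv_mul_of_integrable
      · exact (hf'.continuous.mul hDφ.continuous).integrable_of_hasCompactSupport
          (hfc'.mul_right)
      · exact (hf1.continuous.mul ((hDφ.continuous_fderiv one_ne_zero).clm_apply
          continuous_const)).integrable_of_hasCompactSupport hfc.mul_right
      · exact (hf1.continuous.mul hDφ.continuous).integrable_of_hasCompactSupport hfc.mul_right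
      · exact fun x _ => (hf1.differentiable one_ne_zero) x
      · exact fun x _ => (hDφ.differentiable one_ne_zero) x
    simp_rw [h1]
    rw [key, ih _ hf' hfc' (Fin.tail v), pow_succ]
    have h3 : ∀ x, iteratedFDeriv ℝ j (fun x => fderiv ℝ f x (v 0)) x
        (fun i => Fin.tail v i.rev) = iteratedFDeriv ℝ (j + 1) f x (fun i => v i.rev) := by
      intro x
      rw [iteratedFDeriv_succ_apply_right]
      have h4 : ContDiff ℝ j (fderiv ℝ f) := hf.fderiv_right (m := j) (by norm_cast)
      have h5 := (ContinuousLinearMap.apply ℝ ℝ (v 0)).iteratedFDeriv_comp_left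
        (h4.contDiffAt (x := x)) (i := j) le_rfl
      have h6 : (fun x => fderiv ℝ f x (v 0)) =
        (ContinuousLinearMap.apply ℝ ℝ (v 0)) ∘ fderiv ℝ f := rfl
      rw [h6, h5]
      simp only [ContinuousLinearMap.compContinuousMultilinearMap_coe, Function.comp_apply,
        ContinuousLinearMap.apply_apply, Fin.rev_last]
      congr 2
      funext i
      simp [Fin.init, Fin.tail, Fin.rev_castSucc]
    simp_rw [h3]
    ring

/-- The iterated derivative with the order of the arguments reversed. -/
def revDeriv {n : ℕ} (f : E n → ℝ) (j : ℕ) (x : E n) :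
    ContinuousMultilinearMap ℝ (fun _ : Fin j => E n) ℝ :=
  ContinuousMultilinearMap.domDomCongrₗᵢ ℝ (E n) ℝ Fin.revPerm (iteratedFDeriv ℝ j f x)

theorem norm_revDeriv {n : ℕ} (f : E n → ℝ) (j : ℕ) (x : E n) :
    ‖revDeriv f j x‖ = ‖iteratedFDeriv ℝ j f x‖ :=
  LinearIsometryEquiv.norm_map _ _

theorem norm_revDeriv_sub {n : ℕ} (f : E n → ℝ) (j : ℕ) (x y : E n) :
    ‖revDeriv f j x - revDeriv f j y‖ = ‖iteratedFDeriv ℝ j f x - iteratedFDeriv ℝ j f y‖ := by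
  rw [revDeriv, revDeriv, ← map_sub, LinearIsometryEquiv.norm_map]

theorem isWeakDeriv_revDeriv {n j : ℕ} {f : E n → ℝ} (hf : ContDiff ℝ j f)
    (hfc : HasCompactSupport f) : IsWeakDeriv j f (revDeriv f j) := by
  refine ⟨hf.continuous.locallyIntegrable, ?_, ?_⟩
  · exact ((LinearIsometryEquiv.continuous _).comp
      (hf.continuous_iteratedFDeriv le_rfl)).locallyIntegrable
  · intro φ hφ _ v
    rw [integral_mul_iteratedFDeriv hφ j f hf hfc v]
    rfl

theorem eLpNorm_le_of_support {n : ℕ} {F : Type*} [NormedAddCommGroup F] {G : E n → F} {R B : ℝ}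
    (p : ℝ≥0∞) (hG : Function.support G ⊆ Metric.closedBall 0 R) (hB : ∀ x, ‖G x‖ ≤ B) :
    eLpNorm G p volume ≤
      volume (Metric.closedBall (0 : E n) R) ^ p.toReal⁻¹ * ENNReal.ofReal B := by
  rw [← eLpNorm_restrict_eq_of_support_subset hG]
  refine (eLpNorm_le_of_ae_bound (Eventually.of_forall hB)).trans ?_
  rw [Measure.restrict_apply_univ]

/-- The kernel which bounds the Slobodeckij seminorm of a function that varies by `1` at unit
scale. -/
def slobodeckijKernel (n : ℕ) (θ q : ℝ) (r : ℝ) : ℝ :=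
  (min 1 r / r ^ (θ + n / q)) ^ q

/-- In polar coordinates the integrand is `min 1 y ^ q * y ^ (-1 - θ * q)`. It is integrable at the
origin because `θ < 1`, and at infinity because `θ > 0`. -/
theorem lintegral_slobodeckijKernel_lt_top {n : ℕ} (hn : 1 ≤ n) {θ q : ℝ} (hθ : 0 < θ)
    (hθ1 : θ < 1) (hq : 1 ≤ q) :
    ∫⁻ x : E n, ENNReal.ofReal (slobodeckijKernel n θ q ‖x‖) < ∞ := by
  have : Nonempty (Fin n) := ⟨⟨0, hn⟩⟩
  have : Nontrivial (E n) := inferInstance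
  have hq0 : 0 < q := by linarith
  have hI : Integrable (fun x : E n => slobodeckijKernel n θ q ‖x‖) := by
    rw [integrable_fun_norm_addHaar (volume : Measure (E n)) (f := slobodeckijKernel n θ q)]
    simp only [finrank_euclideanSpace, Fintype.card_fin, smul_eq_mul]
    rw [← Ioc_union_Ioi_eq_Ioi zero_le_one]
    have hform : ∀ y : ℝ, 0 < y → y ^ (n - 1) * slobodeckijKernel n θ q y =
        (min 1 y) ^ q * y ^ (-1 - θ * q) := by
      intro y hy
      rw [slobodeckijKernel, Real.div_rpow (by positivity) (by positivity), ← Real.rpow_mul hy.le,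
        ← Real.rpow_natCast y (n - 1), Nat.cast_sub hn, div_eq_mul_inv, ← Real.rpow_neg hy.le,
        mul_left_comm, ← Real.rpow_add hy]
      congr 2
      field_simp
      push_cast
      ring
    refine IntegrableOn.union ?_ ?_
    · have h1 : IntegrableOn (fun y : ℝ => y ^ (q - 1 - θ * q)) (Ioc 0 1) := by
        rw [← intervalIntegrable_iff_integrableOn_Ioc_of_le zero_le_one]
        exact intervalIntegral.intervalIntegrable_rpow' (by nlinarith)
      refine h1.congr_fun ?_ measurableSet_Ioc
      intro y hy
      change _ = y ^ (n - 1) * slobodeckijKernel n θ q y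
      rw [hform y hy.1, min_eq_right hy.2, ← Real.rpow_add hy.1]
      ring_nf
    · have h1 : IntegrableOn (fun y : ℝ => y ^ (-1 - θ * q)) (Ioi 1) :=
        integrableOn_Ioi_rpow_of_lt (by nlinarith) one_pos
      refine h1.congr_fun ?_ measurableSet_Ioi
      intro y hy
      have hy' : (1 : ℝ) < y := hy
      change _ = y ^ (n - 1) * slobodeckijKernel n θ q y
      rw [hform y (by linarith), min_eq_left hy'.le, Real.one_rpow, one_mul]
  have := hI.lintegral_lt_top
  exact this

/-- The kernel at scale `h`. -/
theorem lintegral_scaled_slobodeckijKernel {n : ℕ} {θ q h : ℝ} (hh : 0 < h) (hq : 1 ≤ q) :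
    ∫⁻ x : E n, ENNReal.ofReal ((h ^ θ * min 1 (‖x‖ / h) / ‖x‖ ^ (θ + n / q)) ^ q) =
      ∫⁻ x : E n, ENNReal.ofReal (slobodeckijKernel n θ q ‖x‖) := by
  have hq0 : 0 < q := by linarith
  -- The prefactor `h ^ θ` leaves exactly the Jacobian of the dilation by `1 / h`, so the integral
  -- is independent of the scale.
  have hc : ∀ x : E n, ENNReal.ofReal ((h ^ θ * min 1 (‖x‖ / h) / ‖x‖ ^ (θ + n / q)) ^ q) =
      ENNReal.ofReal ((h⁻¹) ^ n) * ENNReal.ofReal (slobodeckijKernel n θ q ‖h⁻¹ • x‖) := by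
    intro x
    rw [← ENNReal.ofReal_mul (by positivity), slobodeckijKernel, norm_smul, norm_inv,
      Real.norm_of_nonneg hh.le, ← div_eq_inv_mul]
    congr 1
    have h1 : (h⁻¹) ^ n = (h ^ (-(n / q : ℝ))) ^ q := by
      rw [← Real.rpow_mul hh.le, neg_mul, div_mul_cancel₀ _ hq0.ne', Real.rpow_neg hh.le,
        Real.rpow_natCast, inv_pow]
    rw [h1, ← Real.mul_rpow (by positivity) (by positivity)]
    congr 1
    rw [Real.div_rpow (norm_nonneg _) hh.le, Real.rpow_add hh, Real.rpow_neg hh.le]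
    have h2 : h ^ (n / q : ℝ) ≠ 0 := by positivity
    field_simp
  simp_rw [hc]
  rw [lintegral_const_mul' _ _ ENNReal.ofReal_ne_top]
  have hme : MeasurableEmbedding (fun x : E n => h⁻¹ • x) :=
    (Homeomorph.smulOfNeZero h⁻¹ (inv_ne_zero hh.ne')).measurableEmbedding
  have h3 := hme.lintegral_map (μ := volume)
    (fun x : E n => ENNReal.ofReal (slobodeckijKernel n θ q ‖x‖))
  rw [← h3, Measure.map_addHaar_smul _ (inv_ne_zero hh.ne'), lintegral_smul_measure, smul_eq_mul,
    ← mul_assoc, ← ENNReal.ofReal_mul (by positivity), finrank_euclideanSpace, Fintype.card_fin,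
    abs_of_pos (by positivity), mul_inv_cancel₀ (by positivity), ENNReal.ofReal_one, one_mul]

/-- The triangle inequality is used at distances above `h`, the mean value inequality below. -/
theorem norm_iteratedFDeriv_sub_le {X F : Type*} [NormedAddCommGroup X] [NormedSpace ℝ X]
    [NormedAddCommGroup F] [NormedSpace ℝ F] {j : ℕ} {f : X → F} (hf : ContDiff ℝ (j + 1 : ℕ) f)
    {B h : ℝ} (hh : 0 < h) (h0 : ∀ x, ‖iteratedFDeriv ℝ j f x‖ ≤ B)
    (h1 : ∀ x, ‖iteratedFDeriv ℝ (j + 1) f x‖ ≤ B / h) (x y : X) :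
    ‖iteratedFDeriv ℝ j f x - iteratedFDeriv ℝ j f y‖ ≤ 2 * B * min 1 (‖x - y‖ / h) := by
  have hB : 0 ≤ B := (norm_nonneg _).trans (h0 x)
  rcases le_total 1 (‖x - y‖ / h) with hc | hc
  · rw [min_eq_left hc]
    linarith [norm_sub_le (iteratedFDeriv ℝ j f x) (iteratedFDeriv ℝ j f y), h0 x, h0 y]
  · rw [min_eq_right hc]
    have h2 : ‖iteratedFDeriv ℝ j f x - iteratedFDeriv ℝ j f y‖ ≤ B / h * ‖x - y‖ := by
      refine convex_univ.norm_image_sub_le_of_norm_fderiv_le (𝕜 := ℝ) (fun z _ => ?_)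
        (fun z _ => ?_) (mem_univ y) (mem_univ x)
      · exact (hf.differentiable_iteratedFDeriv (by exact_mod_cast Nat.lt_succ_self j)) z
      · rw [norm_fderiv_iteratedFDeriv]
        exact h1 z
    have h3 : B / h * ‖x - y‖ = B * (‖x - y‖ / h) := by ring
    have h4 : 0 ≤ B * (‖x - y‖ / h) := by positivity
    linarith

/-- The bounding kernel never exceeds one, since `min 1 t ≤ t ^ θ` for `t = ‖z.1 - z.2‖ / h`. On the
diagonal the quotient is zero by convention. -/
theorem eLpNorm_top_slobodeckij_le {n : ℕ} {θ h B : ℝ} (hθ : 0 < θ) (hθ1 : θ < 1) (hh : 0 < h)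
    (hB : 0 ≤ B) {g : E n × E n → ℝ}
    (hg : ∀ z, ‖g z‖ ≤ B * (h ^ θ * min 1 (‖z.1 - z.2‖ / h) / ‖z.1 - z.2‖ ^ θ)) :
    eLpNorm g ∞ volume ≤ ENNReal.ofReal B := by
  have h1 : ∀ z, ‖g z‖ ≤ B := by
    intro z
    refine (hg z).trans (mul_le_of_le_one_right hB ?_)
    rcases (norm_nonneg (z.1 - z.2)).eq_or_lt with h0 | h0
    · rw [← h0]
      simp
    rw [div_le_one (by positivity)]
    set r := ‖z.1 - z.2‖
    rcases le_total 1 (r / h) with hc | hc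
    · rw [min_eq_left hc, mul_one]
      exact Real.rpow_le_rpow hh.le ((one_le_div hh).mp hc) hθ.le
    · rw [min_eq_right hc]
      have h2 : r / h ≤ (r / h) ^ θ := by
        conv_lhs => rw [← Real.rpow_one (r / h)]
        exact Real.rpow_le_rpow_of_exponent_ge (by positivity) hc hθ1.le
      have h3 : r ^ θ = h ^ θ * (r / h) ^ θ := by
        rw [← Real.mul_rpow hh.le (by positivity), mul_div_cancel₀ _ hh.ne']
      rw [h3]
      gcongr
  have h2 := eLpNorm_le_of_ae_bound (p := ∞) (μ := (volume : Measure (E n × E n)))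
    (Eventually.of_forall h1)
  simpa using h2

/-- One of the two variables lies in the ball of radius `R`. Integrating over the other variable
first gives the scale-invariant integral of the kernel, so the double integral is at most twice the
volume of the ball times a constant. -/
theorem eLpNorm_slobodeckij_le {n : ℕ} (hn : 1 ≤ n) {θ : ℝ} (hθ : 0 < θ) (hθ1 : θ < 1)
    {p : ℝ≥0∞} (hp : 1 ≤ p) (hp' : p ≠ ∞) (R : ℝ) :
    ∃ K : ℝ≥0, ∀ (h B : ℝ) (g : E n × E n → ℝ), 0 < h → 0 ≤ B →
      (∀ z, z.1 ∉ Metric.closedBall 0 R → z.2 ∉ Metric.closedBall 0 R → g z = 0) →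
      (∀ z, ‖g z‖ ≤
        B * (h ^ θ * min 1 (‖z.1 - z.2‖ / h) / ‖z.1 - z.2‖ ^ (θ + n / p.toReal))) →
      eLpNorm g p volume ≤ K * ENNReal.ofReal B := by
  set q := p.toReal with hq
  have hq1 : 1 ≤ q := by
    rw [hq, ← ENNReal.toReal_one]
    exact ENNReal.toReal_mono hp' hp
  have hq0 : 0 < q := by linarith
  set V := volume (Metric.closedBall (0 : E n) R) with hV
  have hVfin : V < ∞ := measure_closedBall_lt_top
  set I := ∫⁻ x : E n, ENNReal.ofReal (slobodeckijKernel n θ q ‖x‖) with hI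
  have hIfin : I < ∞ := lintegral_slobodeckijKernel_lt_top hn hθ hθ1 hq1
  have hKfin : (2 * V * I) ^ q⁻¹ ≠ ∞ :=
    ENNReal.rpow_ne_top_of_nonneg (by positivity)
      (ENNReal.mul_ne_top (ENNReal.mul_ne_top (by simp) hVfin.ne) hIfin.ne)
  refine ⟨((2 * V * I) ^ q⁻¹).toNNReal, fun h B g hh hB hg0 hg => ?_⟩
  rw [ENNReal.coe_toNNReal hKfin]
  set κ : E n → ℝ := fun x => h ^ θ * min 1 (‖x‖ / h) / ‖x‖ ^ (θ + n / q) with hκ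
  have hκ0 : ∀ x, 0 ≤ κ x := fun x => by simp only [hκ]; positivity
  have hκm : Measurable κ := by
    simp only [hκ]
    fun_prop
  set k : E n → ℝ≥0∞ := fun x => ENNReal.ofReal (κ x ^ q) with hkdef
  have hkm : Measurable k := by
    simp only [hkdef]
    fun_prop
  have hkI : ∫⁻ x, k x = I := lintegral_scaled_slobodeckijKernel hh hq1
  set χ : E n → ℝ≥0∞ := (Metric.closedBall (0 : E n) R).indicator 1 with hχ
  have hχm : Measurable χ := measurable_one.indicator measurableSet_closedBall
  have hχtop : ∀ x, χ x ≠ ∞ := fun x =>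
    ((indicator_le_self _ _ x).trans_lt ENNReal.one_lt_top).ne
  have hχI : ∫⁻ x, χ x = V := by
    rw [hχ, lintegral_indicator_one measurableSet_closedBall]
  have hpt : ∀ z : E n × E n, ‖g z‖ₑ ^ q ≤
      ENNReal.ofReal B ^ q * ((χ z.1 + χ z.2) * k (z.1 - z.2)) := by
    intro z
    by_cases hz : z.1 ∈ Metric.closedBall 0 R ∨ z.2 ∈ Metric.closedBall 0 R
    · have h1 : 1 ≤ χ z.1 + χ z.2 := by
        rcases hz with hz | hz
        · refine le_add_right ?_
          simp [hχ, indicator_of_mem hz]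
        · refine le_add_left ?_
          simp [hχ, indicator_of_mem hz]
      have h2 : ‖g z‖ₑ ^ q ≤ ENNReal.ofReal B ^ q * k (z.1 - z.2) := by
        have h3 : k (z.1 - z.2) = ENNReal.ofReal (κ (z.1 - z.2)) ^ q :=
          (ENNReal.ofReal_rpow_of_nonneg (hκ0 _) hq0.le).symm
        rw [h3, ← ENNReal.mul_rpow_of_nonneg _ _ hq0.le, ← ENNReal.ofReal_mul hB,
          ← ofReal_norm]
        exact ENNReal.rpow_le_rpow (ENNReal.ofReal_le_ofReal (hg z)) hq0.le
      calc ‖g z‖ₑ ^ q ≤ ENNReal.ofReal B ^ q * (1 * k (z.1 - z.2)) := by rwa [one_mul]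
        _ ≤ _ := by gcongr
    · push Not at hz
      rw [hg0 z hz.1 hz.2]
      simp [hq0]
  have hint : ∫⁻ z : E n × E n, (χ z.1 + χ z.2) * k (z.1 - z.2) = 2 * V * I := by
    have hk2 : Measurable fun z : E n × E n => k (z.1 - z.2) :=
      hkm.comp (measurable_fst.sub measurable_snd)
    have hm1 : Measurable fun z : E n × E n => χ z.1 * k (z.1 - z.2) :=
      (hχm.comp measurable_fst).mul hk2
    have hm2 : Measurable fun z : E n × E n => χ z.2 * k (z.1 - z.2) :=
      (hχm.comp measurable_snd).mul hk2
    simp_rw [add_mul]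
    rw [lintegral_add_left hm1, Measure.volume_eq_prod, lintegral_prod _ hm1.aemeasurable,
      lintegral_prod_symm _ hm2.aemeasurable]
    have h1 : ∀ x : E n, ∫⁻ y, χ x * k (x - y) = χ x * I := by
      intro x
      rw [lintegral_const_mul' _ _ (hχtop _),
        lintegral_sub_left_eq_self k x, hkI]
    have h2 : ∀ y : E n, ∫⁻ x, χ y * k (x - y) = χ y * I := by
      intro y
      rw [lintegral_const_mul' _ _ (hχtop _),
        lintegral_sub_right_eq_self k y, hkI]
    simp only [h1, h2]
    rw [lintegral_mul_const _ hχm, hχI]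
    ring
  rw [eLpNorm_eq_lintegral_rpow_enorm_toReal (by positivity) hp', ← hq, one_div]
  calc (∫⁻ z, ‖g z‖ₑ ^ q) ^ q⁻¹
      ≤ (∫⁻ z : E n × E n, ENNReal.ofReal B ^ q * ((χ z.1 + χ z.2) * k (z.1 - z.2))) ^ q⁻¹ := by
        gcongr with z
        exact hpt z
    _ = (ENNReal.ofReal B ^ q * (2 * V * I)) ^ q⁻¹ := by
        rw [lintegral_const_mul' _ _ (ENNReal.rpow_ne_top_of_nonneg hq0.le ENNReal.ofReal_ne_top),
          hint]
    _ = (2 * V * I) ^ q⁻¹ * ENNReal.ofReal B := by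
        rw [ENNReal.mul_rpow_of_nonneg _ _ (by positivity), ← ENNReal.rpow_mul,
          mul_inv_cancel₀ hq0.ne', ENNReal.rpow_one, mul_comm]

/-- A function with support in a fixed ball that oscillates at scale `h` with amplitude `C * h ^ s`
has Sobolev norm of order `s` at most a constant times `C`. -/
theorem sobolevNorm_le_of_scale {n k : ℕ} (hn : 1 ≤ n) {s : ℝ} (hs : 0 < s) (hsk : s ≤ k)
    {p : ℝ≥0∞} (hp : 1 ≤ p) (R : ℝ) :
    ∃ K : ℝ≥0, ∀ (f : E n → ℝ) (h C : ℝ), ContDiff ℝ k f →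
      Function.support f ⊆ Metric.closedBall 0 R → 0 < h → h ≤ 1 → 0 ≤ C →
      (∀ j ≤ k, ∀ x, ‖iteratedFDeriv ℝ j f x‖ ≤ C * h ^ s / h ^ j) →
      sobolevNorm s p f ≤ K * ENNReal.ofReal C := by
  have hfl : ⌊s⌋₊ ≤ k := Nat.floor_le_of_le hsk
  have hfls : (⌊s⌋₊ : ℝ) ≤ s := Nat.floor_le hs.le
  have hfr : s - ⌊s⌋₊ = Int.fract s := by
    rw [natCast_floor_eq_intCast_floor hs.le, Int.self_sub_floor]
  set V := volume (Metric.closedBall (0 : E n) R) with hV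
  have hVfin : V ^ p.toReal⁻¹ ≠ ∞ :=
    ENNReal.rpow_ne_top_of_nonneg (by positivity) measure_closedBall_lt_top.ne
  -- the Slobodeckij part
  have hslob : ∃ K₁ : ℝ≥0, Int.fract s ≠ 0 → ∀ (h B : ℝ) (g : E n × E n → ℝ), 0 < h → 0 ≤ B →
      (∀ z, z.1 ∉ Metric.closedBall 0 R → z.2 ∉ Metric.closedBall 0 R → g z = 0) →
      (∀ z, ‖g z‖ ≤ B * (h ^ Int.fract s * min 1 (‖z.1 - z.2‖ / h) /
        ‖z.1 - z.2‖ ^ (Int.fract s + n / p.toReal))) →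
      eLpNorm g p volume ≤ K₁ * ENNReal.ofReal B := by
    by_cases h0 : Int.fract s = 0
    · exact ⟨0, fun h => absurd h0 h⟩
    have hθ : 0 < Int.fract s := (Int.fract_nonneg s).lt_of_ne' h0
    by_cases hp' : p = ∞
    · subst hp'
      refine ⟨1, fun _ h B g hh hB _ hg => ?_⟩
      rw [ENNReal.coe_one, one_mul]
      refine eLpNorm_top_slobodeckij_le hθ (Int.fract_lt_one s) hh hB (fun z => ?_)
      simpa using hg z
    · obtain ⟨K, hK⟩ := eLpNorm_slobodeckij_le hn hθ (Int.fract_lt_one s) hp hp' R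
      exact ⟨K, fun _ => hK⟩
  obtain ⟨K₁, hK₁⟩ := hslob
  refine ⟨(⌊s⌋₊ + 1) * (V ^ p.toReal⁻¹).toNNReal + 2 * K₁,
    fun f h C hf hsupp hh hh1 hC hD => ?_⟩
  have hfc : HasCompactSupport f :=
    HasCompactSupport.of_support_subset_isCompact (isCompact_closedBall 0 R) hsupp
  have hts : tsupport f ⊆ Metric.closedBall 0 R :=
    closure_minimal hsupp Metric.isClosed_closedBall
  have hsuppj : ∀ j, Function.support (revDeriv f j) ⊆ Metric.closedBall 0 R := by
    intro j x hx
    apply hts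
    refine (tsupport_iteratedFDeriv_subset (𝕜 := ℝ) j) (subset_tsupport _ ?_)
    rw [Function.mem_support] at hx ⊢
    rwa [← norm_ne_zero_iff, ← norm_revDeriv, norm_ne_zero_iff]
  refine (iInf₂_le (revDeriv f) (fun j hj =>
    isWeakDeriv_revDeriv (hf.of_le (by exact_mod_cast hj.trans hfl)) hfc)).trans ?_
  have hpart1 : ∑ j ∈ Finset.range (⌊s⌋₊ + 1), eLpNorm (revDeriv f j) p volume ≤
      (⌊s⌋₊ + 1) * V ^ p.toReal⁻¹ * ENNReal.ofReal C := by
    have : ∀ j ∈ Finset.range (⌊s⌋₊ + 1), eLpNorm (revDeriv f j) p volume ≤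
        V ^ p.toReal⁻¹ * ENNReal.ofReal C := by
      intro j hj
      have hj' : j ≤ ⌊s⌋₊ := Nat.lt_succ_iff.mp (Finset.mem_range.mp hj)
      refine eLpNorm_le_of_support p (hsuppj j) (fun x => ?_)
      rw [norm_revDeriv]
      refine (hD j (hj'.trans hfl) x).trans ?_
      rw [mul_div_assoc]
      refine mul_le_of_le_one_right hC ?_
      rw [div_le_one (by positivity), ← Real.rpow_natCast]
      exact Real.rpow_le_rpow_of_exponent_ge hh hh1 ((Nat.cast_le.mpr hj').trans hfls)
    refine (Finset.sum_le_card_nsmul _ _ _ this).trans ?_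
    simp [mul_assoc]
  have hpart2 : (if Int.fract s = 0 then 0 else
        eLpNorm (fun z : E n × E n => ‖revDeriv f ⌊s⌋₊ z.1 - revDeriv f ⌊s⌋₊ z.2‖ /
          dist z.1 z.2 ^ (Int.fract s + (n : ℝ) / p.toReal)) p volume) ≤
      2 * K₁ * ENNReal.ofReal C := by
    split_ifs with h0
    · exact zero_le
    -- A non-integer order `s ≤ k` leaves one more derivative, which bounds the differences of the
    -- derivative of order `⌊s⌋₊`.
    have hlt : ⌊s⌋₊ + 1 ≤ k := by
      rcases hfl.lt_or_eq with h | h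
      · exact h
      · exfalso
        apply h0
        rw [← hfr, h]
        have : (k : ℝ) ≤ s := by rw [← h]; exact hfls
        linarith
    have h2C : (2 : ℝ≥0∞) * K₁ * ENNReal.ofReal C = K₁ * ENNReal.ofReal (2 * C) := by
      rw [ENNReal.ofReal_mul (by norm_num), ENNReal.ofReal_ofNat]
      ring
    rw [h2C]
    refine hK₁ h0 h (2 * C) _ hh (by positivity) (fun z h1 h2 => ?_) (fun z => ?_)
    · have h3 : revDeriv f ⌊s⌋₊ z.1 = 0 := by
        by_contra h
        exact h1 (hsuppj _ h)
      have h4 : revDeriv f ⌊s⌋₊ z.2 = 0 := by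
        by_contra h
        exact h2 (hsuppj _ h)
      simp [h3, h4]
    · have h3 : C * h ^ s / h ^ ⌊s⌋₊ = C * h ^ Int.fract s := by
        rw [mul_div_assoc, ← hfr, Real.rpow_sub hh, Real.rpow_natCast]
      have h4 := norm_iteratedFDeriv_sub_le (j := ⌊s⌋₊) (B := C * h ^ Int.fract s)
        (hf.of_le (by exact_mod_cast hlt)) hh
        (fun x => by rw [← h3]; exact hD _ hfl x)
        (fun x => by rw [← h3, div_div, ← pow_succ]; exact hD _ hlt x) z.1 z.2
      rw [norm_div, norm_norm, norm_revDeriv_sub, dist_eq_norm, Real.norm_of_nonneg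
        (by positivity : 0 ≤ ‖z.1 - z.2‖ ^ (Int.fract s + n / p.toReal)), ← mul_div_assoc]
      gcongr
      refine h4.trans (le_of_eq ?_)
      ring
  refine (add_le_add hpart1 hpart2).trans (le_of_eq ?_)
  push_cast
  rw [ENNReal.coe_toNNReal hVfin]
  ring

/-! ### Sobolev norms on the boundary of smooth functions on the ambient space -/

theorem exists_uniform_bound {X : Type*} {k : ℕ} {F : ℕ → X → ℝ} {S : Set X}
    (hF : ∀ j ≤ k, ∃ C, ∀ x ∈ S, F j x ≤ C) : ∃ C, 1 ≤ C ∧ ∀ j ≤ k, ∀ x ∈ S, F j x ≤ C := by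
  induction k with
  | zero =>
    obtain ⟨C, hC⟩ := hF 0 le_rfl
    refine ⟨max 1 C, le_max_left _ _, fun j hj x hx => ?_⟩
    obtain rfl : j = 0 := by omega
    exact (hC x hx).trans (le_max_right _ _)
  | succ k ih =>
    obtain ⟨C, hC1, hC⟩ := ih fun j hj => hF j (by omega)
    obtain ⟨C', hC'⟩ := hF (k + 1) le_rfl
    refine ⟨max C C', hC1.trans (le_max_left _ _), fun j hj x hx => ?_⟩
    rcases Nat.le_succ_iff.mp hj with h | rfl
    · exact (hC j h x hx).trans (le_max_left _ _)
    · exact (hC' x hx).trans (le_max_right _ _)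

theorem exists_iteratedFDeriv_bound {X F : Type*} [NormedAddCommGroup X] [NormedSpace ℝ X]
    [NormedAddCommGroup F] [NormedSpace ℝ F] {f : X → F} {k : ℕ}
    (hf : ContDiff ℝ k f) (hfc : HasCompactSupport f) :
    ∃ C, 1 ≤ C ∧ ∀ j ≤ k, ∀ x, ‖iteratedFDeriv ℝ j f x‖ ≤ C := by
  obtain ⟨C, hC1, hC⟩ := exists_uniform_bound (k := k) (S := univ)
    (F := fun j x => ‖iteratedFDeriv ℝ j f x‖) fun j hj => by
      obtain ⟨C, hC⟩ := (hf.continuous_iteratedFDeriv (m := j)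
        (by exact_mod_cast hj)).bounded_above_of_compact_support (hfc.iteratedFDeriv j)
      exact ⟨C, fun x _ => hC x⟩
  exact ⟨C, hC1, fun j hj x => hC j hj x (mem_univ x)⟩

/-- Multiplication by a fixed function preserves the scaling of the derivatives. -/
theorem exists_mul_scale_bound {X : Type*} [NormedAddCommGroup X] [NormedSpace ℝ X] {w : X → ℝ}
    {k : ℕ} (hw : ContDiff ℝ k w) (hwc : HasCompactSupport w) :
    ∃ K, 0 ≤ K ∧ ∀ (Ψ : X → ℝ) (h B : ℝ), ContDiff ℝ k Ψ → 0 < h → h ≤ 1 → 0 ≤ B →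
      (∀ j ≤ k, ∀ x, ‖iteratedFDeriv ℝ j Ψ x‖ ≤ B / h ^ j) →
      ∀ j ≤ k, ∀ x, ‖iteratedFDeriv ℝ j (fun x => w x * Ψ x) x‖ ≤ K * B / h ^ j := by
  obtain ⟨C, hC1, hC⟩ := exists_iteratedFDeriv_bound hw hwc
  refine ⟨2 ^ k * C, by positivity, fun Ψ h B hΨ hh hh1 hB hD j hj x => ?_⟩
  refine (norm_iteratedFDeriv_mul_le (N := k) hw hΨ x (by exact_mod_cast hj)).trans ?_
  have hterm : ∀ i ∈ Finset.range (j + 1), (j.choose i : ℝ) * ‖iteratedFDeriv ℝ i w x‖ *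
      ‖iteratedFDeriv ℝ (j - i) Ψ x‖ ≤ j.choose i * (C * (B / h ^ j)) := by
    intro i hi
    have hi' : i ≤ j := Nat.lt_succ_iff.mp (Finset.mem_range.mp hi)
    have h1 : B / h ^ (j - i) ≤ B / h ^ j :=
      div_le_div_of_nonneg_left hB (by positivity)
        (pow_le_pow_of_le_one hh.le hh1 (Nat.sub_le j i))
    rw [mul_assoc]
    gcongr
    · exact hC i (hi'.trans hj) x
    · exact (hD (j - i) (by omega) x).trans h1
  refine (Finset.sum_le_sum hterm).trans ?_
  rw [← Finset.sum_mul, ← Nat.cast_sum, Nat.sum_range_choose]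
  have h2 : (2 : ℝ) ^ j ≤ 2 ^ k := pow_le_pow_right₀ (by norm_num) hj
  have h3 : (2 : ℝ) ^ k * C * B / h ^ j = 2 ^ k * (C * (B / h ^ j)) := by ring
  rw [h3]
  push_cast
  gcongr

/-- Composition with a fixed map preserves the scaling of the derivatives. -/
theorem norm_iteratedFDerivWithin_comp_scale_le {X Y : Type*} [NormedAddCommGroup X]
    [NormedSpace ℝ X] [NormedAddCommGroup Y] [NormedSpace ℝ Y] {k : ℕ} {T : Set X} (hT : IsOpen T)
    {χ : X → Y} (hχ : ContDiffOn ℝ k χ T) {W : Y → ℝ} (hW : ContDiff ℝ k W) {x : X} (hx : x ∈ T)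
    {M h B : ℝ} (hM : 1 ≤ M) (hχM : ∀ j ≤ k, ‖iteratedFDerivWithin ℝ j χ T x‖ ≤ M) (hh : 0 < h)
    (hh1 : h ≤ 1) (hWB : ∀ j ≤ k, ∀ y, ‖iteratedFDeriv ℝ j W y‖ ≤ B / h ^ j) {j : ℕ}
    (hj : j ≤ k) :
    ‖iteratedFDerivWithin ℝ j (fun x => W (χ x)) T x‖ ≤ j.factorial * M ^ j * B / h ^ j := by
  -- Rescaling before composing keeps the chain rule estimate sharp in `h`: the outer function then
  -- has derivatives bounded by `B`, and those of the inner one are at most `M / h ≤ (M / h) ^ i`.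
  have hcomp : (fun x => W (χ x)) = (fun u => W (h • u)) ∘ (h⁻¹ • χ) := by
    funext x
    simp [smul_smul, mul_inv_cancel₀ hh.ne']
  have hmain := norm_iteratedFDerivWithin_comp_le (𝕜 := ℝ) (g := fun u => W (h • u))
    (f := h⁻¹ • χ) (n := j) (s := T) (t := univ) (x := x) (N := j) (C := B) (D := M / h)
    ((hW.of_le (by exact_mod_cast hj)).comp (contDiff_const_smul h)).contDiffOn
    ((hχ.of_le (by exact_mod_cast hj)).const_smul h⁻¹) le_rfl
    uniqueDiffOn_univ hT.uniqueDiffOn (mapsTo_univ _ _) hx ?_ ?_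
  · rw [hcomp]
    refine hmain.trans (le_of_eq ?_)
    rw [div_pow]
    ring
  · intro i hi
    rw [iteratedFDerivWithin_univ, iteratedFDeriv_comp_const_smul h
      (hW.of_le (by exact_mod_cast hi.trans hj)), norm_smul, norm_pow, Real.norm_of_nonneg hh.le]
    refine (mul_le_mul_of_nonneg_left (hWB i (hi.trans hj) _) (by positivity)).trans (le_of_eq ?_)
    field_simp
  · intro i hi1 hi
    rw [iteratedFDerivWithin_const_smul_apply ((hχ.of_le (by exact_mod_cast hi.trans hj)) x hx)
      hT.uniqueDiffOn hx, norm_smul, norm_inv, Real.norm_of_nonneg hh.le, ← div_eq_inv_mul]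
    have h1 : M / h ≤ (M / h) ^ i :=
      le_self_pow₀ ((one_le_div hh).mpr (hh1.trans hM)) (by omega)
    refine le_trans ?_ h1
    gcongr
    exact hχM i (hi.trans hj)

namespace BoundaryAtlas

variable {d k : ℕ} {Ω : Set (E d)} (A : BoundaryAtlas k Ω) (i : Fin A.N)

/-- The boundary points in the image of the `i`-th chart. -/
def paramDomain : Set (E (d - 1)) := {y | ((0 : ℝ), y) ∈ (A.chart i).target}

/-- The parametrization of the boundary that is inverse to the `i`-th chart. -/
def param (y : E (d - 1)) : E d := (A.chart i).symm (0, y)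

/-- The support of the `i`-th weight in the boundary chart. -/
def paramSupport : Set (E (d - 1)) := {y | ((0 : ℝ), y) ∈ A.chart i '' tsupport (A.weight i)}

theorem isOpen_paramDomain : IsOpen (A.paramDomain i) :=
  (A.chart i).open_target.preimage (by fun_prop : Continuous fun y : E (d - 1) => ((0 : ℝ), y))

theorem isCompact_paramSupport : IsCompact (A.paramSupport i) := by
  have h1 : IsCompact (A.chart i '' tsupport (A.weight i)) :=
    (A.hasCompactSupport_weight i).isCompact.image_of_continuousOn
      ((A.chart i).continuousOn.mono (A.tsupport_weight i))
  have h2 : Topology.IsClosedEmbedding fun y : E (d - 1) => ((0 : ℝ), y) := by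
    refine Topology.IsClosedEmbedding.of_continuous_injective_isClosedMap (by fun_prop)
      (fun y z h => (Prod.ext_iff.mp h).2) ?_
    intro s hs
    have : (fun y : E (d - 1) => ((0 : ℝ), y)) '' s = {0} ×ˢ s := by
      ext z
      simp [Prod.ext_iff, eq_comm, and_comm]
    rw [this]
    exact isClosed_singleton.prod hs
  exact h2.isCompact_preimage h1

theorem paramSupport_subset : A.paramSupport i ⊆ A.paramDomain i := by
  rintro y ⟨x, hx, hxy⟩
  have := (A.chart i).map_source (A.tsupport_weight i hx)
  rwa [hxy] at this

theorem contDiffOn_param : ContDiffOn ℝ k (A.param i) (A.paramDomain i) :=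
  (A.contDiffOn_symm i).comp (by fun_prop : ContDiff ℝ k fun y : E (d - 1) =>
    ((0 : ℝ), y)).contDiffOn fun _ hy => hy

theorem localize_eqOn (g : E d → ℝ) :
    EqOn (A.localize g i) (fun y => A.weight i (A.param i y) * g (A.param i y))
      (A.paramDomain i) := by
  intro y hy
  exact if_pos hy

theorem support_localize_subset (g : E d → ℝ) :
    Function.support (A.localize g i) ⊆ A.paramSupport i := by
  intro y hy
  have hyT : y ∈ A.paramDomain i := by
    by_contra h
    exact hy (if_neg h)
  rw [Function.mem_support, A.localize_eqOn i g hyT] at hy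
  exact ⟨A.param i y, subset_tsupport _ (left_ne_zero_of_mul hy), (A.chart i).right_inv hyT⟩

/-- The support of the localized function lies in a compact subset of the open chart domain, so
extension by zero creates no singularity. -/
theorem contDiff_localize {g : E d → ℝ} (hg : ContDiff ℝ k g) : ContDiff ℝ k (A.localize g i) := by
  rw [contDiff_iff_contDiffAt]
  intro y
  by_cases hy : y ∈ A.paramSupport i
  · have hyT := A.paramSupport_subset i hy
    have h1 : ContDiffOn ℝ k (fun y => A.weight i (A.param i y) * g (A.param i y))
        (A.paramDomain i) :=
      (((A.contDiff_weight i).of_le (by exact_mod_cast le_top)).mul hg).comp_contDiffOn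
        (A.contDiffOn_param i)
    have hn := (A.isOpen_paramDomain i).mem_nhds hyT
    exact (h1.contDiffAt hn).congr_of_eventuallyEq ((A.localize_eqOn i g).eventuallyEq_of_mem hn)
  · have hn := (A.isCompact_paramSupport i).isClosed.isOpen_compl.mem_nhds hy
    refine (contDiffAt_const (c := (0 : ℝ))).congr_of_eventuallyEq ?_
    filter_upwards [hn] with z hz
    by_contra h
    exact hz (A.support_localize_subset i g h)

/-- The localization to a boundary chart preserves the scaling of the derivatives. -/
theorem exists_localize_scale_bound :
    ∃ K, 0 ≤ K ∧ ∀ (Ψ : E d → ℝ) (h B : ℝ), ContDiff ℝ k Ψ → 0 < h → h ≤ 1 → 0 ≤ B →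
      (∀ j ≤ k, ∀ x, ‖iteratedFDeriv ℝ j Ψ x‖ ≤ B / h ^ j) →
      ∀ j ≤ k, ∀ y, ‖iteratedFDeriv ℝ j (A.localize Ψ i) y‖ ≤ K * B / h ^ j := by
  have hwk : ContDiff ℝ k (A.weight i) := (A.contDiff_weight i).of_le (by exact_mod_cast le_top)
  obtain ⟨K, hK0, hK⟩ := exists_mul_scale_bound hwk (A.hasCompactSupport_weight i)
  have hTo := A.isOpen_paramDomain i
  obtain ⟨M, hM1, hM⟩ := exists_uniform_bound (k := k) (S := A.paramSupport i)
    (F := fun j y => ‖iteratedFDerivWithin ℝ j (A.param i) (A.paramDomain i) y‖) fun j hj =>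
      (A.isCompact_paramSupport i).exists_bound_of_continuousOn
        (((A.contDiffOn_param i).continuousOn_iteratedFDerivWithin (by exact_mod_cast hj)
          hTo.uniqueDiffOn).mono (A.paramSupport_subset i))
  refine ⟨k.factorial * M ^ k * K, by positivity, fun Ψ h B hΨ hh hh1 hB hD j hj y => ?_⟩
  by_cases hy : y ∈ A.paramSupport i
  · have hyT := A.paramSupport_subset i hy
    rw [← iteratedFDerivWithin_of_isOpen j hTo hyT,
      iteratedFDerivWithin_congr (A.localize_eqOn i Ψ) hyT]
    refine (norm_iteratedFDerivWithin_comp_scale_le (W := fun x => A.weight i x * Ψ x) hTo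
      (A.contDiffOn_param i) (hwk.mul hΨ) hyT hM1 (fun j hj => hM j hj y hy) hh hh1
      (hK Ψ h B hΨ hh hh1 hB hD) hj).trans ?_
    have h1 : (j.factorial : ℝ) ≤ k.factorial := by exact_mod_cast Nat.factorial_le hj
    have h2 : M ^ j ≤ M ^ k := pow_le_pow_right₀ hM1 hj
    rw [mul_assoc _ K B]
    gcongr
  · have hn := (A.isCompact_paramSupport i).isClosed.isOpen_compl.mem_nhds hy
    have h0 : A.localize Ψ i =ᶠ[𝓝 y] fun _ => 0 := by
      filter_upwards [hn] with z hz
      by_contra h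
      exact hz (A.support_localize_subset i Ψ h)
    have h1 : iteratedFDeriv ℝ j (A.localize Ψ i) y = 0 := by
      rw [(h0.iteratedFDeriv ℝ j).eq_of_nhds]
      simp
    rw [h1, norm_zero]
    positivity

/-- A smooth function that oscillates at scale `h` with amplitude `C * h ^ s` has a boundary
Sobolev norm of order `s` at most a constant times `C`. -/
theorem exists_sobolevNorm_le (hd : 2 ≤ d) {s : ℝ} (hs : 0 < s) (hsk : s ≤ k) {p : ℝ≥0∞}
    (hp : 1 ≤ p) :
    ∃ K : ℝ≥0, ∀ (Ψ : E d → ℝ) (h C : ℝ), ContDiff ℝ k Ψ → 0 < h → h ≤ 1 → 0 ≤ C →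
      (∀ j ≤ k, ∀ x, ‖iteratedFDeriv ℝ j Ψ x‖ ≤ C * h ^ s / h ^ j) →
      A.sobolevNorm s p Ψ ≤ K * ENNReal.ofReal C := by
  have hloc : ∀ i : Fin A.N, ∃ K : ℝ≥0, ∀ (Ψ : E d → ℝ) (h C : ℝ), ContDiff ℝ k Ψ → 0 < h →
      h ≤ 1 → 0 ≤ C → (∀ j ≤ k, ∀ x, ‖iteratedFDeriv ℝ j Ψ x‖ ≤ C * h ^ s / h ^ j) →
      TransportROM.sobolevNorm s p (A.localize Ψ i) ≤ K * ENNReal.ofReal C := by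
    intro i
    obtain ⟨K, hK0, hK⟩ := A.exists_localize_scale_bound i
    obtain ⟨R, hR⟩ := (A.isCompact_paramSupport i).isBounded.subset_closedBall 0
    obtain ⟨K', hK'⟩ := sobolevNorm_le_of_scale (n := d - 1) (by omega) hs hsk hp R
    refine ⟨K' * K.toNNReal, fun Ψ h C hΨ hh hh1 hC hD => ?_⟩
    refine (hK' (A.localize Ψ i) h (K * C) (A.contDiff_localize i hΨ)
      ((A.support_localize_subset i Ψ).trans hR) hh hh1 (by positivity) ?_).trans (le_of_eq ?_)
    · intro j hj y
      refine (hK Ψ h (C * h ^ s) hΨ hh hh1 (by positivity) hD j hj y).trans (le_of_eq ?_)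
      ring
    · rw [ENNReal.ofReal_mul hK0, ENNReal.coe_mul, mul_assoc]
      rfl
  choose K hK using hloc
  refine ⟨∑ i, K i, fun Ψ h C hΨ hh hh1 hC hD => ?_⟩
  rw [BoundaryAtlas.sobolevNorm, ENNReal.ofNNReal_finsetSum, Finset.sum_mul]
  exact Finset.sum_le_sum fun i _ => hK i Ψ h C hΨ hh hh1 hC hD

end BoundaryAtlas

/-! ### Sums of bumps -/

/-- A smooth bump function at the origin: it is `1` on the unit ball and vanishes outside the ball
of radius `2`. -/
def unitBump (N : ℕ) : ContDiffBump (0 : E N) := ⟨1, 2, one_pos, one_lt_two⟩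

/-- The sum of the bumps of size `h` with centers in `J`. -/
def bumpSum {N : ℕ} (J : Finset (E N)) (h : ℝ) (x : E N) : ℝ :=
  ∑ z ∈ J, unitBump N (h⁻¹ • (x - z))

theorem contDiff_bumpSum {N : ℕ} (J : Finset (E N)) (h : ℝ) {k : ℕ} :
    ContDiff ℝ k (bumpSum J h) := by
  refine ContDiff.sum fun z _ => ?_
  exact (unitBump N).contDiff.comp (by fun_prop)

theorem bumpSum_nonneg {N : ℕ} (J : Finset (E N)) (h : ℝ) : 0 ≤ bumpSum J h :=
  fun _ => Finset.sum_nonneg fun _ _ => (unitBump N).nonneg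

theorem unitBump_eq_zero {N : ℕ} {h : ℝ} (hh : 0 < h) {x z : E N} (hx : 2 * h ≤ ‖x - z‖) :
    unitBump N (h⁻¹ • (x - z)) = 0 := by
  apply (unitBump N).zero_of_le_dist
  rw [dist_zero_right, norm_smul, norm_inv, Real.norm_of_nonneg hh.le, ← div_eq_inv_mul,
    le_div_iff₀ hh]
  exact hx

theorem bumpSum_eq_zero {N : ℕ} {J : Finset (E N)} {h : ℝ} (hh : 0 < h) {x : E N}
    (hx : ∀ z ∈ J, 2 * h ≤ ‖x - z‖) : bumpSum J h x = 0 :=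
  Finset.sum_eq_zero fun z hz => unitBump_eq_zero hh (hx z hz)

theorem one_le_bumpSum {N : ℕ} {J : Finset (E N)} {h : ℝ} (hh : 0 < h) {x z : E N} (hz : z ∈ J)
    (hx : ‖x - z‖ ≤ h) : 1 ≤ bumpSum J h x := by
  have h1 : unitBump N (h⁻¹ • (x - z)) = 1 := by
    apply (unitBump N).one_of_mem_closedBall
    rw [mem_closedBall_zero_iff, norm_smul, norm_inv, Real.norm_of_nonneg hh.le, ← div_eq_inv_mul]
    exact (div_le_one hh).mpr hx
  rw [← h1]
  exact Finset.single_le_sum (f := fun z => unitBump N (h⁻¹ • (x - z)))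
    (fun _ _ => (unitBump N).nonneg) hz

theorem bumpSum_eq_one {N : ℕ} {J : Finset (E N)} {h : ℝ} (hh : 0 < h) {z : E N} (hz : z ∈ J)
    (hJ : ∀ z' ∈ J, z' ≠ z → 2 * h ≤ ‖z - z'‖) : bumpSum J h z = 1 := by
  rw [bumpSum, Finset.sum_eq_single_of_mem z hz fun z' hz' hne => unitBump_eq_zero hh
    (hJ z' hz' hne), sub_self, smul_zero]
  exact (unitBump N).one_of_mem_closedBall (Metric.mem_closedBall_self zero_le_one)

/-- The derivatives of a sum of separated bumps of size `h` of order `j` are at most a constant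
times `h ^ (-j)`. -/
theorem exists_bumpSum_bound (N k : ℕ) :
    ∃ B, 1 ≤ B ∧ ∀ (J : Finset (E N)) (h : ℝ), 0 < h →
      (∀ z ∈ J, ∀ z' ∈ J, z ≠ z' → 5 * h ≤ ‖z - z'‖) →
      ∀ j ≤ k, ∀ x, ‖iteratedFDeriv ℝ j (bumpSum J h) x‖ ≤ B / h ^ j := by
  obtain ⟨B, hB1, hB⟩ := exists_iteratedFDeriv_bound (k := k) (unitBump N).contDiff
    (unitBump N).hasCompactSupport
  refine ⟨B, hB1, fun J h hh hJ j hj x => ?_⟩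
  have hcd : ∀ z : E N, ContDiff ℝ j (fun x => unitBump N (h⁻¹ • (x - z))) := fun z =>
    (unitBump N).contDiff.comp (by fun_prop)
  have hterm : ∀ z : E N, iteratedFDeriv ℝ j (fun x => unitBump N (h⁻¹ • (x - z))) x =
      h⁻¹ ^ j • iteratedFDeriv ℝ j (unitBump N) (h⁻¹ • (x - z)) := by
    intro z
    have h1 := iteratedFDeriv_comp_const_smul (i := j) h⁻¹
      ((unitBump N).contDiff.of_le (n := (j : ℕ∞)) (by simp) :
        ContDiff ℝ j (unitBump N))
    have h2 := congrFun (iteratedFDeriv_comp_sub' (𝕜 := ℝ) (f := fun y => unitBump N (h⁻¹ • y))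
      j z) x
    rw [h2, h1]
  have hle : ∀ z : E N, ‖iteratedFDeriv ℝ j (fun x => unitBump N (h⁻¹ • (x - z))) x‖ ≤
      B / h ^ j := by
    intro z
    rw [hterm, norm_smul, norm_pow, norm_inv, Real.norm_of_nonneg hh.le, inv_pow,
      ← div_eq_inv_mul]
    gcongr
    exact hB j hj _
  have hzero : ∀ z : E N, 2 * h < ‖x - z‖ →
      iteratedFDeriv ℝ j (fun x => unitBump N (h⁻¹ • (x - z))) x = 0 := by
    intro z hz
    rw [hterm]
    have : h⁻¹ • (x - z) ∉ tsupport (iteratedFDeriv ℝ j (unitBump N)) := by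
      intro hmem
      have h1 := tsupport_iteratedFDeriv_subset (𝕜 := ℝ) j hmem
      rw [(unitBump N).tsupport_eq, mem_closedBall_zero_iff, norm_smul, norm_inv,
        Real.norm_of_nonneg hh.le, ← div_eq_inv_mul, div_le_iff₀ hh] at h1
      have : (unitBump N).rOut = 2 := rfl
      rw [this] at h1
      linarith
    rw [image_eq_zero_of_notMem_tsupport this, smul_zero]
  have hsum : iteratedFDeriv ℝ j (bumpSum J h) x =
      ∑ z ∈ J, iteratedFDeriv ℝ j (fun x => unitBump N (h⁻¹ • (x - z))) x := by
    exact iteratedFDeriv_fun_sum_apply fun z _ => (hcd z).contDiffAt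
  rw [hsum]
  -- Centres at distance `5 * h` with supports of radius `2 * h`: at most one bump is active at a
  -- given point, so the bound does not grow with the number of bumps.
  by_cases hx : ∃ z ∈ J, ‖x - z‖ ≤ 2 * h
  · obtain ⟨z, hz, hxz⟩ := hx
    rw [Finset.sum_eq_single_of_mem z hz]
    · exact hle z
    · intro z' hz' hne
      apply hzero
      have h1 := hJ z' hz' z hz hne
      have h2 := norm_sub_le_norm_sub_add_norm_sub z' x z
      rw [norm_sub_rev z' x] at h2
      linarith
  · push Not at hx
    rw [Finset.sum_eq_zero fun z hz => hzero z (hx z hz), norm_zero]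
    positivity

/-- The product of a sum of bumps with a suitable amplitude is in the unit ball of the Sobolev
space. -/
theorem BoundaryAtlas.exists_amplitude {d k : ℕ} {Ω : Set (E d)} (A : BoundaryAtlas k Ω)
    (hd : 2 ≤ d) {s : ℝ} (hs : 0 < s) (hsk : s ≤ k) {p : ℝ≥0∞} (hp : 1 ≤ p) :
    ∃ κ : ℝ, 0 < κ ∧ ∀ (J : Finset (E d)) (h : ℝ), 0 < h → h ≤ 1 →
      (∀ z ∈ J, ∀ z' ∈ J, z ≠ z' → 5 * h ≤ ‖z - z'‖) →
      A.sobolevNorm s p (fun x => κ * h ^ s * bumpSum J h x) ≤ 1 := by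
  obtain ⟨K, hK⟩ := A.exists_sobolevNorm_le hd hs hsk hp
  obtain ⟨B, hB1, hB⟩ := exists_bumpSum_bound d k
  have hB0 : 0 < B := by linarith
  -- Dividing by `B` normalizes the derivatives of the bumps, and `K + 1` instead of `K` avoids a
  -- division by zero.
  refine ⟨1 / ((K + 1) * B), by positivity, fun J h hh hh1 hJ => ?_⟩
  refine (hK _ h (1 / (K + 1)) (contDiff_const.mul (contDiff_bumpSum J h)) hh hh1 (by positivity)
    fun j hj x => ?_).trans ?_
  · have h1 := iteratedFDeriv_const_smul_apply' (𝕜 := ℝ) (i := j) (x := x)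
      (a := 1 / ((K + 1) * B) * h ^ s) (contDiff_bumpSum J h (k := j)).contDiffAt
    simp only [smul_eq_mul] at h1
    rw [h1, norm_smul, Real.norm_of_nonneg (by positivity)]
    refine (mul_le_mul_of_nonneg_left (hB J h hh hJ j hj x) (by positivity)).trans (le_of_eq ?_)
    field_simp
  · rw [← ENNReal.ofReal_coe_nnreal, ← ENNReal.ofReal_mul K.coe_nonneg, ENNReal.ofReal_le_one,
      mul_one_div, div_le_one (by positivity)]
    linarith

/-! ### Hölder norms of the flow fields -/

/-- The field is constant in space and `dir` is constant, so all derivatives of positive order come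
from `a` through an isometry and a coordinate projection. -/
theorem ChordFrame.iteratedFDeriv_vel_comp {d m : ℕ} (F : ChordFrame d) {a : E m → E (d - 1)}
    {j : ℕ} (ha : ContDiff ℝ j a) (hj : j ≠ 0) (z : E d × E m) :
    iteratedFDeriv ℝ j (fun z : E d × E m => F.vel (a z.2)) z =
      F.emb.toContinuousLinearMap.compContinuousMultilinearMap
        ((iteratedFDeriv ℝ j a z.2).compContinuousLinearMap
          fun _ => ContinuousLinearMap.snd ℝ (E d) (E m)) := by
  have ha' : ContDiff ℝ j (a ∘ ContinuousLinearMap.snd ℝ (E d) (E m)) :=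
    ha.comp (ContinuousLinearMap.contDiff _)
  have h1 : (fun z : E d × E m => F.vel (a z.2)) = (fun _ => F.dir) +
      F.emb.toContinuousLinearMap ∘ (a ∘ ContinuousLinearMap.snd ℝ (E d) (E m)) := rfl
  have h2 : ContDiff ℝ j (F.emb.toContinuousLinearMap ∘
      (a ∘ ContinuousLinearMap.snd ℝ (E d) (E m))) :=
    (ContinuousLinearMap.contDiff _).comp ha'
  rw [h1, iteratedFDeriv_add_apply contDiff_const.contDiffAt h2.contDiffAt,
    iteratedFDeriv_const_of_ne hj, Pi.zero_apply, zero_add,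
    ContinuousLinearMap.iteratedFDeriv_comp_left _ ha'.contDiffAt le_rfl,
    ContinuousLinearMap.iteratedFDeriv_comp_right _ ha _ le_rfl]
  rfl

theorem norm_comp_snd_le {X Y V W : Type*} [NormedAddCommGroup X] [NormedSpace ℝ X]
    [NormedAddCommGroup Y] [NormedSpace ℝ Y] [NormedAddCommGroup V] [NormedSpace ℝ V]
    [NormedAddCommGroup W] [NormedSpace ℝ W] (L : V →ₗᵢ[ℝ] W) {j : ℕ}
    (g : ContinuousMultilinearMap ℝ (fun _ : Fin j => Y) V) :
    ‖L.toContinuousLinearMap.compContinuousMultilinearMap (g.compContinuousLinearMap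
      fun _ => ContinuousLinearMap.snd ℝ X Y)‖ ≤ ‖g‖ := by
  rw [L.norm_compContinuousMultilinearMap]
  refine (g.norm_compContinuousLinearMap_le _).trans (mul_le_of_le_one_right (norm_nonneg _) ?_)
  exact Finset.prod_le_one (fun _ _ => norm_nonneg _)
    fun _ _ => ContinuousLinearMap.norm_snd_le ℝ X Y

/-- Only the unit vector `dir` has a norm of order one. A perturbation of width `r` and height `ε *
r ^ s` adds at most `ε` to each derivative and `2 * ε` to the Hölder seminorm, independently of `r`;
hence the total `7 / 4 + 1 / 4 = 2`. -/
theorem ChordFrame.inHolderBall_vel_comp {d m : ℕ} (F : ChordFrame d) {s : ℝ} (hs : 1 ≤ s)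
    {Ω : Set (E d)} {P : Set (E m)} (hΩ : IsOpen Ω) (hP : IsOpen P) {a : E m → E (d - 1)}
    (ha : ContDiff ℝ (⌊s⌋₊ + 1 : ℕ) a) {r ε : ℝ} (hr : 0 < r) (hr1 : r ≤ 1) (hε : 0 ≤ ε)
    (hε1 : ε ≤ 1 / 8)
    (hD : ∀ j ≤ ⌊s⌋₊ + 1, ∀ x, ‖iteratedFDeriv ℝ j a x‖ ≤ ε * r ^ s / r ^ j) {C : ℝ}
    (hC : 2 ≤ C) :
    InHolderBall s (ENNReal.ofReal C) (Ω ×ˢ P) (fun z => F.vel (a z.2)) := by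
  have hs0 : 0 ≤ s := by linarith
  have hfls : (⌊s⌋₊ : ℝ) ≤ s := Nat.floor_le hs0
  have hfr : s - ⌊s⌋₊ = Int.fract s := by
    rw [natCast_floor_eq_intCast_floor hs0, Int.self_sub_floor]
  have hfl0 : ⌊s⌋₊ ≠ 0 := (Nat.floor_pos.mpr hs).ne'
  have hopen : IsOpen (Ω ×ˢ P) := hΩ.prod hP
  have haj : ∀ j ≤ ⌊s⌋₊ + 1, ContDiff ℝ j a := fun j hj => ha.of_le (by exact_mod_cast hj)
  have hle : ∀ j ≤ ⌊s⌋₊, ∀ x, ‖iteratedFDeriv ℝ j a x‖ ≤ ε := by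
    intro j hj x
    refine (hD j (by omega) x).trans ?_
    rw [mul_div_assoc]
    refine mul_le_of_le_one_right hε ?_
    rw [div_le_one (by positivity), ← Real.rpow_natCast]
    exact Real.rpow_le_rpow_of_exponent_ge hr hr1 ((Nat.cast_le.mpr hj).trans hfls)
  have hcd : ContDiff ℝ (⌊s⌋₊ : ℕ) (fun z : E d × E m => F.vel (a z.2)) :=
    contDiff_const.add (F.emb.toContinuousLinearMap.contDiff.comp
      ((haj _ (Nat.le_succ _)).comp contDiff_snd))
  refine ⟨hcd.contDiffOn, ?_⟩
  have h2 : ENNReal.ofReal (7 / 4) + ENNReal.ofReal (1 / 4) ≤ ENNReal.ofReal C := by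
    rw [← ENNReal.ofReal_add (by norm_num) (by norm_num)]
    exact ENNReal.ofReal_le_ofReal (by linarith)
  refine le_trans (add_le_add ?_ ?_) h2
  · refine iSup₂_le fun j hj => iSup₂_le fun z hz => ?_
    have hj' : j ≤ ⌊s⌋₊ := Nat.lt_succ_iff.mp (Finset.mem_range.mp hj)
    rw [iteratedFDerivWithin_of_isOpen j hopen hz, ← ofReal_norm]
    apply ENNReal.ofReal_le_ofReal
    rcases eq_or_ne j 0 with rfl | hj0
    · rw [norm_iteratedFDeriv_zero]
      have h3 := hle 0 (Nat.zero_le _) z.2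
      rw [norm_iteratedFDeriv_zero] at h3
      have h4 : ‖F.vel (a z.2)‖ ≤ ‖F.dir‖ + ‖F.emb (a z.2)‖ := norm_add_le _ _
      rw [F.norm_dir, F.emb.norm_map] at h4
      linarith
    · rw [F.iteratedFDeriv_vel_comp (haj j (by omega)) hj0]
      refine (norm_comp_snd_le F.emb _).trans ((hle j hj' z.2).trans ?_)
      linarith
  · split_ifs with h0
    · exact zero_le
    have hθ : 0 < Int.fract s := (Int.fract_nonneg s).lt_of_ne' h0
    refine iSup₂_le fun y hy => iSup₂_le fun z hz => ?_
    rw [iteratedFDerivWithin_of_isOpen _ hopen hy, iteratedFDerivWithin_of_isOpen _ hopen hz]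
    rw [F.iteratedFDeriv_vel_comp (haj _ (Nat.le_succ _)) hfl0,
      F.iteratedFDeriv_vel_comp (haj _ (Nat.le_succ _)) hfl0]
    have hsub : ∀ g g' : ContinuousMultilinearMap ℝ (fun _ : Fin ⌊s⌋₊ => E m) (E (d - 1)),
        F.emb.toContinuousLinearMap.compContinuousMultilinearMap (g.compContinuousLinearMap
          fun _ => ContinuousLinearMap.snd ℝ (E d) (E m)) -
        F.emb.toContinuousLinearMap.compContinuousMultilinearMap (g'.compContinuousLinearMap
          fun _ => ContinuousLinearMap.snd ℝ (E d) (E m)) =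
        F.emb.toContinuousLinearMap.compContinuousMultilinearMap
          ((g - g').compContinuousLinearMap fun _ => ContinuousLinearMap.snd ℝ (E d) (E m)) := by
      intro g g'
      ext v
      simp
    rw [hsub]
    have h3 : ε * r ^ s / r ^ ⌊s⌋₊ = ε * r ^ Int.fract s := by
      rw [mul_div_assoc, ← hfr, Real.rpow_sub hr, Real.rpow_natCast]
    have h4 := norm_iteratedFDeriv_sub_le (j := ⌊s⌋₊) (B := ε * r ^ Int.fract s) ha hr
      (fun x => by rw [← h3]; exact hD _ (Nat.le_succ _) x)
      (fun x => by rw [← h3, div_div, ← pow_succ]; exact hD _ le_rfl x) y.2 z.2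
    have h5 : r ^ Int.fract s * min 1 (‖y.2 - z.2‖ / r) ≤ dist y z ^ Int.fract s := by
      have h6 : min 1 (‖y.2 - z.2‖ / r) ≤ (‖y.2 - z.2‖ / r) ^ Int.fract s := by
        have ht : 0 ≤ ‖y.2 - z.2‖ / r := by positivity
        rcases le_total 1 (‖y.2 - z.2‖ / r) with h | h
        · exact (min_le_left _ _).trans (Real.one_le_rpow h hθ.le)
        · refine (min_le_right _ _).trans ?_
          conv_lhs => rw [← Real.rpow_one (‖y.2 - z.2‖ / r)]
          exact Real.rpow_le_rpow_of_exponent_ge' ht h hθ.le (Int.fract_lt_one s).le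
      calc r ^ Int.fract s * min 1 (‖y.2 - z.2‖ / r)
          ≤ r ^ Int.fract s * (‖y.2 - z.2‖ / r) ^ Int.fract s := by gcongr
        _ = ‖y.2 - z.2‖ ^ Int.fract s := by
          rw [← Real.mul_rpow hr.le (by positivity), mul_div_cancel₀ _ hr.ne']
        _ ≤ dist y z ^ Int.fract s := by
          rw [← dist_eq_norm]
          gcongr
          exact le_max_right _ _
    apply ENNReal.div_le_of_le_mul
    rw [← ofReal_norm, edist_dist, ENNReal.ofReal_rpow_of_nonneg dist_nonneg hθ.le,
      ← ENNReal.ofReal_mul (by norm_num)]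
    apply ENNReal.ofReal_le_ofReal
    refine (norm_comp_snd_le F.emb _).trans (h4.trans ?_)
    have h7 : 2 * (ε * r ^ Int.fract s) * min 1 (‖y.2 - z.2‖ / r) ≤
        2 * ε * dist y z ^ Int.fract s := by
      have := mul_le_mul_of_nonneg_left h5 (by positivity : 0 ≤ 2 * ε)
      linarith
    refine h7.trans ?_
    gcongr
    linarith

/-! ### Metric entropy -/

/-- A ball of radius less than `η / 2` contains at most one of the points `f σ`, and there are more
than `2 ^ n` of them. -/
theorem div_two_le_entropyNumber {Z ι : Type*} [PseudoEMetricSpace Z] [Fintype ι] {n : ℕ}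
    (hn : n < Fintype.card ι) {K : Set Z} {η : ℝ≥0∞} (f : Finset ι → Z) (hf : ∀ σ, f σ ∈ K)
    (hη : ∀ σ τ, σ ≠ τ → η ≤ edist (f σ) (f τ)) : η / 2 ≤ entropyNumber n K := by
  refine le_iInf₂ fun ε hε => ?_
  by_contra hlt
  push Not at hlt
  have h2 : ((2 * ε : ℝ≥0) : ℝ≥0∞) < η := by
    rw [ENNReal.lt_div_iff_mul_lt (by simp) (by simp)] at hlt
    rwa [ENNReal.coe_mul, mul_comm]
  have hsep : ∀ σ τ, σ ≠ τ → ((2 * ε : ℝ≥0) : ℝ≥0∞) < edist (f σ) (f τ) :=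
    fun σ τ h => h2.trans_le (hη σ τ h)
  have hinj : Function.Injective f := by
    intro σ τ h
    by_contra hne
    have := hsep σ τ hne
    rw [h, edist_self] at this
    exact absurd this (by simp)
  have hS : Metric.IsSeparated ((2 * ε : ℝ≥0) : ℝ≥0∞) (range f) := by
    rintro _ ⟨σ, rfl⟩ _ ⟨τ, rfl⟩ hne
    exact hsep σ τ fun h => hne (by rw [h])
  have h3 := ((Metric.IsSeparated.encard_le_packingNumber (range_subset_iff.mpr hf) hS).trans
    (Metric.packingNumber_two_mul_le_externalCoveringNumber ε K)).trans hε
  have h4 : (range f).encard = 2 ^ Fintype.card ι := by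
    rw [← image_univ, hinj.encard_image, encard_univ, ENat.card_eq_coe_fintype_card,
      Fintype.card_finset]
    norm_cast
  rw [h4] at h3
  have h5 : 2 ^ Fintype.card ι ≤ 2 ^ n := by exact_mod_cast h3
  exact absurd ((Nat.pow_le_pow_iff_right (by norm_num)).mp h5) (by omega)

/-- A strict inequality between continuous functions at one point of the open set `P` persists on an
open set, which has positive measure. -/
theorem ofReal_abs_sub_le_edist {m : ℕ} {P : Set (E m)} (hP : IsOpen P)
    {q q' : Lp ℝ ∞ ((volume : Measure (E m)).restrict P)} {f f' : E m → ℝ}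
    (hf : ContinuousOn f P) (hf' : ContinuousOn f' P) (hq : q =ᵐ[volume.restrict P] f)
    (hq' : q' =ᵐ[volume.restrict P] f') {μ : E m} (hμ : μ ∈ P) :
    ENNReal.ofReal |f μ - f' μ| ≤ edist q q' := by
  by_contra hlt
  push Not at hlt
  have hlt' : edist q q' < ‖f μ - f' μ‖ₑ := by rwa [← ofReal_norm, Real.norm_eq_abs]
  have hae : ∀ᵐ x ∂volume.restrict P, ‖f x - f' x‖ₑ ≤ edist q q' := by
    rw [Lp.edist_def, eLpNorm_exponent_top]
    filter_upwards [enorm_ae_le_eLpNormEssSup (⇑q - ⇑q') (volume.restrict P), hq, hq']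
      with x h1 h2 h3
    rw [← h2, ← h3]
    exact h1
  have hopen : IsOpen (P ∩ (fun x => ‖f x - f' x‖ₑ) ⁻¹' Ioi (edist q q')) :=
    (hf.sub hf').enorm.isOpen_inter_preimage hP isOpen_Ioi
  have hpos := hopen.measure_pos volume ⟨μ, hμ, hlt'⟩
  rw [ae_restrict_iff' hP.measurableSet] at hae
  refine hpos.ne' (measure_mono_null ?_ hae)
  intro x hx h
  exact (h hx.1).not_gt hx.2

/-- A lower bound for the entropy numbers of a set that contains, for each `K`, a cube of `2 ^ N`
points, `N = K ^ M`, with distances at least a constant times `K ^ (-γ)`. -/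
theorem exists_le_entropyNumber {Z : Type*} [PseudoEMetricSpace Z] {S : Set Z} {M : ℕ}
    (hM : 1 ≤ M) {γ c : ℝ} (hγ : 0 ≤ γ) (hc : 0 < c)
    (H : ∀ K : ℕ, 1 ≤ K → ∃ f : Finset (Fin M → Fin K) → Z, (∀ σ, f σ ∈ S) ∧
      ∀ σ τ, σ ≠ τ → ENNReal.ofReal (c * (K : ℝ) ^ (-γ)) ≤ edist (f σ) (f τ)) :
    ∃ c' : ℝ, 0 < c' ∧ ∀ n : ℕ, 1 ≤ n →
      ENNReal.ofReal (c' * (n : ℝ) ^ (-(γ / M))) ≤ entropyNumber n S := by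
  have hM0 : (0 : ℝ) < M := by exact_mod_cast hM
  refine ⟨c * 2 ^ (-γ) / 2, by positivity, fun n hn => ?_⟩
  have hn1 : (1 : ℝ) ≤ n := by exact_mod_cast hn
  set x : ℝ := (n : ℝ) ^ ((M : ℝ)⁻¹) with hx
  have hx1 : 1 ≤ x := Real.one_le_rpow hn1 (by positivity)
  -- With `x = n ^ (1 / M)`, this grid has more than `n` points, while its size per direction is at
  -- most `2 * x`.
  obtain ⟨f, hfS, hf⟩ := H (⌊x⌋₊ + 1) (by omega)
  have hcard : n < Fintype.card (Fin M → Fin (⌊x⌋₊ + 1)) := by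
    rw [Fintype.card_fun, Fintype.card_fin, Fintype.card_fin]
    have h1 : x < ⌊x⌋₊ + 1 := Nat.lt_floor_add_one x
    have h2 : (n : ℝ) = x ^ M := by
      rw [hx, ← Real.rpow_natCast, ← Real.rpow_mul (by positivity), inv_mul_cancel₀ hM0.ne',
        Real.rpow_one]
    have h3 : x ^ M < ((⌊x⌋₊ : ℝ) + 1) ^ M := pow_lt_pow_left₀ h1 (by positivity) (by omega)
    rw [← h2] at h3
    exact_mod_cast h3
  refine le_trans ?_ (div_two_le_entropyNumber hcard f hfS hf)
  have h4 : ENNReal.ofReal (c * ((⌊x⌋₊ + 1 : ℕ) : ℝ) ^ (-γ)) / 2 =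
      ENNReal.ofReal (c * ((⌊x⌋₊ + 1 : ℕ) : ℝ) ^ (-γ) / 2) := by
    rw [ENNReal.ofReal_div_of_pos (by norm_num), ENNReal.ofReal_ofNat]
  rw [h4]
  apply ENNReal.ofReal_le_ofReal
  have h5 : ((⌊x⌋₊ + 1 : ℕ) : ℝ) ≤ 2 * x := by
    push_cast
    linarith [Nat.floor_le (by positivity : 0 ≤ x)]
  have h6 : (2 * x) ^ (-γ) ≤ ((⌊x⌋₊ + 1 : ℕ) : ℝ) ^ (-γ) :=
    Real.rpow_le_rpow_of_nonpos (by positivity) h5 (by linarith)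
  have h7 : (2 * x) ^ (-γ) = 2 ^ (-γ) * (n : ℝ) ^ (-(γ / M)) := by
    rw [Real.mul_rpow (by norm_num) (by positivity), hx, ← Real.rpow_mul (by positivity)]
    congr 2
    field_simp
  rw [h7] at h6
  have := mul_le_mul_of_nonneg_left h6 hc.le
  linarith

/-! ### Quantities of interest with prescribed values -/

namespace TubeFamily

variable {d k : ℕ} {Ω : Set (E d)} (T : TubeFamily Ω)

/-- There are data such that the quantity of interest is large at the parameters at which the
inflow point of the characteristic through the base point is in `J`, and vanishes at the parameters
at which it is far from `J`. -/
theorem exists_mem_qoiClass (hd : 2 ≤ d) (hk : 1 ≤ k) (hΩ : IsOpen Ω)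
    (hΩb : Bornology.IsBounded Ω) (A : BoundaryAtlas k Ω) {sb : ℝ} (hsb : 1 ≤ sb) {m : ℕ}
    {P : Set (E m)} (hP : IsOpen P) {sm sp : ℝ} (hsm : 0 < sm) (hsmk : sm ≤ k) (hsp : 0 < sp)
    (hspk : sp ≤ k) {p : ℝ≥0∞} (hp : 1 ≤ p) {Cb : ℝ} (hCb : 2 ≤ Cb) :
    ∃ c > 0, ∃ Λ > 0, ∃ h₀ > 0, ∃ ε > 0,
      ∀ (a : E m → E (d - 1)) (r h : ℝ) (J : Finset (E d)), ContDiff ℝ (⌊sb⌋₊ + 1 : ℕ) a →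
        0 < r → r ≤ 1 → (∀ j ≤ ⌊sb⌋₊ + 1, ∀ μ, ‖iteratedFDeriv ℝ j a μ‖ ≤ ε * r ^ sb / r ^ j) →
        0 < h → h ≤ h₀ → (∀ z ∈ J, ∀ z' ∈ J, z ≠ z' → Λ * h ≤ ‖z - z'‖) →
        (∀ μ, ‖a μ‖ < T.ρ) ∧ ∃ q ∈ qoiClass A sm sp sb p Cb P, ∃ q₀ : E m → ℝ,
          ContinuousOn q₀ P ∧ q =ᵐ[volume.restrict P] q₀ ∧
          (∀ μ, T.entry (a μ) 0 ∈ J → c * h ^ (sm + sp + ((d : ℝ) - 1)) ≤ q₀ μ) ∧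
          ∀ μ, (∀ z ∈ J, Λ * h ≤ ‖z - T.entry (a μ) 0‖) → q₀ μ = 0 := by
  obtain ⟨c, hc, hcq⟩ := T.exists_le_qoi
  obtain ⟨κm, hκm, hAm⟩ := A.exists_amplitude hd hsm hsmk hp
  obtain ⟨κp, hκp, hAp⟩ := A.exists_amplitude hd hsp hspk (p := ∞) le_top
  obtain ⟨B, hB1, hB⟩ := exists_bumpSum_bound d 0
  have hρ := T.ρ_pos
  have hM := T.M_nonneg
  have hr₀ := r₀_pos (T := T)
  have hd1 : 1 ≤ d := by omega
  -- In `Λ`, the term `4 * (1 + 2 * T.M)` covers the entry points of all lines through the support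
  -- of `gp`, of radius `2 * h`; the summand `5` separates the bumps. In `ε`, the bound `1 / 8`
  -- serves the Hölder norm and `T.ρ / 2` keeps the directions in the tube family.
  refine ⟨c * (κp * κm), by positivity, 4 * (1 + 2 * T.M) + 5, by positivity,
    min 1 (T.r₀ / 2), by positivity, min (1 / 8) (T.ρ / 2), by positivity,
    fun a r h J ha hr hr1 hD hh hhh₀ hJ => ?_⟩
  have hh1 : h ≤ 1 := hhh₀.trans (min_le_left _ _)
  have h2h : 2 * h ≤ T.r₀ := by linarith [hhh₀.trans (min_le_right _ _)]
  have ha2 : ∀ μ, ‖a μ‖ ≤ T.ρ / 2 := by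
    intro μ
    have h1 := hD 0 (Nat.zero_le _) μ
    rw [norm_iteratedFDeriv_zero, pow_zero, div_one] at h1
    have h2 : r ^ sb ≤ 1 := Real.rpow_le_one hr.le hr1 (by linarith)
    have h3 : min (1 / 8) (T.ρ / 2) * r ^ sb ≤ min (1 / 8) (T.ρ / 2) :=
      mul_le_of_le_one_right (by positivity) h2
    exact h1.trans (h3.trans (min_le_right _ _))
  have haρ : ∀ μ, ‖a μ‖ < T.ρ := fun μ => (ha2 μ).trans_lt (by linarith)
  refine ⟨haρ, ?_⟩
  have hJ5 : ∀ z ∈ J, ∀ z' ∈ J, z ≠ z' → 5 * h ≤ ‖z - z'‖ := fun z hz z' hz' hne =>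
    (mul_le_mul_of_nonneg_right (by linarith) hh.le).trans (hJ z hz z' hz' hne)
  -- Bumps of size `h` in the unit balls may have heights `h ^ sm` and `h ^ sp` up to constants;
  -- their product is the part `sm + sp` of the exponent.
  set gm : E d → ℝ := fun x => κm * h ^ sm * bumpSum J h x with hgm
  set gp : E d → ℝ := fun x => κp * h ^ sp * bumpSum {T.base} h x with hgp
  have hgmc : Continuous gm := continuous_const.mul (contDiff_bumpSum J h (k := 0)).continuous
  have hgpc : Continuous gp := continuous_const.mul (contDiff_bumpSum _ h (k := 0)).continuous
  have hgm0 : ∀ x, 0 ≤ gm x := fun x => mul_nonneg (by positivity) (bumpSum_nonneg J h x)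
  have hgp0 : ∀ x, 0 ≤ gp x := fun x => mul_nonneg (by positivity) (bumpSum_nonneg _ h x)
  have hgmC : ∀ x, ‖gm x‖ ≤ κm * h ^ sm * B := by
    intro x
    have h1 := hB J h hh hJ5 0 le_rfl x
    rw [norm_iteratedFDeriv_zero, pow_zero, div_one] at h1
    rw [hgm, norm_mul, Real.norm_of_nonneg (by positivity : 0 ≤ κm * h ^ sm)]
    gcongr
  have hgms : A.sobolevNorm sm p gm ≤ 1 := hAm J h hh hh1 hJ5
  have hgps : A.sobolevNorm sp ∞ gp ≤ 1 := by
    refine hAp {T.base} h hh hh1 fun z hz z' hz' hne => absurd ?_ hne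
    rw [Finset.mem_singleton.mp hz, Finset.mem_singleton.mp hz']
  have hsupp2 : Function.support gp ⊆ Metric.closedBall T.base (2 * h) := by
    intro x hx
    by_contra hxb
    rw [mem_closedBall_iff_norm] at hxb
    push Not at hxb
    refine hx ?_
    have : bumpSum {T.base} h x = 0 := by
      refine bumpSum_eq_zero hh fun z hz => ?_
      rw [Finset.mem_singleton.mp hz]
      exact hxb.le
    rw [hgp]
    simp only [this, mul_zero]
  have hsupp : Function.support gp ⊆ Metric.closedBall T.base T.r₀ :=
    hsupp2.trans (Metric.closedBall_subset_closedBall h2h)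
  have hcont := continuousOn_qoi hgmc hgmC hgpc hsupp
  have hac : Continuous a := ha.continuous
  have hq₀c : Continuous fun μ => T.qoi gm gp (a μ) :=
    hcont.comp_continuous hac fun μ => by simpa using haρ μ
  -- The directions stay in a compact ball, so the quantity of interest is bounded even if `P` is
  -- unbounded.
  obtain ⟨Cq, hCq⟩ := (isCompact_closedBall (0 : E (d - 1)) (T.ρ / 2)).exists_bound_of_continuousOn
    (hcont.mono (Metric.closedBall_subset_ball (by linarith)))
  have hmem : MemLp (fun μ => T.qoi gm gp (a μ)) ∞ (volume.restrict P) :=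
    memLp_top_of_bound hq₀c.aestronglyMeasurable Cq
      (Eventually.of_forall fun μ => hCq _ (by simpa using ha2 μ))
  refine ⟨hmem.toLp, ?_, fun μ => T.qoi gm gp (a μ), hq₀c.continuousOn, hmem.coeFn_toLp, ?_, ?_⟩
  · refine ⟨gm, gp, fun z => T.vel (a z.2), ⟨hgms, hgps, ?_, ?_, ?_⟩, fun μ => T.qoi gm gp (a μ),
      fun μ _ => ?_, hmem.coeFn_toLp⟩
    · exact T.inHolderBall_vel_comp hsb hΩ hP ha hr hr1 (by positivity) (min_le_left _ _) hD hCb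
    · have : Continuous fun z : E d × E m => T.vel (a z.2) :=
        continuous_const.add (T.emb.continuous.comp (hac.comp continuous_snd))
      exact this.continuousOn
    · exact fun μ _ => ⟨T.tube (a μ), isSolvabilityDomain hd1 hk hΩ hΩb A sm p hsupp (haρ μ)⟩
    · exact isQuantityOfInterest hd1 hk hΩ hΩb A hgmc hgmC (hgms.trans_lt ENNReal.one_lt_top)
        hgpc hsupp (haρ μ)
  · intro μ hμ
    have h1 := hcq gm gp (a μ) h (κm * h ^ sm) (κp * h ^ sp) _ (haρ μ) hh (by linarith)
      (by positivity) (by positivity) hgmc hgpc hgmC hsupp hgm0 hgp0 (fun x hx => ?_)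
      (fun x hx => ?_)
    · refine le_trans (le_of_eq ?_) h1
      rw [Real.rpow_add hh, Real.rpow_add hh]
      have h2 : h ^ ((d : ℝ) - 1) = h ^ (d - 1) := by
        rw [← Real.rpow_natCast, Nat.cast_sub hd1, Nat.cast_one]
      rw [h2]
      ring
    · exact le_mul_of_one_le_right (by positivity) (one_le_bumpSum hh (Finset.mem_singleton_self _)
        (mem_closedBall_iff_norm.mp hx))
    · exact le_mul_of_one_le_right (by positivity)
        (one_le_bumpSum hh hμ (mem_closedBall_iff_norm.mp hx))
  · intro μ hμ
    refine qoi_eq_zero h2h hsupp2 (haρ μ) fun z hz => ?_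
    have : bumpSum J h z = 0 := by
      refine bumpSum_eq_zero hh fun w hw => ?_
      have h1 := hμ w hw
      have h2 := norm_sub_le_norm_sub_add_norm_sub w z (T.entry (a μ) 0)
      rw [norm_sub_rev w z] at h2
      nlinarith
    rw [hgm]
    simp only [this, mul_zero]

end TubeFamily

/-! ### Grids of parameters -/

/-- The points with integer coordinates in a coordinate subspace of dimension `M`. -/
def gridPoint (n : ℕ) {M K : ℕ} (α : Fin M → Fin K) : E n :=
  WithLp.toLp 2 fun i => if h : i.1 < M then ((α ⟨i.1, h⟩ : ℕ) : ℝ) else 0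

theorem one_le_norm_gridPoint_sub {n M K : ℕ} (hM : M ≤ n) {α β : Fin M → Fin K} (h : α ≠ β) :
    1 ≤ ‖gridPoint n α - gridPoint n β‖ := by
  obtain ⟨i, hi⟩ := Function.ne_iff.mp h
  have h1 := PiLp.norm_apply_le (gridPoint n α - gridPoint n β) ⟨i.1, i.2.trans_le hM⟩
  refine le_trans ?_ h1
  have h2 : (gridPoint n α - gridPoint n β) ⟨i.1, i.2.trans_le hM⟩ =
      ((((α i : ℕ) : ℤ) - ((β i : ℕ) : ℤ) : ℤ) : ℝ) := by
    simp [gridPoint]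
  rw [h2, Real.norm_eq_abs, ← Int.cast_abs]
  have h3 : ((α i : ℕ) : ℤ) - ((β i : ℕ) : ℤ) ≠ 0 := by
    intro h0
    apply hi
    ext
    omega
  exact_mod_cast Int.one_le_abs h3

theorem norm_gridPoint_le {n M K : ℕ} (α : Fin M → Fin K) :
    ‖gridPoint n α‖ ≤ (n + 1) * K := by
  refine abs_le_of_sq_le_sq' ?_ (by positivity) |>.2
  rw [EuclideanSpace.norm_sq_eq]
  have h1 : ∀ i ∈ (Finset.univ : Finset (Fin n)), ‖gridPoint n α i‖ ^ 2 ≤ (K : ℝ) ^ 2 := by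
    intro i _
    gcongr
    simp only [gridPoint]
    split_ifs with h
    · rw [Real.norm_of_nonneg (by positivity)]
      exact_mod_cast (α ⟨i.1, h⟩).2.le
    · simp
  refine (Finset.sum_le_card_nsmul _ _ _ h1).trans ?_
  rw [Finset.card_univ, Fintype.card_fin, nsmul_eq_mul, mul_pow]
  gcongr
  nlinarith [(Nat.cast_nonneg n : (0 : ℝ) ≤ n)]

/-- The linear map that keeps the first `M` coordinates. -/
def coordMap (m n M : ℕ) : E m →L[ℝ] E n :=
  LinearMap.toContinuousLinearMap
    { toFun := fun x => WithLp.toLp 2 fun i => if h : i.1 < M ∧ i.1 < m then x ⟨i.1, h.2⟩ else 0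
      map_add' := fun x y => by
        ext i
        simp only [PiLp.add_apply]
        split_ifs <;> simp
      map_smul' := fun c x => by
        ext i
        simp only [PiLp.smul_apply]
        split_ifs <;> simp }

theorem coordMap_gridPoint {m n M K : ℕ} (hM : M ≤ m) (α : Fin M → Fin K) :
    coordMap m n M (gridPoint m α) = gridPoint n α := by
  ext i
  change (if h : i.1 < M ∧ i.1 < m then gridPoint m α ⟨i.1, h.2⟩ else 0) = gridPoint n α i
  simp only [gridPoint]
  by_cases h : i.1 < M
  · have h' : i.1 < M ∧ i.1 < m := ⟨h, by omega⟩
    simp [h, h']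
  · simp [h]

/-- A family of functions, indexed by sets of parameters in a grid, which are large at the
parameters in the set and vanish at the other ones. -/
theorem ofReal_le_edist_of_indicator {m : ℕ} {ι : Type*} {P : Set (E m)} (hP : IsOpen P)
    {x : ι → E m} (hx : ∀ α, x α ∈ P) {η : ℝ} {σ τ : Finset ι} (hne : σ ≠ τ)
    {q q' : Lp ℝ ∞ ((volume : Measure (E m)).restrict P)} {f f' : E m → ℝ}
    (hf : ContinuousOn f P) (hf' : ContinuousOn f' P) (hq : q =ᵐ[volume.restrict P] f)
    (hq' : q' =ᵐ[volume.restrict P] f') (h1 : ∀ α ∈ σ, η ≤ f (x α)) (h0 : ∀ α ∉ σ, f (x α) = 0)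
    (h1' : ∀ α ∈ τ, η ≤ f' (x α)) (h0' : ∀ α ∉ τ, f' (x α) = 0) :
    ENNReal.ofReal η ≤ edist q q' := by
  have hex : ∃ α, ¬(α ∈ σ ↔ α ∈ τ) := by
    by_contra h
    push Not at h
    exact hne (Finset.ext h)
  obtain ⟨α, hα⟩ := hex
  refine le_trans (ENNReal.ofReal_le_ofReal ?_) (ofReal_abs_sub_le_edist hP hf hf' hq hq' (hx α))
  by_cases hσ : α ∈ σ
  · have hτ : α ∉ τ := fun h => hα ⟨fun _ => h, fun _ => hσ⟩
    rw [h0' α hτ, sub_zero]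
    exact (h1 α hσ).trans (le_abs_self _)
  · have hτ : α ∈ τ := by
      by_contra h
      exact hα ⟨fun h' => absurd h' hσ, fun h' => absurd h' h⟩
    rw [h0 α hσ, zero_sub, abs_neg]
    exact (h1' α hτ).trans (le_abs_self _)

namespace TubeFamily

variable {d k : ℕ} {Ω : Set (E d)}

/-- The lower bound that comes from the inflow data: the flow directions at the parameters of a
fixed flow field connect the base point with different points of the inflow boundary. -/
theorem exists_le_entropyNumber_of_data (T : TubeFamily Ω) (hd : 3 ≤ d) (hk : 1 ≤ k)
    (hΩ : IsOpen Ω) (hΩb : Bornology.IsBounded Ω) (A : BoundaryAtlas k Ω) {sb : ℝ} (hsb : 1 ≤ sb)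
    {m : ℕ} (hm : d ≤ m + 2) {P : Set (E m)} (hP : IsOpen P) (hPne : P.Nonempty) {sm sp : ℝ} (hsm : 0 < sm)
    (hsmk : sm ≤ k) (hsp : 0 < sp) (hspk : sp ≤ k) {p : ℝ≥0∞} (hp : 1 ≤ p) {Cb : ℝ}
    (hCb : 2 ≤ Cb) :
    ∃ c : ℝ, 0 < c ∧ ∀ n : ℕ, 1 ≤ n →
      ENNReal.ofReal (c * (n : ℝ) ^ (-((sm + sp + ((d : ℝ) - 1)) / ((d : ℝ) - 2)))) ≤
        entropyNumber n (qoiClass A sm sp sb p Cb P) := by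
  classical
  obtain ⟨c, hc, Λ, hΛ, h₀, hh₀, ε, hε, H⟩ := T.exists_mem_qoiClass (by omega) hk hΩ hΩb A hsb hP
    hsm hsmk hsp hspk hp hCb
  obtain ⟨μ₀, hμ₀⟩ := hPne
  obtain ⟨R, hR, hRP⟩ := Metric.nhds_basis_closedBall.mem_iff.mp (hP.mem_nhds hμ₀)
  set L := coordMap m (d - 1) (d - 2) with hL
  -- A linear dependence on `d - 2` parameters, cut off to have bounded derivatives; it is exactly
  -- linear on the ball containing the grid. The scale of this field is `r = 1`.
  set a₀ : E m → E (d - 1) := fun μ => bumpSum {μ₀} R μ • L (μ - μ₀) with ha₀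
  have ha₀cd : ContDiff ℝ (⌊sb⌋₊ + 1 : ℕ) a₀ :=
    (contDiff_bumpSum _ R).smul (L.contDiff.comp (contDiff_id.sub contDiff_const))
  have ha₀c : HasCompactSupport a₀ := by
    refine HasCompactSupport.intro (isCompact_closedBall μ₀ (2 * R)) fun μ hμ => ?_
    have : bumpSum {μ₀} R μ = 0 := by
      refine bumpSum_eq_zero hR fun z hz => ?_
      rw [Finset.mem_singleton.mp hz]
      rw [mem_closedBall_iff_norm] at hμ
      push Not at hμ
      exact hμ.le
    simp only [ha₀, this, zero_smul]
  obtain ⟨B, hB1, hB⟩ := exists_iteratedFDeriv_bound ha₀cd ha₀c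
  have hB0 : 0 < B := by linarith
  set κ := ε / B with hκ
  have hκ0 : 0 < κ := by positivity
  set a : E m → E (d - 1) := fun μ => κ • a₀ μ with ha
  have hacd : ContDiff ℝ (⌊sb⌋₊ + 1 : ℕ) a := ha₀cd.const_smul κ
  have haD : ∀ j ≤ ⌊sb⌋₊ + 1, ∀ μ, ‖iteratedFDeriv ℝ j a μ‖ ≤ ε * 1 ^ sb / 1 ^ j := by
    intro j hj μ
    rw [ha, iteratedFDeriv_const_smul_apply' (ha₀cd.of_le (by exact_mod_cast hj)).contDiffAt,
      norm_smul, Real.norm_of_nonneg hκ0.le, Real.one_rpow, one_pow, div_one, mul_one, hκ,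
      div_mul_eq_mul_div, div_le_iff₀ hB0]
    exact mul_le_mul_of_nonneg_left (hB j hj μ) hε.le
  -- With mesh size `s / K` the grid fits into the ball of radius `R` by `norm_gridPoint_le`.
  set s := R / (m + 1) with hs
  have hs0 : 0 < s := by positivity
  -- Neighbouring grid directions differ by `κ * s / K`, which moves the entry point by at least
  -- `T.ℓ / 2` times as much. Bumps of size `τ / K` are small enough to resolve this.
  set τ := min h₀ (T.ℓ / 2 * (κ * s) / Λ) with hτ
  have hℓ := T.ℓ_pos
  have hτ0 : 0 < τ := by positivity
  set S := sm + sp + ((d : ℝ) - 1) with hS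
  have hd3 : (3 : ℝ) ≤ d := by exact_mod_cast hd
  have hS0 : 0 ≤ S := by rw [hS]; linarith
  have hM2 : ((d - 2 : ℕ) : ℝ) = (d : ℝ) - 2 := by
    rw [Nat.cast_sub (by omega)]; norm_num
  rw [← hM2]
  refine exists_le_entropyNumber (M := d - 2) (by omega) hS0 (c := c * τ ^ S) (by positivity)
    fun K hK => ?_
  have hK0 : (0 : ℝ) < K := by exact_mod_cast hK
  have hK1 : (1 : ℝ) ≤ K := by exact_mod_cast hK
  set x : (Fin (d - 2) → Fin K) → E m := fun α => μ₀ + (s / K) • gridPoint m α with hx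
  have hxR : ∀ α, ‖x α - μ₀‖ ≤ R := by
    intro α
    rw [hx, add_sub_cancel_left, norm_smul, Real.norm_of_nonneg (by positivity)]
    refine (mul_le_mul_of_nonneg_left (norm_gridPoint_le α) (by positivity)).trans (le_of_eq ?_)
    rw [hs]
    field_simp
  have hxP : ∀ α, x α ∈ P := fun α => hRP (mem_closedBall_iff_norm.mpr (hxR α))
  have hax : ∀ α, a (x α) = (κ * (s / K)) • gridPoint (d - 1) α := by
    intro α
    have h1 : bumpSum {μ₀} R (x α) = 1 := by
      have h2 := one_le_bumpSum hR (Finset.mem_singleton_self μ₀) (hxR α)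
      have h3 : bumpSum {μ₀} R (x α) ≤ 1 := by
        rw [bumpSum, Finset.sum_singleton]
        exact (unitBump m).le_one
      exact le_antisymm h3 h2
    simp only [ha, ha₀, h1, one_smul]
    rw [hx, add_sub_cancel_left, map_smul, hL, coordMap_gridPoint (by omega), smul_smul]
  set h := τ / K with hh
  have hh0 : 0 < h := by positivity
  have hhh₀ : h ≤ h₀ := (div_le_self hτ0.le hK1).trans (min_le_left _ _)
  have haρ : ∀ μ, ‖a μ‖ < T.ρ :=
    (H a 1 h ∅ hacd one_pos le_rfl haD hh0 hhh₀ (by simp)).1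
  have hsep : ∀ α β, α ≠ β → Λ * h ≤ ‖T.entry (a (x α)) 0 - T.entry (a (x β)) 0‖ := by
    intro α β hne
    refine le_trans ?_ (le_norm_entry_sub (haρ _) (haρ _))
    rw [hax, hax, ← smul_sub, norm_smul, Real.norm_of_nonneg (by positivity)]
    have h1 := one_le_norm_gridPoint_sub (n := d - 1) (by omega) hne
    have h2 : Λ * τ ≤ T.ℓ / 2 * (κ * s) := by
      have := min_le_right h₀ (T.ℓ / 2 * (κ * s) / Λ)
      rw [← hτ, le_div_iff₀ hΛ] at this
      linarith
    calc Λ * h = Λ * τ / K := by rw [hh]; ring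
      _ ≤ T.ℓ / 2 * (κ * s) / K := by gcongr
      _ = T.ℓ / 2 * (κ * (s / K) * 1) := by ring
      _ ≤ _ := by gcongr
  have hfam : ∀ σ : Finset (Fin (d - 2) → Fin K), ∃ q ∈ qoiClass A sm sp sb p Cb P,
      ∃ q₀ : E m → ℝ, ContinuousOn q₀ P ∧ q =ᵐ[volume.restrict P] q₀ ∧
        (∀ α ∈ σ, c * h ^ S ≤ q₀ (x α)) ∧ ∀ α ∉ σ, q₀ (x α) = 0 := by
    intro σ
    -- The set `σ` is encoded in the inflow data only, by bumps at the entry points belonging to its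
    -- parameters.
    obtain ⟨-, q, hq, q₀, hq₀c, hqq₀, hq1, hq0⟩ := H a 1 h
      (σ.image fun α => T.entry (a (x α)) 0) hacd one_pos le_rfl haD hh0 hhh₀ (by
        intro z hz z' hz' hne
        obtain ⟨α, _, rfl⟩ := Finset.mem_image.mp hz
        obtain ⟨β, _, rfl⟩ := Finset.mem_image.mp hz'
        exact hsep α β fun h => hne (by rw [h]))
    refine ⟨q, hq, q₀, hq₀c, hqq₀, fun α hα => hq1 _ (Finset.mem_image_of_mem _ hα),
      fun α hα => hq0 _ fun z hz => ?_⟩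
    obtain ⟨β, hβ, rfl⟩ := Finset.mem_image.mp hz
    exact hsep β α fun h => hα (h ▸ hβ)
  choose q hq q₀ hq₀c hqq₀ hq1 hq0 using hfam
  refine ⟨q, hq, fun σ σ' hne => ?_⟩
  have hval : c * τ ^ S * (K : ℝ) ^ (-S) = c * h ^ S := by
    rw [hh, Real.div_rpow hτ0.le hK0.le, Real.rpow_neg hK0.le]
    ring
  rw [hval]
  exact ofReal_le_edist_of_indicator hP hxP hne (hq₀c σ) (hq₀c σ') (hqq₀ σ) (hqq₀ σ') (hq1 σ)
    (hq0 σ) (hq1 σ') (hq0 σ')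

/-- The lower bound that comes from the flow fields: the flow field can be perturbed independently
at the points of a grid of parameters. -/
theorem exists_le_entropyNumber_of_field (T : TubeFamily Ω) (hd : 2 ≤ d) (hk : 1 ≤ k)
    (hΩ : IsOpen Ω) (hΩb : Bornology.IsBounded Ω) (A : BoundaryAtlas k Ω) {sb : ℝ} (hsb : 1 ≤ sb)
    {m D : ℕ} (hD : 1 ≤ D) (hm : D ≤ m) {P : Set (E m)} (hP : IsOpen P) (hPne : P.Nonempty) {sm sp : ℝ}
    (hsm : 0 < sm) (hsmk : sm ≤ k) (hsp : 0 < sp) (hspk : sp ≤ k) {p : ℝ≥0∞} (hp : 1 ≤ p)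
    {Cb : ℝ} (hCb : 2 ≤ Cb) :
    ∃ c : ℝ, 0 < c ∧ ∀ n : ℕ, 1 ≤ n →
      ENNReal.ofReal (c * (n : ℝ) ^ (-((sm + sp + ((d : ℝ) - 1)) / ((D : ℝ) / sb)))) ≤
        entropyNumber n (qoiClass A sm sp sb p Cb P) := by
  classical
  obtain ⟨c, hc, Λ, hΛ, h₀, hh₀, ε, hε, H⟩ := T.exists_mem_qoiClass hd hk hΩ hΩb A hsb hP
    hsm hsmk hsp hspk hp hCb
  obtain ⟨μ₀, hμ₀⟩ := hPne
  obtain ⟨R, hR, hRP⟩ := Metric.nhds_basis_closedBall.mem_iff.mp (hP.mem_nhds hμ₀)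
  obtain ⟨B, hB1, hB⟩ := exists_bumpSum_bound m (⌊sb⌋₊ + 1)
  have hB0 : 0 < B := by linarith
  set κ := ε / B with hκ
  have hκ0 : 0 < κ := by positivity
  obtain ⟨e, he⟩ : ∃ e : E (d - 1), ‖e‖ = 1 :=
    ⟨EuclideanSpace.single ⟨0, by omega⟩ 1, by simp⟩
  set s := R / (m + 1) with hs
  have hs0 : 0 < s := by positivity
  -- Parameter bumps of radius `ρ / K` are separated by five radii on a grid of mesh size `s / K`.
  set ρ := min 1 (s / 5) with hρ
  have hρ0 : 0 < ρ := by positivity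
  have hρ5 : 5 * ρ ≤ s := by linarith [min_le_right 1 (s / 5)]
  have hℓ := T.ℓ_pos
  set τ := min h₀ (T.ℓ / 2 * κ / Λ) with hτ
  have hτ0 : 0 < τ := by positivity
  set S := sm + sp + ((d : ℝ) - 1) with hS
  have hd2 : (2 : ℝ) ≤ d := by exact_mod_cast hd
  have hS0 : 0 ≤ S := by rw [hS]; linarith
  have hsb0 : 0 < sb := by linarith
  have hexp : S / ((D : ℝ) / sb) = sb * S / D := by field_simp
  rw [hexp]
  refine exists_le_entropyNumber hD (by positivity) (c := c * (τ * ρ ^ sb) ^ S) (by positivity)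
    fun K hK => ?_
  have hK0 : (0 : ℝ) < K := by exact_mod_cast hK
  have hK1 : (1 : ℝ) ≤ K := by exact_mod_cast hK
  set x : (Fin D → Fin K) → E m := fun α => μ₀ + (s / K) • gridPoint m α with hx
  have hxP : ∀ α, x α ∈ P := by
    intro α
    apply hRP
    rw [mem_closedBall_iff_norm, hx, add_sub_cancel_left, norm_smul,
      Real.norm_of_nonneg (by positivity)]
    refine (mul_le_mul_of_nonneg_left (norm_gridPoint_le α) (by positivity)).trans (le_of_eq ?_)
    rw [hs]
    field_simp
  set r := ρ / K with hr
  have hr0 : 0 < r := by positivity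
  have hr1 : r ≤ 1 := (div_le_self hρ0.le hK1).trans (min_le_left _ _)
  have hxsep : ∀ α β, α ≠ β → 5 * r ≤ ‖x α - x β‖ := by
    intro α β hne
    rw [hx, add_sub_add_left_eq_sub, ← smul_sub, norm_smul, Real.norm_of_nonneg (by positivity)]
    have h1 := one_le_norm_gridPoint_sub (n := m) hm hne
    calc 5 * r = 5 * ρ / K := by rw [hr]; ring
      _ ≤ s / K * 1 := by rw [mul_one]; gcongr
      _ ≤ _ := by gcongr
  have hJsep : ∀ σ : Finset (Fin D → Fin K), ∀ z ∈ σ.image x, ∀ z' ∈ σ.image x, z ≠ z' →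
      5 * r ≤ ‖z - z'‖ := by
    intro σ z hz z' hz' hne
    obtain ⟨α, _, rfl⟩ := Finset.mem_image.mp hz
    obtain ⟨β, _, rfl⟩ := Finset.mem_image.mp hz'
    exact hxsep α β fun h => hne (by rw [h])
  set a : Finset (Fin D → Fin K) → E m → E (d - 1) := fun σ μ =>
    (κ * r ^ sb) • (bumpSum (σ.image x) r μ • e) with ha
  have hφcd : ∀ σ : Finset (Fin D → Fin K), ContDiff ℝ (⌊sb⌋₊ + 1 : ℕ)
      (fun μ => bumpSum (σ.image x) r μ • e) := fun σ =>
    (contDiff_bumpSum _ r).smul contDiff_const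
  have hacd : ∀ σ, ContDiff ℝ (⌊sb⌋₊ + 1 : ℕ) (a σ) := fun σ => (hφcd σ).const_smul _
  have haD : ∀ σ, ∀ j ≤ ⌊sb⌋₊ + 1, ∀ μ,
      ‖iteratedFDeriv ℝ j (a σ) μ‖ ≤ ε * r ^ sb / r ^ j := by
    intro σ j hj μ
    have hj' : ContDiff ℝ j (bumpSum (σ.image x) r) := contDiff_bumpSum _ r
    have h1 : ‖iteratedFDeriv ℝ j (fun μ => bumpSum (σ.image x) r μ • e) μ‖ ≤ B / r ^ j := by
      have h2 := (ContinuousLinearMap.toSpanSingleton ℝ e).norm_iteratedFDeriv_comp_left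
        (hj'.contDiffAt (x := μ)) (le_refl (j : WithTop ℕ∞))
      rw [ContinuousLinearMap.norm_toSpanSingleton, he, one_mul] at h2
      exact h2.trans (hB _ r hr0 (hJsep σ) j hj μ)
    simp only [ha]
    rw [iteratedFDeriv_const_smul_apply' ((hφcd σ).of_le (by exact_mod_cast hj)).contDiffAt,
      norm_smul, Real.norm_of_nonneg (by positivity)]
    refine (mul_le_mul_of_nonneg_left h1 (by positivity)).trans (le_of_eq ?_)
    rw [hκ]
    field_simp
  have hamem : ∀ σ, ∀ α ∈ σ, a σ (x α) = (κ * r ^ sb) • e := by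
    intro σ α hα
    have h1 : bumpSum (σ.image x) r (x α) = 1 := by
      refine bumpSum_eq_one hr0 (Finset.mem_image_of_mem x hα) fun z hz hne => ?_
      have := hJsep σ (x α) (Finset.mem_image_of_mem x hα) z hz hne.symm
      linarith
    simp only [ha, h1, one_smul]
  have hanot : ∀ σ, ∀ α ∉ σ, a σ (x α) = 0 := by
    intro σ α hα
    have h1 : bumpSum (σ.image x) r (x α) = 0 := by
      refine bumpSum_eq_zero hr0 fun z hz => ?_
      obtain ⟨β, hβ, rfl⟩ := Finset.mem_image.mp hz
      have := hxsep α β fun h => hα (h ▸ hβ)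
      linarith
    simp only [ha, h1, zero_smul, smul_zero]
  -- The perturbation moves the entry point by an amount of order `r ^ sb`; this is, up to a
  -- constant, the largest inflow bump that such a shift can still miss.
  set h := τ * r ^ sb with hh
  have hh0 : 0 < h := by positivity
  have hhh₀ : h ≤ h₀ := (mul_le_of_le_one_right hτ0.le
    (Real.rpow_le_one hr0.le hr1 hsb0.le)).trans (min_le_left _ _)
  have hfam : ∀ σ : Finset (Fin D → Fin K), ∃ q ∈ qoiClass A sm sp sb p Cb P,
      ∃ q₀ : E m → ℝ, ContinuousOn q₀ P ∧ q =ᵐ[volume.restrict P] q₀ ∧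
        (∀ α ∈ σ, c * h ^ S ≤ q₀ (x α)) ∧ ∀ α ∉ σ, q₀ (x α) = 0 := by
    intro σ
    -- The field is perturbed on the complement of `σ`: at unperturbed parameters the line through
    -- the base point starts at the inflow bump, at perturbed ones it misses the bump.
    obtain ⟨haρ, q, hq, q₀, hq₀c, hqq₀, hq1, hq0⟩ := H (a σᶜ) r h {T.entry 0 0} (hacd _) hr0 hr1
      (haD _) hh0 hhh₀ (fun z hz z' hz' hne => absurd
        ((Finset.mem_singleton.mp hz).trans (Finset.mem_singleton.mp hz').symm) hne)
    refine ⟨q, hq, q₀, hq₀c, hqq₀, fun α hα => hq1 _ ?_, fun α hα => hq0 _ fun z hz => ?_⟩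
    · rw [hanot _ _ (by simpa using hα)]
      exact Finset.mem_singleton_self _
    · have hα' : α ∈ σᶜ := by simpa using hα
      rw [Finset.mem_singleton.mp hz]
      refine le_trans ?_ (le_norm_entry_sub zero_norm_lt (haρ _))
      rw [hamem _ _ hα', zero_sub, norm_neg, norm_smul, he, mul_one,
        Real.norm_of_nonneg (by positivity)]
      have h2 : Λ * τ ≤ T.ℓ / 2 * κ := by
        have := min_le_right h₀ (T.ℓ / 2 * κ / Λ)
        rw [← hτ, le_div_iff₀ hΛ] at this
        linarith
      calc Λ * h = Λ * τ * r ^ sb := by rw [hh]; ring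
        _ ≤ T.ℓ / 2 * κ * r ^ sb := by gcongr
        _ = _ := by ring
  choose q hq q₀ hq₀c hqq₀ hq1 hq0 using hfam
  refine ⟨q, hq, fun σ σ' hne => ?_⟩
  have hval : c * (τ * ρ ^ sb) ^ S * (K : ℝ) ^ (-(sb * S)) = c * h ^ S := by
    rw [hh, hr, Real.div_rpow hρ0.le hK0.le, ← mul_div_assoc,
      Real.div_rpow (by positivity) (by positivity), ← Real.rpow_mul hK0.le, Real.rpow_neg hK0.le]
    ring
  rw [hval]
  exact ofReal_le_edist_of_indicator hP hxP hne (hq₀c σ) (hq₀c σ') (hqq₀ σ) (hqq₀ σ') (hq1 σ)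
    (hq0 σ) (hq1 σ') (hq0 σ')

end TubeFamily

/-! ### Combination of the two lower bounds -/

theorem IsReferenceMap.nonempty {d : ℕ} {s : ℝ} {Ω : Set (E d)} {Ξ : ℝ × E (d - 1) → E d}
    (hΞ : IsReferenceMap s Ω Ξ) : Ω.Nonempty := by
  have h0 : ((0 : ℝ), (0 : E (d - 1))) ∈ referenceDomain d :=
    ⟨⟨le_rfl, zero_le_one⟩, fun i => by simp⟩
  exact closure_nonempty_iff.mp ⟨_, hΞ.mapsTo h0⟩

end

end TransportROM

open TransportROM
theorem mainTheorem2 {d k : ℕ} (hd : 2 ≤ d) (hk : 1 ≤ k)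
    (Ω : Set (E d)) (hΩ : IsOpen Ω) (hΩb : Bornology.IsBounded Ω) (A : BoundaryAtlas k Ω)
    (sb : ℝ) (hsb : 1 ≤ sb)
    (Ξ : ℝ × E (d - 1) → E d) (hΞ : IsReferenceMap sb Ω Ξ) :
    ∃ C₀ : ℝ, 0 < C₀ ∧ ∀ Cb : ℝ, C₀ ≤ Cb →
      ∀ (m D : ℕ), d + D ≤ m + 2 → (1 ≤ D ∨ 3 ≤ d) →
      ∀ P : Set (E m), IsOpen P → P.Nonempty →
      ∀ (sm sp : ℝ), 0 < sm → sm ≤ k → 0 < sp → sp ≤ k →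
      ∀ p : ℝ≥0∞, 1 ≤ p → p ≠ ∞ →
      ∃ c : ℝ, 0 < c ∧ ∀ n : ℕ, 1 ≤ n →
        ENNReal.ofReal
            (c * (n : ℝ) ^ (-((sm + sp + ((d : ℝ) - 1)) / max ((D : ℝ) / sb) ((d : ℝ) - 2)))) ≤
          entropyNumber n (qoiClass A sm sp sb p Cb P) := by
  obtain ⟨T⟩ := exists_tubeFamily (by omega) hk hΩ hΩb hΞ.nonempty A
  -- The fields are small perturbations of a constant unit vector, so the radius `2` is enough.
  refine ⟨2, two_pos, fun Cb hCb m D hm hDd P hP hPne sm sp hsm hsmk hsp hspk p hp _ => ?_⟩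
  have hd2 : (2 : ℝ) ≤ d := by exact_mod_cast hd
  have hsb0 : 0 < sb := by linarith
  rcases le_or_gt ((D : ℝ) / sb) ((d : ℝ) - 2) with h | h
  · rw [max_eq_right h]
    -- For `d = 2` the alternative `1 ≤ D` would give `D / sb > 0 = d - 2`, contrary to the case at
    -- hand.
    have hd3 : 3 ≤ d := by
      rcases hDd with hD | hd3
      · have : (0 : ℝ) < D / sb := by
          have : (0 : ℝ) < D := by exact_mod_cast hD
          positivity
        have h2 : (2 : ℝ) < d := by linarith
        exact_mod_cast h2
      · exact hd3
    exact T.exists_le_entropyNumber_of_data hd3 hk hΩ hΩb A hsb (by omega) hP hPne hsm hsmk hsp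
      hspk hp hCb
  · rw [max_eq_left h.le]
    have hD : 1 ≤ D := by
      rcases Nat.eq_zero_or_pos D with rfl | hD
      · simp at h
        linarith
      · exact hD
    exact T.exists_le_entropyNumber_of_field hd hk hΩ hΩb A hsb hD (by omega) hP hPne hsm hsmk hsp
      hspk hp hCb
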